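/- Consider randomized algorithms on a real random-access machine: it has natural-number cells (with addition, truncated subtraction and comparison) and real cells (with exact $+,-,\times,\div$ and comparison), indirect addressing, and an instruction that draws an independent uniform random number from $[0,1]$; every elementary step costs one unit of time, and there are no roundings of reals to integers. For $\epsilon,\delta>0$, an $(\epsilon,\delta)$-approximation of a number $V\ge 0$ is a random variable $Z$ such that $V/(1+\epsilon)\le Z\le(1+\epsilon)V$ with probability at least $1-\delta$. For $0<p\le 1$ let $\mathcal B(n,p)$ be the distribution of the random $n\times n$ $(0,1)$-matrix with mutually independent entries, each equal to $1$ with probability $p$. There is a randomized algorithm (one fixed program) that takes as input $n$, an $n\times n$ matrix $A$, and real numbers $\epsilon,\delta>0$, with the following two properties. (1) For all $\epsilon,\delta>0$, all $n$ and every $n\times n$ $(0,1)$-matrix $A$ with $\mathrm{per}\,A>0$, its output is an $(\epsilon,\delta)$-approximation of $\mathrm{per}\,A$ (it halts with an output within a factor of $1+\epsilon$ of $\mathrm{per}\,A$ with probability at least $1-\delta$). (2) For any fixed $\alpha>1/2$, $\epsilon,\delta>0$ and $0<p\le 1$ there is a constant $C>0$ such that, for random $A\in\mathcal B(n,p)$,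 with high probability (that is, with probability tending to $1$ as $n\to\infty$) the output is an $(\epsilon,\delta)$-approximation of $\mathrm{per}\,A$ and the expected running time on $A$, over the random choices of the algorithm, is at most $C\,n^{1.5+\alpha/p}$. -/

import Mathlib

open MeasureTheory ProbabilityTheory Filter Topology
open scoped ENNReal

/-! ### A randomized real random-access machine with a step count -/

/-- The memory of the machine: infinitely many cells holding natural numbers and infinitely many
cells holding real numbers. -/
structure Store where
  nat : ℕ → ℕ
  real : ℕ → ℝ

/-- Expressions for natural numbers.  Cells are addressed indirectly: `cell a` is the content of the
natural-number cell whose address is the value of `a`.  There is deliberately no multiplication or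
division of natural numbers and no rounding of reals to integers. -/
inductive NExp
  | lit (k : ℕ)
  | cell (a : NExp)
  | add (a b : NExp)
  | sub (a b : NExp)

/-- Expressions for real numbers: integer constants, memory cells (with address given by a
natural-number expression) and the four arithmetic operations. -/
inductive RExp
  | lit (k : ℕ)
  | cell (a : NExp)
  | add (a b : RExp)
  | sub (a b : RExp)
  | mul (a b : RExp)
  | div (a b : RExp)

/-- Tests: comparison of two natural numbers or of two real numbers. -/
inductive Cond
  | nle (a b : NExp)
  | rle (a b : RExp)

/-- Programs.  A program is a finite object that does not depend on the input. -/
inductive Prog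
  /-- Store the value of `e` in the natural-number cell with address `a`. -/
  | setN (a : NExp) (e : NExp)
  /-- Store the value of `e` in the real cell with address `a`. -/
  | setR (a : NExp) (e : RExp)
  /-- Store a fresh uniform random number from `[0,1]` in the real cell with address `a`. -/
  | rand (a : NExp)
  | skip
  | seq (P Q : Prog)
  | ite (c : Cond) (P Q : Prog)
  /-- While `c` holds, execute `P`. -/
  | loop (c : Cond) (P : Prog)

/-- Value of a natural-number expression (subtraction is truncated at `0`). -/
def NExp.eval (s : Store) : NExp → ℕ
  | lit k => k
  | cell a => s.nat (a.eval s)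
  | add a b => a.eval s + b.eval s
  | sub a b => a.eval s - b.eval s

/-- Value of a real expression, in exact arithmetic (division by `0` gives `0`). -/
noncomputable def RExp.eval (s : Store) : RExp → ℝ
  | lit k => k
  | cell a => s.real (a.eval s)
  | add a b => a.eval s + b.eval s
  | sub a b => a.eval s - b.eval s
  | mul a b => a.eval s * b.eval s
  | div a b => a.eval s / b.eval s

/-- Truth of a test. -/
def Cond.holds (s : Store) : Cond → Prop
  | nle a b => a.eval s ≤ b.eval s
  | rle a b => a.eval s ≤ b.eval s

/-- A configuration: the stack of programs still to be executed, and the memory.  The machine has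
halted when the stack is empty. -/
abbrev Config := List Prog × Store

open Classical in
/-- One step of the machine; `u` is the random number that is available in this step.  Every
assignment, every test and every structural transition counts as one step; since the expressions in a
fixed program have bounded size, this counts elementary operations up to a constant factor. -/
noncomputable def step (u : unitInterval) : Config → Config
  | ([], s) => ([], s)
  | (.setN a e :: K, s) => (K, { s with nat := Function.update s.nat (a.eval s) (e.eval s) })
  | (.setR a e :: K, s) => (K, { s with real := Function.update s.real (a.eval s) (e.eval s) })
  | (.rand a :: K, s) => (K, { s with real := Function.update s.real (a.eval s) (u : ℝ) })
  | (.skip :: K, s) => (K, s)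
  | (.seq P Q :: K, s) => (P :: Q :: K, s)
  | (.ite c P Q :: K, s) => if c.holds s then (P :: K, s) else (Q :: K, s)
  | (.loop c P :: K, s) => if c.holds s then (P :: .loop c P :: K, s) else (K, s)

/-- The configuration after `t` steps of `P` started in memory `s`, where step number `i`
(counted from `0`) may use the random number `ω i`. -/
noncomputable def run (P : Prog) (s : Store) (ω : ℕ → unitInterval) : ℕ → Config
  | 0 => ([P], s)
  | t + 1 => step (ω t) (run P s ω t)

/-- The law of the random numbers: independent and uniform on `[0,1]`. -/
noncomputable def randomness : Measure (ℕ → unitInterval) :=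
  Measure.infinitePi fun _ => (volume : Measure unitInterval)

/-- `P` started in `s` halts, with output (the content of real cell `0`) equal to `x`. -/
def Outputs (P : Prog) (s : Store) (ω : ℕ → unitInterval) (x : ℝ) : Prop :=
  ∃ t, (run P s ω t).1 = [] ∧ (run P s ω t).2.real 0 = x

/-- The number of steps until `P` started in `s` halts, `∞` if it never does. -/
noncomputable def haltTime (P : Prog) (s : Store) (ω : ℕ → unitInterval) : ℝ≥0∞ :=
  ⨅ (t : ℕ) (_ : (run P s ω t).1 = []), (t : ℝ≥0∞)

/-- The expected number of steps of `P` started in `s`. -/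
noncomputable def expectedTime (P : Prog) (s : Store) : ℝ≥0∞ :=
  ∫⁻ ω, haltTime P s ω ∂randomness

/-! ### Approximating the permanent -/

/-- The initial memory on input `(A, ε, δ)`: natural-number cell `0` holds `n`, real cells `0` and
`1` hold `ε` and `δ`, the entries of `A` follow row by row in the real cells `2, …, n² + 1`, and all
other cells hold `0`. -/
noncomputable def inputStore {n : ℕ} (A : Matrix (Fin n) (Fin n) ℝ) (ε δ : ℝ) : Store where
  nat := fun a => if a = 0 then n else 0
  real := fun a =>
    if a = 0 then ε
    else if a = 1 then δ
    else if h : a - 2 < n * n then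
      A (finProdFinEquiv.symm ⟨a - 2, h⟩).1 (finProdFinEquiv.symm ⟨a - 2, h⟩).2
    else 0

/-- On input `(A, ε, δ)`, the program `P` computes an `(ε, δ)`-approximation of the permanent of
`A`: with probability at least `1 - δ` it halts with an output that is within a factor of `1 + ε` of
the permanent. -/
def ApproximatesPermanent (P : Prog) {n : ℕ} (A : Matrix (Fin n) (Fin n) ℝ) (ε δ : ℝ) : Prop :=
  ENNReal.ofReal (1 - δ) ≤ randomness {ω | ∃ x, Outputs P (inputStore A ε δ) ω x ∧
    A.permanent / (1 + ε) ≤ x ∧ x ≤ (1 + ε) * A.permanent}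

/-- The real `(0,1)`-matrix with ones at the places where `X` is true. -/
def zeroOneMatrix {n : ℕ} (X : Fin n → Fin n → Bool) : Matrix (Fin n) (Fin n) ℝ :=
  Matrix.of fun i j => if X i j then 1 else 0

/-- The random matrix model `ℬ(n, p)`: the `n²` entries are independent, each equal to one (true)
with probability `p` and zero (false) with probability `1 - p`. -/
noncomputable def randomMatrix (n : ℕ) (p : unitInterval) : Measure (Fin n → Fin n → Bool) :=
  Measure.pi fun _ => Measure.pi fun _ => bernoulliMeasure true false p

/-! The algorithm is self-reducible rejection sampling driven by a Bregman-type bound. A row with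
`r` ones gets the weight `rowBound r / expSum n`, where `rowBound` grows so that `h * exp (1 / h)`
is at most the next value `nextBound h`, and `expSum n` is a rational lower approximation of e. The
product of these weights bounds the permanent of a minor. A trial goes through the columns and picks
an unused row `k` with probability (bound after removing row `k` and the column) / (bound before).
These probabilities add up to at most one (`prod_decay_mul_sum_pick_le_one`); the missing mass is
rejection. They telescope, so a trial succeeds with probability exactly q = per A / U, where U =
`permBound` (`successProb_eq_sum`, `trialProb_eq`).

Trials are repeated until m successes have occurred, and the output is U m / T, with T the number of
trials. Writing s for the current number of successes, q T - s is a martingale whose final variance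
is m (1 - q), so Chebyshev's inequality makes m > (1 + ε)² / (δ ε²) sufficient. The expected number
of trials is m / q and a trial takes O(n²) steps. Both facts are obtained from potentials in
`IsValue.trials_le`.

For random matrices it remains to bound U / per A by a constant times n^(1/(2p) - 1/2). The
permanent is multiplied by v^(number of ones) with v = exp (-1/(pn)). Without this weight the second
moment computation leaves a factor exp (1/p - 1); with it the moment ratio is at most 1 + o(1)
(`integral_weightedPerm_sq_le_mul`, `tendsto_ratioExponent`), so the weighted permanent is at least
half its mean with high probability. Linearizing `rowBound` at p n bounds U by an expression
containing exactly the inverse weight, which therefore cancels (`permBound_le`, `prod_weights`). The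
term (log r) / 2 in `rowBound_le` produces n^(1/(2p)), and Stirling's formula produces n^(-1/2).

The machine is analysed through bounded functionals Φ of configurations with Φ ≤ r + average of Φ
after one step (`IsValue`). Truncated running time (r = 1) and failure probability (r = 0) are of
this kind, so one analysis of the program, carried out for arbitrary r, serves both. -/

/-! ### Running from an arbitrary configuration -/

/-- The configuration after `t` steps from the configuration `c`. -/
noncomputable def runFrom (c : Config) (ω : ℕ → unitInterval) : ℕ → Config
  | 0 => c
  | t + 1 => step (ω t) (runFrom c ω t)

lemma run_eq_runFrom (P : Prog) (s : Store) (ω : ℕ → unitInterval) (t : ℕ) :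
    run P s ω t = runFrom ([P], s) ω t := by
  induction t with
  | zero => rfl
  | succ t ih => simp only [run, runFrom, ih]

lemma runFrom_succ' (c : Config) (ω : ℕ → unitInterval) (t : ℕ) :
    runFrom c ω (t + 1) = runFrom (step (ω 0) c) (fun i => ω (i + 1)) t := by
  induction t with
  | zero => rfl
  | succ t ih => rw [runFrom, ih, runFrom]

/-! ### Splitting off the first random number -/

/-- Prepend a random number to a sequence of random numbers. -/
def consSeq (x : unitInterval × (ℕ → unitInterval)) : ℕ → unitInterval
  | 0 => x.1
  | i + 1 => x.2 i

lemma measurable_consSeq : Measurable consSeq := by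
  refine measurable_pi_iff.2 fun i => ?_
  cases i with
  | zero => exact measurable_fst
  | succ i => exact (measurable_pi_apply i).comp measurable_snd

instance : IsProbabilityMeasure randomness := by unfold randomness; infer_instance

-- An infinite product measure is determined by its values on finite boxes, and the preimage of a
-- box under `consSeq` is a product of a set for coordinate 0 and a box for the shifted coordinates.
open Classical in
lemma map_consSeq :
    ((volume : Measure unitInterval).prod randomness).map consSeq = randomness := by
  conv_rhs => rw [randomness]
  refine Measure.eq_infinitePi _ fun s t ht => ?_
  have hpre : consSeq ⁻¹' (Set.pi s t) =
      (if 0 ∈ s then t 0 else Set.univ) ×ˢ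
        (Set.pi (s.preimage Nat.succ (Nat.succ_injective.injOn)) fun i => t (i + 1)) := by
    ext ⟨u, ω⟩
    simp only [Set.mem_preimage, Set.mem_pi, Set.mem_prod, Finset.mem_coe, Finset.mem_preimage]
    constructor
    · intro h
      refine ⟨?_, fun i hi => h (i + 1) hi⟩
      split_ifs with h0
      · exact h 0 h0
      · trivial
    · rintro ⟨h0, h⟩ i hi
      cases i with
      | zero => rw [if_pos hi] at h0; exact h0
      | succ i => exact h i hi
  rw [Measure.map_apply measurable_consSeq
    (MeasurableSet.pi (Finset.countable_toSet s) fun i _ => ht i), hpre, Measure.prod_prod,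
    randomness, Measure.infinitePi_pi _ (fun i _ => ht (i + 1))]
  have hprod : ∏ i ∈ s.preimage Nat.succ (Nat.succ_injective.injOn),
      (volume : Measure unitInterval) (t (i + 1)) =
      ∏ i ∈ s.filter (· ≠ 0), (volume : Measure unitInterval) (t i) := by
    rw [Finset.prod_preimage' Nat.succ s _ (fun i => (volume : Measure unitInterval) (t i))]
    refine Finset.prod_congr ?_ fun _ _ => rfl
    ext i
    simp only [Finset.mem_filter, Set.mem_range, and_congr_right_iff]
    intro _
    constructor
    · rintro ⟨j, rfl⟩; exact Nat.succ_ne_zero j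
    · intro h; exact ⟨i - 1, Nat.succ_pred_eq_of_ne_zero h⟩
  rw [hprod]
  by_cases h0 : 0 ∈ s
  · rw [if_pos h0, Finset.filter_ne', Finset.mul_prod_erase s
      (fun i => (volume : Measure unitInterval) (t i)) h0]
  · rw [if_neg h0, measure_univ, one_mul, Finset.filter_ne', Finset.erase_eq_of_notMem h0]

/-- The integral of an arbitrary function is the supremum over its measurable minorants, and Tonelli
applies to each of these. Since only upper bounds are needed, this direction makes it unnecessary to
prove that halting times and outputs are measurable. -/
lemma lintegral_prod_le_iterated {α β : Type*} [MeasurableSpace α] [MeasurableSpace β]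
    (μ : Measure α) (ν : Measure β) [SFinite ν] (f : α × β → ℝ≥0∞) :
    ∫⁻ z, f z ∂(μ.prod ν) ≤ ∫⁻ x, ∫⁻ y, f (x, y) ∂ν ∂μ := by
  rw [← iSup_lintegral_measurable_le_eq_lintegral]
  refine iSup₂_le fun g hg => iSup_le fun hle => ?_
  rw [lintegral_prod _ hg.aemeasurable]
  exact lintegral_mono fun x => lintegral_mono fun y => hle (x, y)

lemma lintegral_randomness_le (f : (ℕ → unitInterval) → ℝ≥0∞) :
    ∫⁻ ω, f ω ∂randomness ≤ ∫⁻ u : unitInterval, ∫⁻ ω, f (consSeq (u, ω)) ∂randomness := by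
  conv_lhs => rw [← map_consSeq]
  exact (lintegral_map_le _ _).trans (lintegral_prod_le_iterated _ _ _)

/-! ### Value functions -/

/-- A bounded functional of configurations which grows by at most `r` on average in each step. -/
structure IsValue (r : ℝ≥0∞) (Φ : Config → ℝ≥0∞) : Prop where
  step_le : ∀ p K s, Φ (p :: K, s) ≤ r + ∫⁻ u : unitInterval, Φ (step u (p :: K, s))
  bounded : ∃ B : ℝ≥0∞, B ≠ ⊤ ∧ ∀ c, Φ c ≤ B

/-- A pathwise inequality between a run and the run after its first step becomes an averaged one
once the first random number is split off. -/
lemma isValue_lintegral {r B : ℝ≥0∞} (hB : B ≠ ⊤) (F : Config → (ℕ → unitInterval) → ℝ≥0∞)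
    (hF : ∀ c ω, F c ω ≤ B)
    (hstep : ∀ p K s ω, F (p :: K, s) ω ≤ r + F (step (ω 0) (p :: K, s)) fun i => ω (i + 1)) :
    IsValue r fun c => ∫⁻ ω, F c ω ∂randomness where
  step_le p K s := by
    refine (lintegral_randomness_le _).trans ?_
    calc ∫⁻ u : unitInterval, ∫⁻ ω, F (p :: K, s) (consSeq (u, ω)) ∂randomness
        ≤ ∫⁻ u : unitInterval, (r + ∫⁻ ω, F (step u (p :: K, s)) ω ∂randomness) := by
          refine lintegral_mono fun u => ?_
          refine (lintegral_mono fun ω => hstep p K s (consSeq (u, ω))).trans ?_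
          rw [lintegral_add_left measurable_const]
          simp [consSeq]
      _ = _ := by rw [lintegral_add_left measurable_const]; simp
  bounded := ⟨B, hB, fun c => (lintegral_mono (hF c)).trans (by simp)⟩

/-- The number of steps until the machine halts. -/
noncomputable def haltTimeFrom (c : Config) (ω : ℕ → unitInterval) : ℝ≥0∞ :=
  ⨅ (t : ℕ) (_ : (runFrom c ω t).1 = []), (t : ℝ≥0∞)

lemma haltTimeFrom_le_step (c : Config) (ω : ℕ → unitInterval) :
    haltTimeFrom c ω ≤ 1 + haltTimeFrom (step (ω 0) c) fun i => ω (i + 1) := by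
  unfold haltTimeFrom
  rw [ENNReal.add_iInf]
  refine le_iInf fun t => ?_
  by_cases h : (runFrom (step (ω 0) c) (fun i => ω (i + 1)) t).1 = []
  · rw [iInf_pos h]
    refine (iInf₂_le (t + 1) (by rwa [runFrom_succ'])).trans ?_
    push_cast
    rw [add_comm]
  · simp [h]

/-- Truncation supplies the boundedness in `IsValue`; it survives a step because the bound `1 + N`
on the right exceeds `N`. -/
lemma isValue_truncatedTime (N : ℕ) :
    IsValue 1 fun c => ∫⁻ ω, min (haltTimeFrom c ω) N ∂randomness := by
  refine isValue_lintegral (B := N) (by simp) _ (fun c ω => min_le_right _ _) fun p K s ω => ?_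
  calc min (haltTimeFrom (p :: K, s) ω) N
      ≤ min (1 + haltTimeFrom (step (ω 0) (p :: K, s)) fun i => ω (i + 1)) (1 + N) :=
        min_le_min (haltTimeFrom_le_step _ _) le_add_self
    _ = _ := by rw [min_add_add_left]

/-- Monotone convergence without measurability: a finite-valued simple function below `f` is
bounded, hence lies below `min f N` for some `N`. -/
lemma lintegral_le_of_forall_min_le {α : Type*} [MeasurableSpace α] (μ : Measure α)
    (f : α → ℝ≥0∞) (b : ℝ≥0∞) (h : ∀ N : ℕ, ∫⁻ a, min (f a) N ∂μ ≤ b) : ∫⁻ a, f a ∂μ ≤ b := by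
  rw [lintegral_eq_nnreal]
  refine iSup₂_le fun φ hφ => ?_
  obtain ⟨C, hC⟩ := (φ.finite_range).bddAbove
  obtain ⟨N, hN⟩ := exists_nat_ge C
  refine le_trans ?_ (h N)
  rw [← SimpleFunc.lintegral_eq_lintegral]
  refine lintegral_mono fun a => le_min (hφ a) ?_
  have : φ a ≤ N := (hC ⟨a, rfl⟩).trans hN
  simp only [SimpleFunc.map_apply]
  exact_mod_cast this

lemma expectedTime_le_of_value {P : Prog} {s : Store} {b : ℝ≥0∞}
    (h : ∀ Φ, IsValue 1 Φ → (∀ s, Φ ([], s) = 0) → Φ ([P], s) ≤ b) : expectedTime P s ≤ b := by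
  refine lintegral_le_of_forall_min_le _ _ _ fun N => ?_
  have := h _ (isValue_truncatedTime N) fun s => ?_
  · refine le_trans (le_of_eq ?_) this
    simp only [haltTime, haltTimeFrom, run_eq_runFrom]
  · have h0 : ∀ ω, min (haltTimeFrom ([], s) ω) N = 0 := fun ω => by
      have : haltTimeFrom ([], s) ω ≤ ((0 : ℕ) : ℝ≥0∞) :=
        iInf₂_le (f := fun t (_ : (runFrom ([], s) ω t).1 = []) => (t : ℝ≥0∞)) 0 rfl
      exact le_antisymm ((min_le_left _ _).trans (this.trans (by simp))) zero_le
    simp only [h0, lintegral_zero]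

-- The functional here is the integral of the indicator of failure, where not halting counts as
-- failure; failing from a configuration implies failing after its first step, so the cost per step
-- is 0.
open Classical in
lemma le_measure_outputs_of_value {P : Prog} {s : Store} {S : Set ℝ} {δ : ℝ} (hδ : 0 ≤ δ)
    (h : ∀ Φ, IsValue 0 Φ → (∀ c, Φ c ≤ 1) → (∀ s : Store, s.real 0 ∈ S → Φ ([], s) = 0) →
      Φ ([P], s) ≤ ENNReal.ofReal δ) :
    ENNReal.ofReal (1 - δ) ≤ randomness {ω | ∃ x, Outputs P s ω x ∧ x ∈ S} := by
  let G : Config → (ℕ → unitInterval) → Prop := fun c ω =>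
    ∃ t, (runFrom c ω t).1 = [] ∧ (runFrom c ω t).2.real 0 ∈ S
  let F : Config → (ℕ → unitInterval) → ℝ≥0∞ := fun c ω => if G c ω then 0 else 1
  have hF1 : ∀ c ω, F c ω ≤ 1 := fun c ω => by simp only [F]; split_ifs <;> simp
  have hval : IsValue 0 fun c => ∫⁻ ω, F c ω ∂randomness := by
    refine isValue_lintegral ENNReal.one_ne_top F hF1 fun p K s ω => ?_
    rw [zero_add]
    simp only [F]
    split_ifs with h1 h2 h2
    · exact le_rfl
    · exact zero_le_one
    · exfalso
      obtain ⟨t, ht⟩ := h2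
      exact h1 ⟨t + 1, by rwa [runFrom_succ']⟩
    · exact le_rfl
  have hb := h _ hval (fun c => (lintegral_mono (hF1 c)).trans (by simp)) fun s hs => by
    have : ∀ ω, F ([], s) ω = 0 := fun ω => if_pos ⟨0, rfl, hs⟩
    simp [this]
  have hset : {ω | ∃ x, Outputs P s ω x ∧ x ∈ S} = {ω | G ([P], s) ω} := by
    ext ω
    simp only [Set.mem_ofPred_eq, Outputs, G, run_eq_runFrom]
    constructor
    · rintro ⟨x, ⟨t, ht, rfl⟩, hx⟩; exact ⟨t, ht, hx⟩
    · rintro ⟨t, ht, hx⟩; exact ⟨_, ⟨t, ht, rfl⟩, hx⟩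
  rw [hset]
  -- The success event need not be measurable. Its measurable hull has the same measure, and the
  -- complement of the hull consists of failures only.
  set E := toMeasurable randomness {ω | G ([P], s) ω} with hE
  have hEm : MeasurableSet E := measurableSet_toMeasurable _ _
  have hc : randomness Eᶜ ≤ ENNReal.ofReal δ := by
    rw [← lintegral_indicator_one hEm.compl]
    refine (lintegral_mono fun ω => ?_).trans hb
    by_cases hω : ω ∈ Eᶜ
    · have : ¬ G ([P], s) ω := fun hG => hω (subset_toMeasurable _ _ hG)
      simp [F, this, Set.indicator_of_mem hω]
    · simp [Set.indicator_of_notMem hω]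
  rw [← measure_toMeasurable, ← hE, ENNReal.ofReal_sub _ hδ, ENNReal.ofReal_one]
  rw [tsub_le_iff_right]
  calc (1 : ℝ≥0∞) = randomness E + randomness Eᶜ := by
        rw [measure_add_measure_compl hEm, measure_univ]
    _ ≤ _ := by gcongr

/-! ### Deterministic program fragments -/

/-- `P` started in `s` uses no random numbers and ends in `s'` after `t` steps. -/
inductive Exec : Prog → Store → ℕ → Store → Prop
  | setN (a e : NExp) (s : Store) :
      Exec (.setN a e) s 1 { s with nat := Function.update s.nat (a.eval s) (e.eval s) }
  | setR (a : NExp) (e : RExp) (s : Store) :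
      Exec (.setR a e) s 1 { s with real := Function.update s.real (a.eval s) (e.eval s) }
  | skip (s : Store) : Exec .skip s 1 s
  | seq {P Q : Prog} {s s₁ s₂ : Store} {t₁ t₂ : ℕ} :
      Exec P s t₁ s₁ → Exec Q s₁ t₂ s₂ → Exec (.seq P Q) s (t₁ + t₂ + 1) s₂
  | iteTrue {c : Cond} {P Q : Prog} {s s₁ : Store} {t : ℕ} :
      c.holds s → Exec P s t s₁ → Exec (.ite c P Q) s (t + 1) s₁
  | iteFalse {c : Cond} {P Q : Prog} {s s₁ : Store} {t : ℕ} :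
      ¬ c.holds s → Exec Q s t s₁ → Exec (.ite c P Q) s (t + 1) s₁
  | loopDone {c : Cond} {P : Prog} {s : Store} : ¬ c.holds s → Exec (.loop c P) s 1 s
  | loopStep {c : Cond} {P : Prog} {s s₁ s₂ : Store} {t₁ t₂ : ℕ} :
      c.holds s → Exec P s t₁ s₁ → Exec (.loop c P) s₁ t₂ s₂ →
      Exec (.loop c P) s (t₁ + t₂ + 1) s₂

lemma IsValue.le_of_step_eq {r : ℝ≥0∞} {Φ : Config → ℝ≥0∞} (hΦ : IsValue r Φ) {p : Prog}
    {K : List Prog} {s : Store} {c : Config} (h : ∀ u, step u (p :: K, s) = c) :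
    Φ (p :: K, s) ≤ r + Φ c := by
  refine (hΦ.step_le p K s).trans ?_
  simp [h]

/-- A step that ignores the random number averages over a constant, so each step costs `r`. The
arbitrary stack `K` allows any continuation. -/
lemma IsValue.exec {r : ℝ≥0∞} {Φ : Config → ℝ≥0∞} (hΦ : IsValue r Φ) {P : Prog} {s s' : Store}
    {t : ℕ} (h : Exec P s t s') : ∀ K, Φ (P :: K, s) ≤ r * t + Φ (K, s') := by
  induction h with
  | setN a e s => intro K; simpa using hΦ.le_of_step_eq (fun u => rfl)
  | setR a e s => intro K; simpa using hΦ.le_of_step_eq (fun u => rfl)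
  | skip s => intro K; simpa using hΦ.le_of_step_eq (fun u => rfl)
  | @seq P Q s s₁ s₂ t₁ t₂ _ _ ih₁ ih₂ =>
    intro K
    calc _ ≤ r + Φ (P :: Q :: K, s) := hΦ.le_of_step_eq (fun u => rfl)
      _ ≤ r + (r * t₁ + (r * t₂ + Φ (K, s₂))) := by
        gcongr
        exact (ih₁ _).trans (by gcongr; exact ih₂ _)
      _ = _ := by push_cast; ring
  | @iteTrue c P Q s s₁ t hc _ ih =>
    intro K
    calc _ ≤ r + Φ (P :: K, s) := hΦ.le_of_step_eq (fun u => by simp [step, hc])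
      _ ≤ r + (r * t + Φ (K, s₁)) := by gcongr; exact ih _
      _ = _ := by push_cast; ring
  | @iteFalse c P Q s s₁ t hc _ ih =>
    intro K
    calc _ ≤ r + Φ (Q :: K, s) := hΦ.le_of_step_eq (fun u => by simp [step, hc])
      _ ≤ r + (r * t + Φ (K, s₁)) := by gcongr; exact ih _
      _ = _ := by push_cast; ring
  | @loopDone c P s hc =>
    intro K; simpa using hΦ.le_of_step_eq (c := (K, s)) (fun u => by simp [step, hc])
  | @loopStep c P s s₁ s₂ t₁ t₂ hc _ _ ih₁ ih₂ =>
    intro K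
    calc _ ≤ r + Φ (P :: .loop c P :: K, s) := hΦ.le_of_step_eq (fun u => by simp [step, hc])
      _ ≤ r + (r * t₁ + (r * t₂ + Φ (K, s₂))) := by
        gcongr
        exact (ih₁ _).trans (by gcongr; exact ih₂ _)
      _ = _ := by push_cast; ring

/-! ### Total correctness with a bound on the steps -/

/-- `P` started in `s` uses no random numbers and ends within `t` steps in a memory satisfying
`Q`. -/
def Ends (P : Prog) (s : Store) (t : ℕ) (Q : Store → Prop) : Prop :=
  ∃ t' ≤ t, ∃ s', Exec P s t' s' ∧ Q s'

lemma Ends.mono {P : Prog} {s : Store} {t t' : ℕ} {Q Q' : Store → Prop} (h : Ends P s t Q)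
    (ht : t ≤ t') (hQ : ∀ s', Q s' → Q' s') : Ends P s t' Q' := by
  obtain ⟨t₁, h₁, s', hs', hq⟩ := h
  exact ⟨t₁, h₁.trans ht, s', hs', hQ _ hq⟩

lemma Ends.setN {a e : NExp} {s : Store} {Q : Store → Prop}
    (h : Q { s with nat := Function.update s.nat (a.eval s) (e.eval s) }) :
    Ends (.setN a e) s 1 Q := ⟨1, le_rfl, _, .setN a e s, h⟩

lemma Ends.setR {a : NExp} {e : RExp} {s : Store} {Q : Store → Prop}
    (h : Q { s with real := Function.update s.real (a.eval s) (e.eval s) }) :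
    Ends (.setR a e) s 1 Q := ⟨1, le_rfl, _, .setR a e s, h⟩

lemma Ends.skip {s : Store} {Q : Store → Prop} (h : Q s) : Ends .skip s 1 Q :=
  ⟨1, le_rfl, _, .skip s, h⟩

/-- Taking termination of the second program as the postcondition of the first gives a
weakest-precondition calculus in which nested programs are treated from the outside in. -/
lemma Ends.seq {P P' : Prog} {s : Store} {t t' : ℕ} {Q : Store → Prop}
    (h : Ends P s t fun s' => Ends P' s' t' Q) : Ends (.seq P P') s (t + t' + 1) Q := by
  obtain ⟨t₁, h₁, s₁, e₁, t₂, h₂, s₂, e₂, hq⟩ := h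
  exact ⟨_, by omega, s₂, .seq e₁ e₂, hq⟩

lemma Ends.ite {c : Cond} {P P' : Prog} {s : Store} {t : ℕ} {Q : Store → Prop}
    (h₁ : c.holds s → Ends P s t Q) (h₂ : ¬ c.holds s → Ends P' s t Q) :
    Ends (.ite c P P') s (t + 1) Q := by
  by_cases hc : c.holds s
  · obtain ⟨t', ht', s', e, hq⟩ := h₁ hc
    exact ⟨_, by omega, s', .iteTrue hc e, hq⟩
  · obtain ⟨t', ht', s', e, hq⟩ := h₂ hc
    exact ⟨_, by omega, s', .iteFalse hc e, hq⟩

lemma Ends.loopDone {c : Cond} {P : Prog} {s : Store} {t : ℕ} {Q : Store → Prop}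
    (hc : ¬ c.holds s) (hq : Q s) : Ends (.loop c P) s (t + 1) Q :=
  ⟨1, by omega, s, .loopDone hc, hq⟩

lemma Ends.loopStep {c : Cond} {P : Prog} {s : Store} {t t' : ℕ} {Q : Store → Prop}
    (hc : c.holds s) (h : Ends P s t fun s' => Ends (.loop c P) s' t' Q) :
    Ends (.loop c P) s (t + t' + 1) Q := by
  obtain ⟨t₁, h₁, s₁, e₁, t₂, h₂, s₂, e₂, hq⟩ := h
  exact ⟨_, by omega, s₂, .loopStep hc e₁ e₂, hq⟩

/-- A counting loop with `m` rounds and invariant `I`. -/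
lemma Ends.loop {c : Cond} {P : Prog} {s : Store} {t m : ℕ} (I : ℕ → Store → Prop)
    (h0 : I 0 s) (hstep : ∀ i < m, ∀ s, I i s → c.holds s ∧ Ends P s t (I (i + 1)))
    (hdone : ∀ s, I m s → ¬ c.holds s) : Ends (.loop c P) s (m * (t + 1) + 1) (I m) := by
  suffices h : ∀ d i, i + d = m → ∀ s, I i s → Ends (.loop c P) s (d * (t + 1) + 1) (I m) from
    h m 0 (by omega) s h0
  intro d
  induction d with
  | zero =>
    intro i hi s hs
    obtain rfl : i = m := by omega
    exact (Ends.loopDone (t := 0) (hdone s hs) hs).mono (by omega) fun _ h => h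
  | succ d ih =>
    intro i hi s hs
    obtain ⟨hc, hb⟩ := hstep i (by omega) s hs
    refine (Ends.loopStep hc (hb.mono le_rfl fun s' hs' => ih (i + 1) (by omega) s' hs')).mono
      ?_ fun _ h => h
    rw [Nat.succ_mul]
    omega

lemma IsValue.ends {r : ℝ≥0∞} {Φ : Config → ℝ≥0∞} (hΦ : IsValue r Φ) {P : Prog} {s : Store}
    {t : ℕ} {Q : Store → Prop} {K : List Prog} {b : ℝ≥0∞} (h : Ends P s t Q)
    (hb : ∀ s', Q s' → Φ (K, s') ≤ b) : Φ (P :: K, s) ≤ r * t + b := by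
  obtain ⟨t', ht', s', e, hq⟩ := h
  exact (hΦ.exec e K).trans (by gcongr; exact hb s' hq)

lemma IsValue.seq_le {r : ℝ≥0∞} {Φ : Config → ℝ≥0∞} (hΦ : IsValue r Φ) (P Q : Prog)
    (K : List Prog) (s : Store) : Φ (.seq P Q :: K, s) ≤ r + Φ (P :: Q :: K, s) :=
  hΦ.le_of_step_eq fun _ => rfl

lemma IsValue.loop_le {r : ℝ≥0∞} {Φ : Config → ℝ≥0∞} (hΦ : IsValue r Φ) {c : Cond} {P : Prog}
    {K : List Prog} {s : Store} (hc : c.holds s) :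
    Φ (.loop c P :: K, s) ≤ r + Φ (P :: .loop c P :: K, s) :=
  hΦ.le_of_step_eq fun _ => by simp [step, hc]

lemma IsValue.loop_done_le {r : ℝ≥0∞} {Φ : Config → ℝ≥0∞} (hΦ : IsValue r Φ) {c : Cond}
    {P : Prog} {K : List Prog} {s : Store} (hc : ¬ c.holds s) :
    Φ (.loop c P :: K, s) ≤ r + Φ (K, s) :=
  hΦ.le_of_step_eq fun _ => by simp [step, hc]

lemma IsValue.rand_le {r : ℝ≥0∞} {Φ : Config → ℝ≥0∞} (hΦ : IsValue r Φ) (a : NExp)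
    (K : List Prog) (s : Store) : Φ (.rand a :: K, s) ≤ r + ∫⁻ u : unitInterval,
      Φ (K, { s with real := Function.update s.real (a.eval s) (u : ℝ) }) :=
  hΦ.step_le _ _ _

/-! ### The row bound -/

/-- The recursion of the row bound. -/
noncomputable def nextBound (h : ℝ) : ℝ := h + 1 + 1 / (2 * h) + 1 / (h * h)

/-- The bound for a row with `r` ones, up to normalization. -/
noncomputable def rowBound : ℕ → ℝ
  | 0 => 1
  | r + 1 => nextBound (rowBound r)

lemma add_one_le_rowBound (r : ℕ) : (r : ℝ) + 1 ≤ rowBound r := by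
  induction r with
  | zero => simp [rowBound]
  | succ r ih =>
    have : 0 < rowBound r := lt_of_lt_of_le (by positivity) ih
    have h1 : 0 < 1 / (2 * rowBound r) := by positivity
    have h2 : 0 < 1 / (rowBound r * rowBound r) := by positivity
    simp only [rowBound, nextBound]
    push_cast
    linarith

lemma one_le_rowBound (r : ℕ) : 1 ≤ rowBound r :=
  le_trans (by have : (0 : ℝ) ≤ r := r.cast_nonneg
               linarith) (add_one_le_rowBound r)

lemma rowBound_pos (r : ℕ) : 0 < rowBound r := zero_lt_one.trans_le (one_le_rowBound r)

/-- The recursion is made for this inequality: h exp (1/h) = h + 1 + 1/(2h) + ..., and for h ≥ 1 the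
remaining terms are at most 1/h². -/
lemma rowBound_mul_exp_le (r : ℕ) : rowBound r * Real.exp (1 / rowBound r) ≤ rowBound (r + 1) := by
  have h1 := one_le_rowBound r
  have hp := rowBound_pos r
  set h := rowBound r with hh
  have hx0 : 0 ≤ 1 / h := by positivity
  have hx1 : 1 / h ≤ 1 := by rw [div_le_one hp]; exact h1
  have he := Real.exp_bound' hx0 hx1 (n := 3) (by norm_num)
  simp only [Finset.sum_range_succ, Finset.sum_range_zero, Nat.factorial] at he
  norm_num at he
  have hle : Real.exp (1 / h) ≤ 1 + 1 / h + (1 / h) ^ 2 / 2 + (1 / h) ^ 3 := by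
    have : 0 ≤ (1 / h) ^ 3 := by positivity
    have e2 : (h ^ 2)⁻¹ = (1 / h) ^ 2 := by rw [one_div, inv_pow]
    have e3 : (h ^ 3)⁻¹ = (1 / h) ^ 3 := by rw [one_div, inv_pow]
    rw [e2, e3, ← one_div] at he
    linarith
  calc h * Real.exp (1 / h) ≤ h * (1 + 1 / h + (1 / h) ^ 2 / 2 + (1 / h) ^ 3) := by gcongr
    _ = rowBound (r + 1) := by
      rw [rowBound, ← hh, nextBound]
      field_simp

lemma rowBound_le (r : ℕ) (hr : 1 ≤ r) :
    rowBound r ≤ r + Real.log r / 2 + 7 / 2 := by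
  -- Since `rowBound r ≥ r + 1`, the increments 1/(2h) add up to at most half a harmonic number, and
  -- the increments 1/h² to at most the telescoping sum 2 - 2/(r + 1).
  have key : ∀ r : ℕ, rowBound r ≤ r + 1 + (harmonic r : ℝ) / 2 + (2 - 2 / ((r : ℝ) + 1)) := by
    intro r
    induction r with
    | zero => norm_num [rowBound]
    | succ r ih =>
      have h1 := add_one_le_rowBound r
      have hp := rowBound_pos r
      have hr0 : (0 : ℝ) < (r : ℝ) + 1 := by positivity
      have e1 : 1 / (2 * rowBound r) ≤ 1 / (2 * ((r : ℝ) + 1)) := by gcongr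
      have e2 : 1 / (rowBound r * rowBound r) ≤ 1 / (((r : ℝ) + 1) * ((r : ℝ) + 1)) := by gcongr
      rw [rowBound, nextBound, harmonic_succ]
      push_cast
      have e3 : 1 / (2 * ((r : ℝ) + 1)) = ((r : ℝ) + 1)⁻¹ / 2 := by field_simp
      -- With a = r + 1 ≥ 1, half of 1/a² is at most 1/(a(a + 1)) = 1/a - 1/(a + 1).
      have e4 : 1 / (((r : ℝ) + 1) * ((r : ℝ) + 1)) ≤ 1 / ((r : ℝ) + 1) -
          1 / ((r : ℝ) + 1 + 1) + 1 / (((r : ℝ) + 1) * ((r : ℝ) + 1)) / 2 := by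
        rw [div_sub_div _ _ (by positivity) (by positivity), ← sub_nonneg]
        have : (1 * ((r : ℝ) + 1 + 1) - ((r : ℝ) + 1) * 1) / (((r : ℝ) + 1) * ((r : ℝ) + 1 + 1)) +
            1 / (((r : ℝ) + 1) * ((r : ℝ) + 1)) / 2 - 1 / (((r : ℝ) + 1) * ((r : ℝ) + 1)) =
            (r : ℝ) / (2 * ((r : ℝ) + 1) * ((r : ℝ) + 1) * ((r : ℝ) + 1 + 1)) := by
          field_simp
          ring
        rw [this]
        positivity
      have e5 : 1 / (((r : ℝ) + 1) * ((r : ℝ) + 1)) ≤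
          2 * (1 / ((r : ℝ) + 1) - 1 / ((r : ℝ) + 1 + 1)) := by linarith
      have e6 : 2 / ((r : ℝ) + 1) = 2 * (1 / ((r : ℝ) + 1)) := by ring
      have e7 : 2 / ((r : ℝ) + 1 + 1) = 2 * (1 / ((r : ℝ) + 1 + 1)) := by ring
      rw [e6] at ih
      rw [e7]
      linarith
  have hH : (harmonic r : ℝ) ≤ 1 + Real.log r := harmonic_le_one_add_log r
  have : 0 < 2 / ((r : ℝ) + 1) := by positivity
  linarith [key r]

/-! ### A computable substitute for e -/

/-- Partial sums of the series for `e`. -/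
noncomputable def expSum (n : ℕ) : ℝ := ∑ i ∈ Finset.range (n + 1), 1 / (i.factorial : ℝ)

lemma one_le_expSum (n : ℕ) : 1 ≤ expSum n := by
  unfold expSum
  rw [Finset.sum_range_succ']
  have : 0 ≤ ∑ k ∈ Finset.range n, 1 / ((k + 1).factorial : ℝ) :=
    Finset.sum_nonneg fun _ _ => by positivity
  simpa using this

lemma expSum_pos (n : ℕ) : 0 < expSum n := zero_lt_one.trans_le (one_le_expSum n)

lemma expSum_le_exp (n : ℕ) : expSum n ≤ Real.exp 1 := by
  simpa [expSum] using Real.sum_le_exp_of_nonneg zero_le_one (n + 1)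

/-- The relative error of the partial sum is at most 2/(n + 1), so replacing e by `expSum n` in all
n rows costs at most the constant factor exp 2. -/
lemma exp_le_expSum_pow (n : ℕ) : Real.exp n ≤ expSum n ^ n * Real.exp 2 := by
  have hb := Real.exp_bound' zero_le_one le_rfl (n := n + 1) (by omega)
  have h1 : Real.exp 1 ≤ expSum n * (1 + 2 / ((n : ℝ) + 1)) := by
    have hc := one_le_expSum n
    have : (1 : ℝ) ^ (n + 1) * (((n + 1 : ℕ) : ℝ) + 1) / (((n + 1).factorial : ℝ) * (n + 1 : ℕ))
        ≤ 2 / ((n : ℝ) + 1) := by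
      have hf : (1 : ℝ) ≤ ((n + 1).factorial : ℝ) := by exact_mod_cast Nat.factorial_pos (n + 1)
      have hf2 : ((n : ℝ) + 1) ≤ ((n + 1).factorial : ℝ) := by
        exact_mod_cast Nat.self_le_factorial (n + 1)
      push_cast
      rw [one_pow, one_mul, div_le_div_iff₀ (by positivity) (by positivity)]
      have hn : (0 : ℝ) ≤ n := n.cast_nonneg
      nlinarith [mul_nonneg hn hn]
    have h2 : 0 < 2 / ((n : ℝ) + 1) := by positivity
    have h3 : expSum n = ∑ m ∈ Finset.range (n + 1), (1 : ℝ) ^ m / m.factorial := by simp [expSum]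
    rw [← h3] at hb
    nlinarith
  have h2 : 1 + 2 / ((n : ℝ) + 1) ≤ Real.exp (2 / ((n : ℝ) + 1)) := by
    rw [add_comm]; exact Real.add_one_le_exp _
  have hpos := expSum_pos n
  calc Real.exp n = Real.exp 1 ^ n := by rw [← Real.exp_nat_mul, mul_one]
    _ ≤ (expSum n * Real.exp (2 / ((n : ℝ) + 1))) ^ n := by
      gcongr
      exact h1.trans (by gcongr)
    _ = expSum n ^ n * Real.exp (n * (2 / ((n : ℝ) + 1))) := by rw [mul_pow, ← Real.exp_nat_mul]
    _ ≤ _ := by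
      gcongr
      rw [mul_div_assoc', div_le_iff₀ (by positivity)]
      linarith

/-! ### The weights of the sampling procedure -/

/-- The number of ones of row `k` in the columns `j, …, n - 1`. -/
def onesFrom (B : ℕ → ℕ → Bool) (n k j : ℕ) : ℕ := ((Finset.Ico j n).filter fun l => B k l).card

lemma onesFrom_self (B : ℕ → ℕ → Bool) (n k : ℕ) : onesFrom B n k n = 0 := by simp [onesFrom]

lemma onesFrom_eq (B : ℕ → ℕ → Bool) {n j : ℕ} (k : ℕ) (hj : j < n) :
    onesFrom B n k j = onesFrom B n k (j + 1) + if B k j then 1 else 0 := by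
  unfold onesFrom
  rw [← Finset.insert_Ico_add_one_left_eq_Ico hj, Finset.filter_insert]
  split_ifs with h
  · rw [Finset.card_insert_of_notMem (by simp)]
  · rfl

/-- The factor by which the bound for row `k` decreases when column `j` is removed. -/
noncomputable def decay (B : ℕ → ℕ → Bool) (n k j : ℕ) : ℝ :=
  rowBound (onesFrom B n k (j + 1)) / rowBound (onesFrom B n k j)

/-- The factor by which the bound increases when row `k` is removed together with column `j`,
provided that the entry there is one. -/
noncomputable def pick (B : ℕ → ℕ → Bool) (n k j : ℕ) : ℝ :=
  if B k j then expSum n / rowBound (onesFrom B n k (j + 1)) else 0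

lemma decay_pos (B : ℕ → ℕ → Bool) (n k j : ℕ) : 0 < decay B n k j :=
  div_pos (rowBound_pos _) (rowBound_pos _)

lemma pick_nonneg (B : ℕ → ℕ → Bool) (n k j : ℕ) : 0 ≤ pick B n k j := by
  unfold pick
  split_ifs
  · exact (div_pos (expSum_pos n) (rowBound_pos _)).le
  · exact le_rfl

/-- For an entry one this is `rowBound_mul_exp_le` divided through, as `pick / expSum` is then 1/h.
For an entry zero both sides are 1. -/
lemma decay_le_exp (B : ℕ → ℕ → Bool) {n j : ℕ} (k : ℕ) (hj : j < n) :
    decay B n k j ≤ Real.exp (-(pick B n k j / expSum n)) := by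
  unfold decay pick
  rw [onesFrom_eq B k hj]
  split_ifs with h
  · have h1 := rowBound_mul_exp_le (onesFrom B n k (j + 1))
    have hp := rowBound_pos (onesFrom B n k (j + 1))
    have hc := expSum_pos n
    rw [div_div_cancel_left' hc.ne', ← one_div, Real.exp_neg,
      div_le_iff₀ (rowBound_pos _), ← div_eq_inv_mul, le_div_iff₀ (Real.exp_pos _)]
    exact h1
  · simp [(rowBound_pos _).ne']

/-- The selection probabilities add up to at most one. -/
lemma prod_decay_mul_sum_pick_le_one (B : ℕ → ℕ → Bool) {n j : ℕ} (hj : j < n) (R : Finset ℕ) :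
    (∏ k ∈ R, decay B n k j) * ∑ k ∈ R, pick B n k j ≤ 1 := by
  have hc := expSum_pos n
  set t := ∑ k ∈ R, pick B n k j / expSum n with ht
  have hsum : ∑ k ∈ R, pick B n k j = expSum n * t := by
    rw [ht, Finset.mul_sum]
    exact Finset.sum_congr rfl fun k _ => by field_simp
  have ht0 : 0 ≤ t := Finset.sum_nonneg fun k _ => div_nonneg (pick_nonneg _ _ _ _) hc.le
  have hprod : ∏ k ∈ R, decay B n k j ≤ Real.exp (-t) := by
    rw [ht, ← Finset.sum_neg_distrib, Real.exp_sum]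
    exact Finset.prod_le_prod (fun k _ => (decay_pos _ _ _ _).le) fun k _ => decay_le_exp B k hj
  rw [hsum]
  -- The product of the decays is at most exp (-t), while `expSum n ≤ e` and t ≤ exp (t - 1). This
  -- is why e has to be approximated from below.
  calc (∏ k ∈ R, decay B n k j) * (expSum n * t)
      ≤ Real.exp (-t) * (Real.exp 1 * Real.exp (t - 1)) := by
        gcongr
        · exact expSum_le_exp n
        · linarith [Real.add_one_le_exp (t - 1)]
    _ = 1 := by rw [← Real.exp_add, ← Real.exp_add]; simp

/-- The upper bound for the permanent of the minor consisting of the rows in `R` and the columns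
`j, …, n - 1`. -/
noncomputable def minorBound (B : ℕ → ℕ → Bool) (n : ℕ) (R : Finset ℕ) (j : ℕ) : ℝ :=
  ∏ k ∈ R, rowBound (onesFrom B n k j) / expSum n

/-- The permanent of the minor with rows `R` and columns `j, …, j + d - 1`, expanded column by
column. -/
def minorPerm (B : ℕ → ℕ → Bool) : ℕ → Finset ℕ → ℕ → ℝ
  | 0, _, _ => 1
  | d + 1, R, j => ∑ k ∈ R, if B k j then minorPerm B d (R.erase k) (j + 1) else 0

lemma minorBound_pos (B : ℕ → ℕ → Bool) (n : ℕ) (R : Finset ℕ) (j : ℕ) : 0 < minorBound B n R j :=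
  Finset.prod_pos fun _ _ => div_pos (rowBound_pos _) (expSum_pos n)

/-- The probability that the sampling procedure completes a permutation, from column `j` on. -/
noncomputable def successProb (B : ℕ → ℕ → Bool) (n : ℕ) (R : Finset ℕ) (j : ℕ) : ℝ :=
  minorPerm B (n - j) R j / minorBound B n R j

lemma minorPerm_nonneg (B : ℕ → ℕ → Bool) (d : ℕ) : ∀ R j, 0 ≤ minorPerm B d R j := by
  induction d with
  | zero => intro R j; exact zero_le_one
  | succ d ih =>
    intro R j
    exact Finset.sum_nonneg fun k _ => by split_ifs; exacts [ih _ _, le_rfl]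

lemma successProb_nonneg (B : ℕ → ℕ → Bool) (n : ℕ) (R : Finset ℕ) (j : ℕ) :
    0 ≤ successProb B n R j := div_nonneg (minorPerm_nonneg _ _ _ _) (minorBound_pos _ _ _ _).le

lemma successProb_empty (B : ℕ → ℕ → Bool) (n : ℕ) : successProb B n ∅ n = 1 := by
  simp [successProb, minorPerm, minorBound]

/-- The selection probability of row `k` is the quotient of the bounds after and before the choice;
hence the probabilities telescope along a trial. -/
lemma minorBound_erase (B : ℕ → ℕ → Bool) {n j : ℕ} {R : Finset ℕ} {k : ℕ} (hk : k ∈ R)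
    (hB : B k j = true) :
    minorBound B n (R.erase k) (j + 1) =
      (∏ l ∈ R, decay B n l j) * pick B n k j * minorBound B n R j := by
  have h1 : (∏ l ∈ R, decay B n l j) * minorBound B n R j = minorBound B n R (j + 1) := by
    unfold minorBound decay
    rw [← Finset.prod_mul_distrib]
    refine Finset.prod_congr rfl fun l _ => ?_
    have := (rowBound_pos (onesFrom B n l j)).ne'
    field_simp
  rw [mul_right_comm, h1]
  unfold minorBound pick
  rw [if_pos hB, ← Finset.mul_prod_erase R _ hk]
  have := (rowBound_pos (onesFrom B n k (j + 1))).ne'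
  have := (expSum_pos n).ne'
  field_simp

/-- Dividing the column expansion of the permanent by the bound gives the recursion for the success
probability of the sampling process. Rows with a zero in the column contribute nothing, as their
`pick` vanishes. -/
lemma successProb_eq_sum (B : ℕ → ℕ → Bool) {n j : ℕ} (hj : j < n) (R : Finset ℕ) :
    successProb B n R j = ∑ k ∈ R,
      (∏ l ∈ R, decay B n l j) * pick B n k j * successProb B n (R.erase k) (j + 1) := by
  obtain ⟨d, hd⟩ : ∃ d, n - j = d + 1 := ⟨n - j - 1, by omega⟩
  have hd' : n - (j + 1) = d := by omega
  rw [successProb, hd, minorPerm, Finset.sum_div]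
  refine Finset.sum_congr rfl fun k hk => ?_
  split_ifs with hB
  · rw [successProb, hd', minorBound_erase B hk hB]
    have h1 := (minorBound_pos B n R j).ne'
    have h2 : pick B n k j ≠ 0 := by
      rw [pick, if_pos hB]
      exact (div_pos (expSum_pos n) (rowBound_pos _)).ne'
    have h3 : ∏ l ∈ R, decay B n l j ≠ 0 := (Finset.prod_pos fun l _ => decay_pos _ _ _ _).ne'
    field_simp
  · simp [pick, hB]

/-- The success probabilities of the smaller minors are averaged with weights of total mass at most
one. For the full matrix this says that the permanent is at most `permBound`. -/
lemma successProb_le_one (B : ℕ → ℕ → Bool) (n : ℕ) (d : ℕ) : ∀ (R : Finset ℕ) (j : ℕ),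
    j + d = n → R.card = d → successProb B n R j ≤ 1 := by
  induction d with
  | zero =>
    intro R j hj hR
    obtain rfl : j = n := by omega
    rw [Finset.card_eq_zero.1 hR, successProb_empty]
  | succ d ih =>
    intro R j hj hR
    rw [successProb_eq_sum B (by omega)]
    refine le_trans ?_ (prod_decay_mul_sum_pick_le_one B (n := n) (j := j) (by omega) R)
    rw [Finset.mul_sum]
    refine Finset.sum_le_sum fun k hk => ?_
    refine mul_le_of_le_one_right (mul_nonneg (Finset.prod_nonneg fun l _ => (decay_pos _ _ _ _).le)
      (pick_nonneg _ _ _ _)) (ih _ _ (by omega) ?_)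
    rw [Finset.card_erase_of_mem hk, hR]; rfl

/-! ### The column expansion of the permanent -/

/-- The array of the entries of a matrix, with zeros outside. -/
def boolArray {n : ℕ} (X : Fin n → Fin n → Bool) (k j : ℕ) : Bool :=
  if h : k < n ∧ j < n then X ⟨k, h.1⟩ ⟨j, h.2⟩ else false

/-- The sum over the permutations that extend a given choice of rows for the first `j` columns. -/
lemma sum_perm_extending {n : ℕ} (X : Fin n → Fin n → Bool) (d : ℕ) :
    ∀ (j : ℕ) (f : Fin n → Fin n), j + d = n → Set.InjOn f {i | i.1 < j} →
    (∑ σ : Equiv.Perm (Fin n) with ∀ i : Fin n, i.1 < j → σ i = f i,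
      ∏ i : Fin n with j ≤ i.1, zeroOneMatrix X (σ i) i) =
    minorPerm (boolArray X) d
      ((Finset.univ.filter fun k : Fin n => ∀ i : Fin n, i.1 < j → f i ≠ k).map Fin.valEmbedding)
      j := by
  induction d with
  | zero =>
    intro j f hj hf
    obtain rfl : j = n := by omega
    have hinj : Function.Injective f := fun a b h => hf a.2 b.2 h
    have hfb : Function.Bijective f := Finite.injective_iff_bijective.1 hinj
    rw [minorPerm, Finset.sum_eq_single (Equiv.ofBijective f hfb)]
    · refine Finset.prod_eq_one fun i hi => ?_
      have := (Finset.mem_filter.1 hi).2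
      omega
    · intro σ hσ hne
      exfalso
      apply hne
      ext i
      rw [(Finset.mem_filter.1 hσ).2 i i.2]
      rfl
    · intro h
      exact absurd (Finset.mem_filter.2 ⟨Finset.mem_univ _, fun i _ => rfl⟩) h
  | succ d ih =>
    intro j f hj hf
    have hjn : j < n := by omega
    set J : Fin n := ⟨j, hjn⟩ with hJ
    -- The permutations are grouped by their value at column `j`; a row that is already used gives
    -- an empty group.
    rw [minorPerm, Finset.sum_map, ← Finset.sum_fiberwise _ (fun σ : Equiv.Perm (Fin n) => σ J),
      Finset.sum_filter]
    refine Finset.sum_congr rfl fun k _ => ?_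
    rw [Finset.filter_filter]
    by_cases hk : ∀ i : Fin n, i.1 < j → f i ≠ k
    · rw [if_pos hk]
      have hf' : Set.InjOn (Function.update f J k) {i | i.1 < j + 1} := by
        intro a ha b hb hab
        simp only [Set.mem_ofPred_eq] at ha hb
        rcases Nat.lt_succ_iff_lt_or_eq.1 ha with ha | ha <;>
          rcases Nat.lt_succ_iff_lt_or_eq.1 hb with hb | hb
        · have h1 : a ≠ J := fun h => by rw [h] at ha; exact lt_irrefl _ ha
          have h2 : b ≠ J := fun h => by rw [h] at hb; exact lt_irrefl _ hb
          rw [Function.update_of_ne h1, Function.update_of_ne h2] at hab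
          exact hf ha hb hab
        · have h1 : a ≠ J := fun h => by rw [h] at ha; exact lt_irrefl _ ha
          have h2 : b = J := Fin.ext hb
          rw [Function.update_of_ne h1, h2, Function.update_self] at hab
          exact absurd hab (hk a ha)
        · have h1 : b ≠ J := fun h => by rw [h] at hb; exact lt_irrefl _ hb
          have h2 : a = J := Fin.ext ha
          rw [Function.update_of_ne h1, h2, Function.update_self] at hab
          exact absurd hab.symm (hk b hb)
        · exact Fin.ext (by omega)
      have hcond : ∀ σ : Equiv.Perm (Fin n),
          ((∀ i : Fin n, i.1 < j → σ i = f i) ∧ σ J = k) ↔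
          ∀ i : Fin n, i.1 < j + 1 → σ i = Function.update f J k i := by
        intro σ
        constructor
        · rintro ⟨h1, h2⟩ i hi
          by_cases hiJ : i = J
          · rw [hiJ, Function.update_self, h2]
          · rw [Function.update_of_ne hiJ]
            exact h1 i (lt_of_le_of_ne (Nat.lt_succ_iff.1 hi) fun h => hiJ (Fin.ext h))
        · intro h
          refine ⟨fun i hi => ?_, ?_⟩
          · have hiJ : i ≠ J := fun h => by rw [h] at hi; exact lt_irrefl _ hi
            rw [h i (by omega), Function.update_of_ne hiJ]
          · rw [h J (Nat.lt_succ_self j), Function.update_self]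
      simp only [hcond]
      have hprod : ∀ σ : Equiv.Perm (Fin n), (∏ i : Fin n with j ≤ i.1, zeroOneMatrix X (σ i) i) =
          zeroOneMatrix X (σ J) J * ∏ i : Fin n with j + 1 ≤ i.1, zeroOneMatrix X (σ i) i := by
        intro σ
        have : (Finset.univ.filter fun i : Fin n => j ≤ i.1) =
            insert J (Finset.univ.filter fun i : Fin n => j + 1 ≤ i.1) := by
          ext i
          simp only [Finset.mem_filter, Finset.mem_univ, true_and, Finset.mem_insert, Fin.ext_iff, hJ]
          omega
        rw [this, Finset.prod_insert (by simp [hJ])]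
      have hset : ((Finset.univ.filter fun k' : Fin n =>
            ∀ i : Fin n, i.1 < j + 1 → Function.update f J k i ≠ k').map Fin.valEmbedding) =
          ((Finset.univ.filter fun k' : Fin n =>
            ∀ i : Fin n, i.1 < j → f i ≠ k').map Fin.valEmbedding).erase (Fin.valEmbedding k) := by
        rw [← Finset.map_erase]
        congr 1
        ext k'
        simp only [Finset.mem_filter, Finset.mem_univ, true_and, Finset.mem_erase]
        constructor
        · intro h
          refine ⟨fun hkk => ?_, fun i hi => ?_⟩
          · have := h J (Nat.lt_succ_self j)
            rw [Function.update_self] at this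
            exact this hkk.symm
          · have hiJ : i ≠ J := fun h => by rw [h] at hi; exact lt_irrefl _ hi
            have := h i (by omega)
            rwa [Function.update_of_ne hiJ] at this
        · rintro ⟨h1, h2⟩ i hi
          by_cases hiJ : i = J
          · rw [hiJ, Function.update_self]; exact fun h => h1 h.symm
          · rw [Function.update_of_ne hiJ]
            exact h2 i (lt_of_le_of_ne (Nat.lt_succ_iff.1 hi) fun h => hiJ (Fin.ext h))
      rw [← hset, ← ih (j + 1) (Function.update f J k) (by omega) hf']
      have hB : boolArray X (Fin.valEmbedding k) j = X k J := by
        simp [boolArray, hjn, hJ]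
      rw [hB]
      have hval : ∀ σ : Equiv.Perm (Fin n), (∀ i : Fin n, i.1 < j + 1 →
          σ i = Function.update f J k i) → zeroOneMatrix X (σ J) J = if X k J then 1 else 0 := by
        intro σ hσ
        rw [hσ J (Nat.lt_succ_self j), Function.update_self]
        rfl
      rw [Finset.sum_congr rfl fun σ hσ => by rw [hprod σ, hval σ (Finset.mem_filter.1 hσ).2]]
      split_ifs <;> simp
    · rw [if_neg hk]
      refine Finset.sum_eq_zero fun σ hσ => ?_
      exfalso
      obtain ⟨h1, h2⟩ := (Finset.mem_filter.1 hσ).2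
      push Not at hk
      obtain ⟨i, hi, hik⟩ := hk
      have : σ i = σ J := by rw [h1 i hi, hik, h2]
      have := congrArg Fin.val (σ.injective this)
      simp only [hJ] at this
      omega

lemma permanent_eq_minorPerm {n : ℕ} (X : Fin n → Fin n → Bool) :
    (zeroOneMatrix X).permanent = minorPerm (boolArray X) n (Finset.range n) 0 := by
  have h := sum_perm_extending X n 0 id (by omega) (by simp [Set.InjOn])
  have hR : (Finset.univ.filter fun k : Fin n => ∀ i : Fin n, i.1 < 0 → id i ≠ k).map
      Fin.valEmbedding = Finset.range n := by
    ext k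
    simp
  rw [hR] at h
  rw [← h]
  simp [Matrix.permanent]

/-! ### The program -/

/-- The natural-number cell with a fixed address. -/
def nReg (i : ℕ) : NExp := .cell (.lit i)

/-- The address of the `i`-th real register; the registers lie behind the input and the two
tables. -/
def rAddr (i : ℕ) : NExp := .add (.add (nReg 1) (.add (nReg 1) (nReg 1))) (.lit (2 + i))

/-- The content of the `i`-th real register. -/
def rReg (i : ℕ) : RExp := .cell (rAddr i)

/-- The address of the entry of the table of decays that belongs to the current position. -/
def decayAddr : NExp := .add (nReg 1) (nReg 3)

/-- The address of the entry of the table of picks that belongs to the current position. -/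
def pickAddr : NExp := .add (nReg 1) (.add (nReg 1) (nReg 3))

/-- Increment a natural-number register. -/
def incr (i : ℕ) : Prog := .setN (.lit i) (.add (nReg i) (.lit 1))

/-- The test whether register `i` is less than `n`. -/
def ltSize (i : ℕ) : Cond := .nle (.add (nReg i) (.lit 1)) (nReg 0)

/-- Mark all rows as unused. -/
def resetRows : Prog :=
  .seq (.setN (.lit 2) (.lit 0))
    (.loop (ltSize 2) (.seq (.setN (.add (.lit 10) (nReg 2)) (.lit 0)) (incr 2)))

/-- Move to the next row in the current column. -/
def nextRow : Prog := .seq (.setN (.lit 3) (.add (nReg 3) (nReg 0))) (incr 2)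

/-- Move to the first row in the current column. -/
def firstRow : Prog :=
  .seq (.setN (.lit 2) (.lit 0)) (.setN (.lit 3) (.add (.lit 2) (nReg 4)))

/-- The test whether the current row is unused. -/
def unused : Cond := .nle (.cell (.add (.lit 10) (nReg 2))) (.lit 0)

/-- Multiply the decays of the unused rows in the current column. -/
def multiplyDecays : Prog :=
  .seq (.setR (rAddr 7) (.lit 1)) (.seq firstRow (.loop (ltSize 2)
    (.seq (.ite unused (.setR (rAddr 7) (.mul (rReg 7) (.cell decayAddr))) .skip) nextRow)))

/-- Scan the unused rows until the random number in register `8` is used up. -/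
def scanRows : Prog :=
  .loop (ltSize 2) (.seq (.ite unused
    (.seq (.setR (rAddr 8) (.sub (rReg 8) (.mul (rReg 7) (.cell pickAddr))))
      (.ite (.rle (.lit 0) (rReg 8)) .skip
        -- A choice sets the row counter to `n`, and the subsequent `nextRow` raises it to `n + 1`;
        -- a scan without a choice ends with exactly `n`.
        (.seq (.setN (.add (.lit 10) (nReg 2)) (.lit 1)) (.setN (.lit 2) (nReg 0))))) .skip)
    nextRow)

/-- Choose a row for the current column, and move on to the next column, or beyond the last one if
the choice fails. -/
def chooseRow : Prog :=
  .seq firstRow (.seq scanRows (.ite (ltSize 2)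
    .skip (.ite (.nle (nReg 2) (nReg 0))
      -- Column `n + 1` signals rejection, whereas a completed permutation leaves the column counter
      -- at `n`.
      (.setN (.lit 4) (.add (nReg 0) (.lit 1))) (incr 4))))

/-- Treat one column. -/
def columnStep : Prog := .seq multiplyDecays (.seq (.rand (rAddr 8)) chooseRow)

/-- Preparation of a trial. -/
def startTrial : Prog :=
  .seq (.setR (rAddr 6) (.add (rReg 6) (.lit 1))) (.seq resetRows (.setN (.lit 4) (.lit 0)))

/-- One trial of the rejection sampling. -/
def trial : Prog :=
  .seq startTrial (.seq (.loop (ltSize 4) columnStep)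
    (.ite (.nle (nReg 4) (nReg 0)) (.setN (.lit 5) (.sub (nReg 5) (.lit 1))) .skip))

/-- Trials until enough of them have succeeded. -/
def trials : Prog := .loop (.nle (.lit 1) (nReg 5)) trial

/-- Write the output. -/
def writeOutput : Prog := .setR (.lit 0) (.div (.mul (rReg 4) (rReg 5)) (rReg 6))

/-- Compute `n²` in register `1`. -/
def computeSquare : Prog :=
  .loop (ltSize 2) (.seq (.setN (.lit 1) (.add (nReg 1) (nReg 0))) (incr 2))

/-- Compute the partial sum of the series for `e`. -/
def computeExpSum : Prog :=
  .seq (.setN (.lit 2) (.lit 0)) (.seq (.setR (rAddr 0) (.lit 1)) (.seq (.setR (rAddr 1) (.lit 0))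
    (.seq (.setR (rAddr 2) (.lit 1)) (.loop (ltSize 2)
      (.seq (.setR (rAddr 1) (.add (rReg 1) (.lit 1)))
        (.seq (.setR (rAddr 2) (.div (rReg 2) (rReg 1)))
          (.seq (.setR (rAddr 0) (.add (rReg 0) (rReg 2))) (incr 2))))))))

/-- The number `(1 + ε)² / (δ ε²)`. -/
def trialTarget : RExp :=
  .div (.mul (.add (.lit 1) (.cell (.lit 0))) (.add (.lit 1) (.cell (.lit 0))))
    (.mul (.cell (.lit 1)) (.mul (.cell (.lit 0)) (.cell (.lit 0))))

/-- Compute the number of successes that are needed. -/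
def computeTarget : Prog :=
  .seq (.setN (.lit 5) (.lit 0)) (.seq (.setR (rAddr 5) (.lit 0))
    -- Reals cannot be rounded, so a natural and a real counter run in parallel until they exceed
    -- the target; they stop at its floor plus one.
    (.loop (.rle (rReg 5) trialTarget)
      (.seq (.setR (rAddr 5) (.add (rReg 5) (.lit 1))) (incr 5))))

/-- The next value of the bound in register `3`. -/
def nextBoundExp : RExp :=
  .add (.add (.add (rReg 3) (.lit 1)) (.div (.lit 1) (.mul (.lit 2) (rReg 3))))
    (.div (.lit 1) (.mul (rReg 3) (rReg 3)))

/-- Fill in the table entries for one position. -/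
def fillEntry : Prog :=
  -- The pointer moves down through a row, so that register 3 always holds the row bound for the
  -- columns to the right.
  .seq (.setN (.lit 3) (.sub (nReg 3) (.lit 1)))
    (.seq (.ite (.rle (.lit 1) (.cell (nReg 3)))
      (.seq (.setR decayAddr (.div (rReg 3) nextBoundExp))
        (.seq (.setR pickAddr (.div (rReg 0) (rReg 3))) (.setR (rAddr 3) nextBoundExp)))
      (.seq (.setR decayAddr (.lit 1)) (.setR pickAddr (.lit 0)))) (incr 6))

/-- Fill in the tables for one row. -/
def fillRow : Prog :=
  .seq (.setN (.lit 6) (.lit 0)) (.seq (.setR (rAddr 3) (.lit 1))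
    (.seq (.loop (ltSize 6) fillEntry)
      (.seq (.setR (rAddr 4) (.mul (rReg 4) (.div (rReg 3) (rReg 0)))) (incr 2))))

/-- Fill in the tables. -/
def fillTables : Prog :=
  .seq (.setN (.lit 2) (.lit 0)) (.seq (.setN (.lit 3) (.add (nReg 1) (.lit 2)))
    (.seq (.setR (rAddr 4) (.lit 1)) (.seq (.setR (rAddr 6) (.lit 0)) (.loop (ltSize 2) fillRow))))

/-- The deterministic preparation. -/
def prepare : Prog :=
  .seq computeSquare (.seq computeExpSum (.seq computeTarget fillTables))

/-- Approximation of the permanent by rejection sampling. -/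
def permanentProgram : Prog := .seq prepare (.seq trials writeOutput)

@[simp] lemma nReg_eval (s : Store) (i : ℕ) : (nReg i).eval s = s.nat i := rfl

-- Once natural cell 1 holds n², the base 3n² + 2 skips ε, δ, the matrix and the two tables. Real
-- registers: 0 `expSum n`, 1 and 2 the counter and inverse factorial for it, 3 the current row
-- bound, 4 the bound U, 5 the target m, 6 the number of trials, 7 the product of decays, 8 the
-- remaining part of the random number. Natural cells: 2 row counter, 3 table pointer, 4 column, 5
-- successes still needed, 6 counter while a row is filled, 10 + k the mark of row k.
@[simp] lemma rAddr_eval (s : Store) (i : ℕ) : (rAddr i).eval s = 3 * s.nat 1 + 2 + i := by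
  simp only [rAddr, nReg, NExp.eval]
  ring

@[simp] lemma rReg_eval (s : Store) (i : ℕ) :
    (rReg i).eval s = s.real (3 * s.nat 1 + 2 + i) := by
  simp [rReg, RExp.eval]

@[simp] lemma decayAddr_eval (s : Store) : decayAddr.eval s = s.nat 1 + s.nat 3 := rfl

@[simp] lemma pickAddr_eval (s : Store) : pickAddr.eval s = s.nat 1 + (s.nat 1 + s.nat 3) := rfl

@[simp] lemma ltSize_holds (s : Store) (i : ℕ) : (ltSize i).holds s ↔ s.nat i < s.nat 0 := Iff.rfl

@[simp] lemma unused_holds (s : Store) : unused.holds s ↔ s.nat (10 + s.nat 2) = 0 := by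
  simp [unused, Cond.holds, NExp.eval]

lemma Ends.incr {i : ℕ} {s : Store} {Q : Store → Prop}
    (h : Q ⟨Function.update s.nat i (s.nat i + 1), s.real⟩) : Ends (incr i) s 1 Q := Ends.setN h

/-! ### The memory during the trials -/

/-- The tables and the constants have been computed. -/
structure Ready (B : ℕ → ℕ → Bool) (n : ℕ) (U m : ℝ) (s : Store) : Prop where
  size : s.nat 0 = n
  square : s.nat 1 = n * n
  decay : ∀ k < n, ∀ j < n, s.real (n * n + (2 + j + k * n)) = decay B n k j
  pick : ∀ k < n, ∀ j < n, s.real (n * n + (n * n + (2 + j + k * n))) = pick B n k j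
  bound : s.real (3 * (n * n) + 2 + 4) = U
  target : s.real (3 * (n * n) + 2 + 5) = m

lemma pos_lt {n k j : ℕ} (hk : k < n) (hj : j < n) : j + k * n < n * n := by
  calc j + k * n < n + k * n := by omega
    _ = (k + 1) * n := by ring
    _ ≤ n * n := Nat.mul_le_mul_right _ hk

section
variable {B : ℕ → ℕ → Bool} {n : ℕ} {U m : ℝ} {s : Store}

lemma Ready.update_nat (h : Ready B n U m s) {a v : ℕ} (ha : 2 ≤ a) :
    Ready B n U m ⟨Function.update s.nat a v, s.real⟩ where
  size := by simp [Function.update_of_ne (show 0 ≠ a by omega), h.size]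
  square := by simp [Function.update_of_ne (show 1 ≠ a by omega), h.square]
  decay := h.decay
  pick := h.pick
  bound := h.bound
  target := h.target

lemma Ready.update_real (h : Ready B n U m s) {a : ℕ} {v : ℝ} (ha : 3 * (n * n) + 2 + 6 ≤ a) :
    Ready B n U m ⟨s.nat, Function.update s.real a v⟩ where
  size := h.size
  square := h.square
  decay k hk j hj := by
    have := pos_lt hk hj
    rw [← h.decay k hk j hj]
    exact Function.update_of_ne (by omega) _ _
  pick k hk j hj := by
    have := pos_lt hk hj
    rw [← h.pick k hk j hj]
    exact Function.update_of_ne (by omega) _ _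
  bound := by rw [← h.bound]; exact Function.update_of_ne (by omega) _ _
  target := by rw [← h.target]; exact Function.update_of_ne (by omega) _ _

/-- The memory between two trials: `r` more successes are needed, `T` trials have been made. -/
structure Between (B : ℕ → ℕ → Bool) (n : ℕ) (U m : ℝ) (r T : ℕ) (s : Store) : Prop
    extends Ready B n U m s where
  remaining : s.nat 5 = r
  count : s.real (3 * (n * n) + 2 + 6) = T

lemma Between.update_nat {r T : ℕ} (h : Between B n U m r T s) {a v : ℕ} (ha : 2 ≤ a)
    (ha' : a ≠ 5) : Between B n U m r T ⟨Function.update s.nat a v, s.real⟩ where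
  toReady := h.toReady.update_nat ha
  remaining := by simp [Function.update_of_ne ha'.symm, h.remaining]
  count := h.count

lemma Between.update_real {r T : ℕ} (h : Between B n U m r T s) {a : ℕ} {v : ℝ}
    (ha : 3 * (n * n) + 2 + 7 ≤ a) : Between B n U m r T ⟨s.nat, Function.update s.real a v⟩ where
  toReady := h.toReady.update_real (by omega)
  remaining := h.remaining
  count := by rw [← h.count]; exact Function.update_of_ne (by omega) _ _

/-- The memory during a trial: the rows in `R` are unused, and column `j` comes next. -/
structure InTrial (B : ℕ → ℕ → Bool) (n : ℕ) (U m : ℝ) (r T : ℕ) (R : Finset ℕ) (j : ℕ)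
    (s : Store) : Prop extends Between B n U m r T s where
  column : s.nat 4 = j
  rows : ∀ k < n, s.nat (10 + k) = 0 ↔ k ∈ R

variable {r T : ℕ} {R : Finset ℕ} {j : ℕ}

lemma InTrial.update_nat (h : InTrial B n U m r T R j s) {a v : ℕ} (ha : a = 2 ∨ a = 3) :
    InTrial B n U m r T R j ⟨Function.update s.nat a v, s.real⟩ where
  toBetween := h.toBetween.update_nat (by omega) (by omega)
  column := by simp [Function.update_of_ne (show 4 ≠ a by omega), h.column]
  rows k hk := by simp [Function.update_of_ne (show 10 + k ≠ a by omega), h.rows k hk]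

lemma InTrial.update_real (h : InTrial B n U m r T R j s) {a : ℕ} {v : ℝ}
    (ha : 3 * (n * n) + 2 + 7 ≤ a) :
    InTrial B n U m r T R j ⟨s.nat, Function.update s.real a v⟩ where
  toBetween := h.toBetween.update_real ha
  column := h.column
  rows := h.rows

lemma InTrial.setColumn (h : InTrial B n U m r T R j s) (v : ℕ) :
    InTrial B n U m r T R v ⟨Function.update s.nat 4 v, s.real⟩ where
  toBetween := h.toBetween.update_nat (by omega) (by omega)
  column := by simp
  rows k hk := by simp [Function.update_of_ne (show 10 + k ≠ 4 by omega), h.rows k hk]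

lemma InTrial.useRow (h : InTrial B n U m r T R j s) (k : ℕ) :
    InTrial B n U m r T (R.erase k) j ⟨Function.update s.nat (10 + k) 1, s.real⟩ where
  toBetween := h.toBetween.update_nat (by omega) (by omega)
  column := by simp [Function.update_of_ne (show 4 ≠ 10 + k by omega), h.column]
  rows l hl := by
    by_cases hlk : l = k
    · subst hlk; simp
    · simp [h.rows l hl, hlk]

/-- The memory while the rows are scanned in the current column; the scan has reached row `k`. -/
structure Scanning (B : ℕ → ℕ → Bool) (n : ℕ) (U m : ℝ) (r T : ℕ) (R : Finset ℕ) (j k : ℕ)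
    (s : Store) : Prop extends InTrial B n U m r T R j s where
  row : s.nat 2 = k
  position : s.nat 3 = 2 + j + k * n

lemma InTrial.ends_firstRow (h : InTrial B n U m r T R j s) :
    Ends firstRow s 3 fun s' => Scanning B n U m r T R j 0 s' ∧ s'.real = s.real := by
  refine Ends.seq (Ends.setN (Ends.setN ⟨⟨?_, ?_, ?_⟩, rfl⟩))
  · exact (h.update_nat (Or.inl rfl)).update_nat (Or.inr rfl)
  · simp [NExp.eval]
  · simp [NExp.eval, h.column]

lemma Scanning.ends_nextRow {k : ℕ} (h : Scanning B n U m r T R j k s) :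
    Ends nextRow s 3 fun s' => Scanning B n U m r T R j (k + 1) s' ∧ s'.real = s.real := by
  refine Ends.seq (Ends.setN (Ends.incr ⟨⟨?_, ?_, ?_⟩, rfl⟩))
  · exact (h.toInTrial.update_nat (Or.inr rfl)).update_nat (Or.inl rfl)
  · simp [NExp.eval, h.row]
  · simp [NExp.eval, h.position, h.size]; ring

lemma Scanning.update_real {k : ℕ} (h : Scanning B n U m r T R j k s) {a : ℕ} {v : ℝ}
    (ha : 3 * (n * n) + 2 + 7 ≤ a) :
    Scanning B n U m r T R j k ⟨s.nat, Function.update s.real a v⟩ where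
  toInTrial := h.toInTrial.update_real ha
  row := h.row
  position := h.position

lemma Scanning.unused_iff {k : ℕ} (h : Scanning B n U m r T R j k s) (hk : k < n) :
    unused.holds s ↔ k ∈ R := by
  rw [unused_holds, h.row, h.rows k hk]

lemma filter_lt_succ_of_mem {R : Finset ℕ} {k : ℕ} (hk : k ∈ R) :
    R.filter (· < k + 1) = insert k (R.filter (· < k)) := by
  ext l
  simp only [Finset.mem_filter, Finset.mem_insert]
  constructor
  · rintro ⟨h1, h2⟩
    rcases Nat.lt_succ_iff_lt_or_eq.1 h2 with h | h
    · exact Or.inr ⟨h1, h⟩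
    · exact Or.inl h
  · rintro (rfl | ⟨h1, h2⟩)
    · exact ⟨hk, Nat.lt_succ_self _⟩
    · exact ⟨h1, by omega⟩

lemma filter_lt_succ_of_notMem {R : Finset ℕ} {k : ℕ} (hk : k ∉ R) :
    R.filter (· < k + 1) = R.filter (· < k) := by
  ext l
  simp only [Finset.mem_filter, and_congr_right_iff]
  intro hl
  have : l ≠ k := fun h => hk (h ▸ hl)
  omega

lemma filter_lt_of_subset {R : Finset ℕ} (hR : R ⊆ Finset.range n) : R.filter (· < n) = R :=
  Finset.filter_true_of_mem fun _ hk => Finset.mem_range.1 (hR hk)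

lemma InTrial.ends_multiplyDecays (h : InTrial B n U m r T R j s) (hj : j < n)
    (hR : R ⊆ Finset.range n) :
    Ends multiplyDecays s (n * 7 + 7) fun s' => InTrial B n U m r T R j s' ∧
      s'.real (3 * (n * n) + 2 + 7) = ∏ k ∈ R, decay B n k j := by
  refine (Ends.seq (Ends.setR (Ends.seq
    ((h.update_real (by simp [h.square])).ends_firstRow.mono le_rfl fun s₁ hs₁ =>
      Ends.mono (Ends.loop (t := 6) (m := n) (fun k s => Scanning B n U m r T R j k s ∧
        s.real (3 * (n * n) + 2 + 7) = ∏ l ∈ R.filter (· < k), _root_.decay B n l j) ?_ ?_ ?_)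
        le_rfl ?_)))).mono (by omega) fun _ h => h
  · refine ⟨hs₁.1, ?_⟩
    rw [hs₁.2]
    simp [h.square, RExp.eval]
  · rintro k hk s ⟨hs, hP⟩
    refine ⟨by simpa [hs.row, hs.size] using hk, ?_⟩
    refine (Ends.seq (Ends.ite (t := 1) (Q := fun s' => Ends nextRow s' 3 _) ?_ ?_)).mono
      le_rfl fun _ h => h
    · intro hu
      rw [hs.unused_iff hk] at hu
      refine Ends.setR ((hs.update_real (by simp [hs.square])).ends_nextRow.mono le_rfl ?_)
      rintro s' ⟨hs', hr⟩
      refine ⟨hs', ?_⟩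
      rw [hr, filter_lt_succ_of_mem hu, Finset.prod_insert (by simp)]
      simp only [rAddr_eval, hs.square, Function.update_self, RExp.eval, rReg_eval,
        decayAddr_eval, hP, hs.position, hs.decay k hk j hj]
      ring
    · intro hu
      rw [hs.unused_iff hk] at hu
      refine Ends.skip (hs.ends_nextRow.mono le_rfl ?_)
      rintro s' ⟨hs', hr⟩
      refine ⟨hs', ?_⟩
      rw [hr, filter_lt_succ_of_notMem hu, hP]
  · rintro s ⟨hs, -⟩
    simp [hs.row, hs.size]
  · rintro s ⟨hs, hP⟩
    rw [filter_lt_of_subset hR] at hP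
    exact ⟨hs.toInTrial, hP⟩

/-- The outcome of the choice of a row with the random number `u`, where `P` is the product of the
decays. -/
def ChoiceOutcome (B : ℕ → ℕ → Bool) (n : ℕ) (R : Finset ℕ) (j : ℕ) (P u : ℝ)
    (rejected : Prop) (chosen : ℕ → Prop) : Prop :=
  (P * ∑ k ∈ R, pick B n k j ≤ u ∧ rejected) ∨
    ∃ k ∈ R, P * ∑ l ∈ R.filter (· < k), pick B n l j ≤ u ∧
      u < P * ∑ l ∈ R.filter (· < k), pick B n l j + P * pick B n k j ∧ chosen k

/-- Register 8 holds `u` minus the total selection probability of the unused rows already scanned. A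
row is chosen when this becomes negative, that is, when `u` lies in the interval belonging to the
row. The induction is on the number `d` of rows still to be scanned. -/
lemma ends_scanRows (hj : j < n) (hR : R ⊆ Finset.range n) (P u : ℝ) (d : ℕ) :
    ∀ k s, k + d = n → Scanning B n U m r T R j k s → s.real (3 * (n * n) + 2 + 7) = P →
      s.real (3 * (n * n) + 2 + 8) = u - P * ∑ l ∈ R.filter (· < k), pick B n l j →
      P * ∑ l ∈ R.filter (· < k), pick B n l j ≤ u →
      Ends scanRows s (d * 12 + 13) fun s' => ChoiceOutcome B n R j P u
        (InTrial B n U m r T R j s' ∧ s'.nat 2 = n)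
        fun k => InTrial B n U m r T (R.erase k) j s' ∧ s'.nat 2 = n + 1 := by
  induction d with
  | zero =>
    intro k s hk hs hP hu hle
    obtain rfl : k = n := by omega
    refine Ends.mono (Ends.loopDone (t := 0) (by simp [hs.row, hs.size]) ?_) (by omega)
      fun _ h => h
    rw [filter_lt_of_subset hR] at hle
    exact Or.inl ⟨hle, hs.toInTrial, hs.row⟩
  | succ d ih =>
    intro k s hk hs hP hu hle
    have hkn : k < n := by omega
    have hnd : ((d + 1) * 12 + 13) = 11 + (d * 12 + 13) + 1 := by ring
    rw [hnd]
    refine Ends.loopStep (by simpa [hs.row, hs.size] using hkn) ?_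
    refine Ends.mono (t := 7 + 3 + 1) (Ends.seq (Ends.ite (t := 6) ?_ ?_)) le_rfl fun _ h => h
    · intro hun
      rw [hs.unused_iff hkn] at hun
      have hnotin : k ∉ R.filter (· < k) := by simp
      have hnew : ∑ l ∈ R.filter (· < k + 1), pick B n l j =
          pick B n k j + ∑ l ∈ R.filter (· < k), pick B n l j := by
        rw [filter_lt_succ_of_mem hun, Finset.sum_insert hnotin]
      refine Ends.mono (t := 1 + 4 + 1) (Ends.seq (Ends.setR ?_)) le_rfl fun _ h => h
      have hval : (RExp.sub (rReg 8) (.mul (rReg 7) (.cell pickAddr))).eval s =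
          u - P * ∑ l ∈ R.filter (· < k + 1), pick B n l j := by
        simp only [RExp.eval, rReg_eval, pickAddr_eval, hs.square, hP, hu, hs.position,
          hs.pick k hkn j hj, hnew]
        ring
      rw [hval, rAddr_eval, hs.square]
      have hs2 := hs.update_real (a := 3 * (n * n) + 2 + 8)
        (v := u - P * ∑ l ∈ R.filter (· < k + 1), pick B n l j) (by omega)
      refine Ends.ite (t := 3) (fun hc => ?_) (fun hc => ?_)
      · simp only [Cond.holds, RExp.eval, rReg_eval, hs.square, Function.update_self,
          Nat.cast_zero, sub_nonneg] at hc
        refine Ends.mono (t := 1) (Ends.skip ?_) (by omega) fun _ h => h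
        refine hs2.ends_nextRow.mono le_rfl ?_
        rintro s' ⟨hs', hr⟩
        refine ih (k + 1) s' (by omega) hs' ?_ ?_ hc
        · rw [hr, ← hP]; exact Function.update_of_ne (by omega) _ _
        · rw [hr]; exact Function.update_self _ _ _
      · simp only [Cond.holds, RExp.eval, rReg_eval, hs.square, Function.update_self,
          Nat.cast_zero, sub_nonneg, not_le] at hc
        refine Ends.mono (t := 1 + 1 + 1) (Ends.seq (Ends.setN (Ends.setN ?_))) (by omega)
          fun _ h => h
        simp only [NExp.eval, nReg_eval, hs.row]
        have hin := hs2.toInTrial.useRow k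
        have hrow0 : Function.update s.nat (10 + k) 1 0 = n := by
          rw [Function.update_of_ne (by omega), hs.size]
        rw [hrow0]
        have hin2 := hin.update_nat (a := 2) (v := n) (Or.inl rfl)
        refine Ends.mono (t := 1 + 1 + 1) (Ends.seq (Ends.setN (Ends.incr ?_))) (by omega)
          fun _ h => h
        set x := NExp.eval _ (NExp.add (nReg 3) (nReg 0)) with hx
        have hin3 := hin2.update_nat (a := 3) (v := x) (Or.inr rfl)
        have hin4 := hin3.update_nat (a := 2) (v := n + 1) (Or.inl rfl)
        refine Ends.loopDone (t := d * 12 + 12) ?_ ?_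
        · simp [hrow0, NExp.eval]
        · refine Or.inr ⟨k, hun, hle, ?_, ?_⟩
          · rw [hnew] at hc
            linarith
          · simpa [NExp.eval] using hin4
    · intro hun
      rw [hs.unused_iff hkn] at hun
      refine Ends.mono (t := 1) (Ends.skip (hs.ends_nextRow.mono le_rfl ?_)) (by omega)
        fun _ h => h
      rintro s' ⟨hs', hr⟩
      have hf := filter_lt_succ_of_notMem hun
      refine ih (k + 1) s' (by omega) hs' (by rw [hr, hP]) (by rw [hr, hf, hu]) (by rwa [hf])

lemma InTrial.ends_chooseRow (h : InTrial B n U m r T R j s) (hj : j < n)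
    (hR : R ⊆ Finset.range n) {P u : ℝ} (hP : s.real (3 * (n * n) + 2 + 7) = P)
    (hu : s.real (3 * (n * n) + 2 + 8) = u) (hu0 : 0 ≤ u) :
    Ends chooseRow s (n * 12 + 21) fun s' => ChoiceOutcome B n R j P u
        (InTrial B n U m r T R (n + 1) s') fun k => InTrial B n U m r T (R.erase k) (j + 1) s' := by
  refine Ends.mono (t := 3 + ((n * 12 + 13) + 3 + 1) + 1) (Ends.seq
    (h.ends_firstRow.mono le_rfl ?_)) (by omega) fun _ h => h
  rintro s₁ ⟨hs₁, hr⟩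
  refine Ends.seq (t := n * 12 + 13) (t' := 3) ((ends_scanRows hj hR P u n 0 s₁ (by omega) hs₁ (by rw [hr, hP])
    (by rw [hr, hu]; simp) (by simpa using hu0)).mono le_rfl ?_)
  rintro s₂ (⟨h1, h2, h3⟩ | ⟨k, hk, h1, h2, h3, h4⟩)
  · refine Ends.ite (t := 2) (fun hc => ?_) (fun _ => Ends.ite (t := 1) (fun _ => ?_) fun hc => ?_)
    · simp [h3, h2.size] at hc
    · refine Ends.setN ?_
      have := h2.setColumn (n + 1)
      simp only [NExp.eval, nReg_eval, h2.size]
      exact Or.inl ⟨h1, this⟩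
    · simp [Cond.holds, h3, h2.size] at hc
  · refine Ends.ite (t := 2) (fun hc => ?_) (fun _ => Ends.ite (t := 1) (fun hc => ?_) fun _ => ?_)
    · simp [h4, h3.size] at hc
    · simp [Cond.holds, h4, h3.size] at hc
    · refine Ends.incr ?_
      have := h3.setColumn (j + 1)
      rw [h3.column]
      exact Or.inr ⟨k, hk, h1, h2, this⟩

/-! ### The effect of a trial -/

lemma volume_unitInterval_preimage_le (A : Set ℝ) (hA : MeasurableSet A) :
    (volume : Measure unitInterval) {u | (u : ℝ) ∈ A} ≤ volume (A ∩ unitInterval) := by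
  have := unitInterval.measurePreserving_coe.measure_preimage hA.nullMeasurableSet
  rw [Measure.restrict_apply hA] at this
  exact this.le

/-- The outcomes correspond to consecutive intervals whose lengths are the selection probabilities,
followed by the rejection interval. The pointwise bound by indicators is measurable, so nothing is
required of `G`. -/
lemma lintegral_choice_le {P : ℝ} (G : unitInterval → ℝ≥0∞) (b : ℝ≥0∞) (g : ℕ → ℝ≥0∞)
    (hG : ∀ u : unitInterval, ChoiceOutcome B n R j P u (G u ≤ b) fun k => G u ≤ g k) :
    ∫⁻ u, G u ≤ ENNReal.ofReal (1 - P * ∑ k ∈ R, pick B n k j) * b +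
      ∑ k ∈ R, ENNReal.ofReal (P * pick B n k j) * g k := by
  set S := P * ∑ k ∈ R, pick B n k j with hS
  let A : Set ℝ := Set.Ici S
  let I : ℕ → Set ℝ := fun k => Set.Ico (P * ∑ l ∈ R.filter (· < k), pick B n l j)
    (P * ∑ l ∈ R.filter (· < k), pick B n l j + P * pick B n k j)
  have hmA : MeasurableSet {u : unitInterval | (u : ℝ) ∈ A} :=
    measurable_subtype_coe measurableSet_Ici
  have hmI : ∀ k, MeasurableSet {u : unitInterval | (u : ℝ) ∈ I k} := fun k =>
    measurable_subtype_coe measurableSet_Ico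
  have hpt : ∀ u, G u ≤ Set.indicator {u : unitInterval | (u : ℝ) ∈ A} (fun _ => b) u +
      ∑ k ∈ R, Set.indicator {u : unitInterval | (u : ℝ) ∈ I k} (fun _ => g k) u := by
    intro u
    rcases hG u with ⟨h1, h2⟩ | ⟨k, hk, h1, h2, h3⟩
    · refine h2.trans (le_add_right ?_)
      rw [Set.indicator_of_mem (show u ∈ {u : unitInterval | (u : ℝ) ∈ A} from h1)]
    · refine h3.trans (le_add_left (le_trans ?_ (Finset.single_le_sum
        (f := fun k => Set.indicator {u : unitInterval | (u : ℝ) ∈ I k} (fun _ => g k) u)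
        (fun _ _ => zero_le) hk)))
      rw [Set.indicator_of_mem (show u ∈ {u : unitInterval | (u : ℝ) ∈ I k} from ⟨h1, h2⟩)]
  refine (lintegral_mono hpt).trans ?_
  rw [lintegral_add_left (measurable_const.indicator hmA),
    lintegral_finsetSum _ fun k _ => measurable_const.indicator (hmI k)]
  simp only [lintegral_indicator_const, hmA, hmI]
  refine add_le_add ?_ (Finset.sum_le_sum fun k hk => ?_)
  · rw [mul_comm]
    gcongr
    refine (volume_unitInterval_preimage_le A measurableSet_Ici).trans ?_
    refine (measure_mono (t := Set.Icc S 1) ?_).trans (by rw [Real.volume_Icc])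
    rintro x ⟨h1, h2⟩
    exact ⟨h1, h2.2⟩
  · rw [mul_comm]
    gcongr
    refine (volume_unitInterval_preimage_le _ measurableSet_Ico).trans ?_
    refine (measure_mono Set.inter_subset_left).trans ?_
    rw [Real.volume_Ico]
    simp

/-- Separates the common cost `e` from the values after success (`a`) and failure (`b`). -/
lemma sum_choice_eq (R : Finset ℕ) (w e a b : ℝ≥0∞) (p x y : ℕ → ℝ≥0∞) :
    w * (e + b) + ∑ k ∈ R, p k * (e + (x k * a + y k * b)) =
      e * (w + ∑ k ∈ R, p k) + ((∑ k ∈ R, p k * x k) * a + (w + ∑ k ∈ R, p k * y k) * b) := by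
  have : ∑ k ∈ R, p k * (e + (x k * a + y k * b)) =
      e * ∑ k ∈ R, p k + (∑ k ∈ R, p k * x k) * a + (∑ k ∈ R, p k * y k) * b := by
    simp only [Finset.mul_sum, Finset.sum_mul, ← Finset.sum_add_distrib]
    exact Finset.sum_congr rfl fun k _ => by ring
  rw [this]
  ring

/-- Averaging over the choice in one column reproduces the recursion `successProb_eq_sum`. A column
costs 7n + 7 steps for the decays, 12n + 21 for the choice, and 4 for the loop test, two sequencings
and the random draw. -/
lemma IsValue.columns_le {c : ℝ≥0∞} {Φ : Config → ℝ≥0∞} (hΦ : IsValue c Φ) {K : List Prog}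
    {a b : ℝ≥0∞} (ha : ∀ s, InTrial B n U m r T ∅ n s → Φ (K, s) ≤ a)
    (hb : ∀ R s, InTrial B n U m r T R (n + 1) s → Φ (K, s) ≤ b) (d : ℕ) :
    ∀ j R s, j + d = n → R ⊆ Finset.range n → R.card = d → InTrial B n U m r T R j s →
      Φ (.loop (ltSize 4) columnStep :: K, s) ≤ c * (d * (n * 19 + 32) + 1 : ℕ) +
        (ENNReal.ofReal (successProb B n R j) * a +
          ENNReal.ofReal (1 - successProb B n R j) * b) := by
  induction d with
  | zero =>
    intro j R s hj hR hcard hs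
    obtain rfl : j = n := by omega
    obtain rfl := Finset.card_eq_zero.1 hcard
    refine (hΦ.loop_done_le (by simp [hs.column, hs.size])).trans ?_
    rw [successProb_empty]
    simp only [zero_mul, zero_add, Nat.cast_one, mul_one, ENNReal.ofReal_one, one_mul, sub_self,
      ENNReal.ofReal_zero, add_zero]
    gcongr
    exact ha s hs
  | succ d ih =>
    intro j R s hj hR hcard hs
    have hjn : j < n := by omega
    set P := ∏ k ∈ R, _root_.decay B n k j with hPdef
    have hP0 : 0 ≤ P := Finset.prod_nonneg fun _ _ => (decay_pos _ _ _ _).le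
    have hP1 : P * ∑ k ∈ R, _root_.pick B n k j ≤ 1 := prod_decay_mul_sum_pick_le_one B hjn R
    set E := c * (d * (n * 19 + 32) + 1 : ℕ) with hE
    set q : ℕ → ℝ := fun k => successProb B n (R.erase k) (j + 1) with hq
    set S := P * ∑ k ∈ R, _root_.pick B n k j with hS
    have hcard' : ∀ k ∈ R, (R.erase k).card = d := fun k hk => by
      rw [Finset.card_erase_of_mem hk, hcard]; rfl
    have hq0 : ∀ k, 0 ≤ q k := fun k => successProb_nonneg _ _ _ _
    have hq1 : ∀ k ∈ R, q k ≤ 1 := fun k hk =>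
      successProb_le_one B n d _ _ (by omega) (hcard' k hk)
    have hp0 : ∀ k, 0 ≤ P * _root_.pick B n k j := fun k => mul_nonneg hP0 (pick_nonneg _ _ _ _)
    have hrand : ∀ s₁, InTrial B n U m r T R j s₁ → s₁.real (3 * (n * n) + 2 + 7) = P →
        ∫⁻ u : unitInterval, Φ (chooseRow :: .loop (ltSize 4) columnStep :: K,
          { s₁ with real := Function.update s₁.real ((rAddr 8).eval s₁) (u : ℝ) }) ≤
        c * (n * 12 + 21 : ℕ) + E + (ENNReal.ofReal (successProb B n R j) * a +
          ENNReal.ofReal (1 - successProb B n R j) * b) := by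
      intro s₁ hs₁ hs₁P
      let g : ℕ → ℝ≥0∞ := fun k => c * (n * 12 + 21 : ℕ) + (E +
        (ENNReal.ofReal (q k) * a + ENNReal.ofReal (1 - q k) * b))
      refine (lintegral_choice_le (B := B) (n := n) (R := R) (j := j) (P := P) _
        (c * (n * 12 + 21 : ℕ) + (E + b)) g ?_).trans ?_
      · intro u
        have hs₂ : InTrial B n U m r T R j
            { s₁ with real := Function.update s₁.real ((rAddr 8).eval s₁) (u : ℝ) } :=
          hs₁.update_real (by simp [hs₁.square])
        obtain ⟨t', ht', s', hex, hout⟩ := hs₂.ends_chooseRow hjn hR (P := P) (u := u)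
          (by rw [← hs₁P]; simp [hs₁.square]) (by simp [hs₁.square]) u.2.1
        have hex' := hΦ.exec hex (.loop (ltSize 4) columnStep :: K)
        have hct : c * (t' : ℝ≥0∞) ≤ c * (n * 12 + 21 : ℕ) := by gcongr
        rcases hout with ⟨h1, h2⟩ | ⟨k, hk, h1, h2, h3⟩
        · refine Or.inl ⟨h1, hex'.trans (add_le_add hct ?_)⟩
          -- After a rejection the column is `n + 1` and the loop exits in one step, which `E`
          -- covers.
          refine (hΦ.loop_done_le (by simp [h2.column, h2.size])).trans ?_
          refine add_le_add ?_ (hb _ _ h2)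
          rw [hE]
          conv_lhs => rw [← mul_one c]
          gcongr
          exact_mod_cast Nat.le_add_left 1 _
        · refine Or.inr ⟨k, hk, h1, h2, hex'.trans (add_le_add hct ?_)⟩
          exact ih (j + 1) (R.erase k) s' (by omega) ((Finset.erase_subset _ _).trans hR)
            (hcard' k hk) h3
      -- The selection probabilities together with the rejection probability `1 - S` have total mass
      -- one, so the costs common to all outcomes are counted once.
      · have hsum1 : ENNReal.ofReal (1 - S) + ∑ k ∈ R, ENNReal.ofReal (P * _root_.pick B n k j)
            = 1 := by
          have hS0 : 0 ≤ S :=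
            mul_nonneg hP0 (Finset.sum_nonneg fun k _ => pick_nonneg _ _ _ _)
          rw [← ENNReal.ofReal_sum_of_nonneg fun k _ => hp0 k, ← Finset.mul_sum, ← hS,
            ← ENNReal.ofReal_add (by linarith) hS0, sub_add_cancel, ENNReal.ofReal_one]
        have hsuc := successProb_eq_sum B hjn R
        have hsum2 : ∑ k ∈ R, ENNReal.ofReal (P * _root_.pick B n k j) * ENNReal.ofReal (q k) =
            ENNReal.ofReal (successProb B n R j) := by
          rw [hsuc, ENNReal.ofReal_sum_of_nonneg fun k _ => mul_nonneg (hp0 k) (hq0 k)]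
          exact Finset.sum_congr rfl fun k _ => (ENNReal.ofReal_mul (hp0 k)).symm
        have hsum3 : ENNReal.ofReal (1 - S) +
            ∑ k ∈ R, ENNReal.ofReal (P * _root_.pick B n k j) * ENNReal.ofReal (1 - q k) =
            ENNReal.ofReal (1 - successProb B n R j) := by
          have : ∑ k ∈ R, ENNReal.ofReal (P * _root_.pick B n k j) * ENNReal.ofReal (1 - q k) =
              ENNReal.ofReal (∑ k ∈ R, P * _root_.pick B n k j * (1 - q k)) := by
            rw [ENNReal.ofReal_sum_of_nonneg fun k hk =>
              mul_nonneg (hp0 k) (sub_nonneg.2 (hq1 k hk))]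
            exact Finset.sum_congr rfl fun k _ => (ENNReal.ofReal_mul (hp0 k)).symm
          rw [this, ← ENNReal.ofReal_add (by linarith) (Finset.sum_nonneg fun k hk =>
            mul_nonneg (hp0 k) (sub_nonneg.2 (hq1 k hk)))]
          congr 1
          rw [hsuc]
          simp only [mul_sub, mul_one, Finset.sum_sub_distrib]
          rw [← Finset.mul_sum, ← hS]
          ring
        refine le_of_eq ?_
        simp only [g]
        rw [← hS]
        clear_value S
        calc _ = (c * (n * 12 + 21 : ℕ) + E) * (ENNReal.ofReal (1 - S) +
                ∑ k ∈ R, ENNReal.ofReal (P * _root_.pick B n k j)) +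
              ((∑ k ∈ R, ENNReal.ofReal (P * _root_.pick B n k j) * ENNReal.ofReal (q k)) * a +
              (ENNReal.ofReal (1 - S) +
                ∑ k ∈ R, ENNReal.ofReal (P * _root_.pick B n k j) * ENNReal.ofReal (1 - q k)) *
                b) := by
              rw [← sum_choice_eq, ← add_assoc]
              simp only [← add_assoc]
          _ = _ := by rw [hsum1, hsum2, hsum3, mul_one]
    calc Φ (.loop (ltSize 4) columnStep :: K, s)
        ≤ c + (c + (c * (n * 7 + 7 : ℕ) + (c + (c + (c * (n * 12 + 21 : ℕ) + E +
          (ENNReal.ofReal (successProb B n R j) * a +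
          ENNReal.ofReal (1 - successProb B n R j) * b)))))) := by
          refine (hΦ.loop_le (by simpa [hs.column, hs.size] using hjn)).trans ?_
          refine add_le_add le_rfl ((hΦ.seq_le _ _ _ _).trans (add_le_add le_rfl ?_))
          refine hΦ.ends (hs.ends_multiplyDecays hjn hR) ?_
          rintro s₁ ⟨hs₁, hs₁P⟩
          refine (hΦ.seq_le _ _ _ _).trans (add_le_add le_rfl ?_)
          exact (hΦ.rand_le _ _ _).trans (add_le_add le_rfl (hrand s₁ hs₁ hs₁P))
      _ = _ := by
          rw [hE]
          push_cast
          ring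

lemma Between.ends_startTrial (h : Between B n U m r T s) :
    Ends startTrial s (n * 4 + 7) fun s' =>
      InTrial B n U m r (T + 1) (Finset.range n) 0 s' := by
  have h1 : Between B n U m r (T + 1) ⟨s.nat, Function.update s.real ((rAddr 6).eval s)
      ((RExp.add (rReg 6) (.lit 1)).eval s)⟩ := by
    refine ⟨h.toReady.update_real (by simp [h.square]), h.remaining, ?_⟩
    simp [h.square, RExp.eval, h.count]
  refine Ends.mono (t := 1 + ((1 + (n * (3 + 1) + 1) + 1) + 1 + 1) + 1) (Ends.seq (Ends.setR
    (Ends.seq (Ends.seq (Ends.setN ((Ends.loop (fun i s => Between B n U m r (T + 1) s ∧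
      s.nat 2 = i ∧ ∀ k < i, s.nat (10 + k) = 0) ?_ ?_ ?_).mono le_rfl ?_))))))
    (by omega) fun _ h => h
  · exact ⟨h1.update_nat (by simp [NExp.eval]) (by simp [NExp.eval]), by simp [NExp.eval], by simp⟩
  · rintro i hi s ⟨hs, h2, h3⟩
    refine ⟨by simpa [h2, hs.size] using hi, ?_⟩
    refine Ends.mono (t := 1 + 1 + 1) (Ends.seq (Ends.setN (Ends.incr ⟨?_, ?_, ?_⟩))) le_rfl
      fun _ h => h
    · exact (hs.update_nat (by simp [NExp.eval]; omega) (by simp [NExp.eval]; omega)).update_nat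
        (by omega) (by omega)
    · simp [NExp.eval, h2, Function.update_of_ne (show 2 ≠ 10 + i by omega)]
    · intro k hk
      simp only [NExp.eval, nReg_eval, h2]
      rw [Function.update_of_ne (by omega)]
      by_cases hki : k = i
      · simp [hki]
      · rw [Function.update_of_ne (by omega)]
        exact h3 k (by omega)
  · rintro s ⟨hs, h2, -⟩
    simp [h2, hs.size]
  · rintro s ⟨hs, h2, h3⟩
    refine Ends.setN ⟨hs.update_nat (by simp [NExp.eval]) (by simp [NExp.eval]), by simp [NExp.eval],
      fun k hk => ?_⟩
    simp only [NExp.eval, Finset.mem_range, hk, iff_true]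
    rw [Function.update_of_ne (by omega)]
    exact h3 k hk

/-- The probability that a trial succeeds. -/
noncomputable def trialProb (B : ℕ → ℕ → Bool) (n : ℕ) : ℝ := successProb B n (Finset.range n) 0

/-- A bound for the number of steps of a trial. -/
def trialTime (n : ℕ) : ℕ := n * (n * 19 + 32) + n * 4 + 12

/-- A trial is one Bernoulli experiment with parameter `trialProb`; the two extra steps are the
final test and the update of the number of missing successes. -/
lemma IsValue.trial_le {c : ℝ≥0∞} {Φ : Config → ℝ≥0∞} (hΦ : IsValue c Φ) {K : List Prog}
    {a b : ℝ≥0∞} (ha : ∀ s, Between B n U m r (T + 1) s → Φ (K, s) ≤ a)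
    (hb : ∀ s, Between B n U m (r + 1) (T + 1) s → Φ (K, s) ≤ b)
    (hs : Between B n U m (r + 1) T s) :
    Φ (trial :: K, s) ≤ c * (trialTime n : ℕ) + (ENNReal.ofReal (trialProb B n) * a +
      ENNReal.ofReal (1 - trialProb B n) * b) := by
  have hcols : ∀ s₁, InTrial B n U m (r + 1) (T + 1) (Finset.range n) 0 s₁ →
      Φ (.loop (ltSize 4) columnStep ::
        .ite (.nle (nReg 4) (nReg 0)) (.setN (.lit 5) (.sub (nReg 5) (.lit 1))) .skip :: K, s₁) ≤
      c * (n * (n * 19 + 32) + 1 : ℕ) + (ENNReal.ofReal (trialProb B n) * (c * (2 : ℕ) + a) +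
        ENNReal.ofReal (1 - trialProb B n) * (c * (2 : ℕ) + b)) := by
    intro s₁ hs₁
    refine hΦ.columns_le (fun s hs => ?_) (fun R s hs => ?_) n 0 _ s₁ (by omega) (subset_refl _)
      (Finset.card_range n) hs₁
    · refine hΦ.ends (Q := Between B n U m r (T + 1)) (Ends.ite (t := 1) (fun _ => Ends.setN ?_)
        fun hc => ?_) ha
      · refine ⟨hs.toReady.update_nat (by simp [NExp.eval]), ?_, hs.count⟩
        simp [NExp.eval, hs.remaining]
      · simp [Cond.holds, hs.column, hs.size] at hc
    · refine hΦ.ends (Q := Between B n U m (r + 1) (T + 1)) (Ends.ite (t := 1) (fun hc => ?_)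
        fun _ => Ends.skip hs.toBetween) hb
      simp [Cond.holds, hs.column, hs.size] at hc
  have hq0 : 0 ≤ trialProb B n := successProb_nonneg _ _ _ _
  have hq1 : trialProb B n ≤ 1 :=
    successProb_le_one B n n _ _ (by omega) (Finset.card_range n)
  have hone : ENNReal.ofReal (trialProb B n) + ENNReal.ofReal (1 - trialProb B n) = 1 := by
    rw [← ENNReal.ofReal_add hq0 (by linarith)]
    simp
  calc Φ (trial :: K, s) ≤ c + (c * (n * 4 + 7 : ℕ) + (c + (c * (n * (n * 19 + 32) + 1 : ℕ) +
        (ENNReal.ofReal (trialProb B n) * (c * (2 : ℕ) + a) +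
        ENNReal.ofReal (1 - trialProb B n) * (c * (2 : ℕ) + b))))) := by
        refine (hΦ.seq_le _ _ _ _).trans (add_le_add le_rfl ?_)
        refine hΦ.ends hs.ends_startTrial fun s₁ hs₁ => ?_
        exact (hΦ.seq_le _ _ _ _).trans (add_le_add le_rfl (hcols s₁ hs₁))
    _ = c + c * (n * 4 + 7 : ℕ) + c + c * (n * (n * 19 + 32) + 1 : ℕ) +
        c * 2 * (ENNReal.ofReal (trialProb B n) + ENNReal.ofReal (1 - trialProb B n)) +
        (ENNReal.ofReal (trialProb B n) * a + ENNReal.ofReal (1 - trialProb B n) * b) := by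
        push_cast
        ring
    _ = _ := by
        rw [hone, trialTime]
        push_cast
        ring

/-! ### The loop over the trials -/

/-- A potential that does not decrease on average in a trial bounds the value of the loop. -/
lemma IsValue.trials_le {c : ℝ≥0∞} {Φ : Config → ℝ≥0∞} (hΦ : IsValue c Φ) {K : List Prog}
    (hq : 0 < trialProb B n) (v : ℕ → ℕ → ℝ≥0∞)
    (h0 : ∀ T s, Between B n U m 0 T s → c + Φ (K, s) ≤ v 0 T)
    (hv : ∀ r T, c * (trialTime n + 1 : ℕ) + (ENNReal.ofReal (trialProb B n) * v r (T + 1) +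
      ENNReal.ofReal (1 - trialProb B n) * v (r + 1) (T + 1)) ≤ v (r + 1) T) (r : ℕ) :
    ∀ T s, Between B n U m r T s → Φ (trials :: K, s) ≤ v r T := by
  induction r with
  | zero =>
    intro T s hs
    refine (hΦ.loop_done_le ?_).trans (h0 T s hs)
    simp [Cond.holds, hs.remaining, NExp.eval]
  | succ r ih =>
    obtain ⟨M, hM, hΦM⟩ := hΦ.bounded
    -- The largest excess of Φ over the potential with `r + 1` successes missing. A failed trial
    -- keeps `r + 1` but raises `T`, so the supremum runs over all `T`.
    set D : ℝ≥0∞ := ⨆ (T : ℕ) (s : Store) (_ : Between B n U m (r + 1) T s),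
      (Φ (trials :: K, s) - v (r + 1) T) with hD
    have hDM : D ≤ M := iSup_le fun T => iSup_le fun s => iSup_le fun _ =>
      tsub_le_self.trans (hΦM _)
    have hDtop : D ≠ ⊤ := ne_top_of_le_ne_top hM hDM
    have hle : ∀ T s, Between B n U m (r + 1) T s → Φ (trials :: K, s) ≤ v (r + 1) T + D := by
      intro T s hs
      rw [← tsub_le_iff_left]
      exact le_iSup_of_le T (le_iSup_of_le s (le_iSup_of_le hs le_rfl))
    have hstep : ∀ T s, Between B n U m (r + 1) T s →
        Φ (trials :: K, s) ≤ v (r + 1) T + ENNReal.ofReal (1 - trialProb B n) * D := by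
      intro T s hs
      have h1 := hΦ.loop_le (c := .nle (.lit 1) (nReg 5)) (P := trial) (K := K) (s := s)
        (by simp [Cond.holds, hs.remaining, NExp.eval])
      have h2 := hΦ.trial_le (K := trials :: K) (fun s hs => ih (T + 1) s hs)
        (fun s hs => hle (T + 1) s hs) hs
      calc Φ (trials :: K, s) ≤ c + (c * (trialTime n : ℕ) +
            (ENNReal.ofReal (trialProb B n) * v r (T + 1) +
            ENNReal.ofReal (1 - trialProb B n) * (v (r + 1) (T + 1) + D))) :=
            h1.trans (add_le_add le_rfl h2)
        _ = c * (trialTime n + 1 : ℕ) + (ENNReal.ofReal (trialProb B n) * v r (T + 1) +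
            ENNReal.ofReal (1 - trialProb B n) * v (r + 1) (T + 1)) +
            ENNReal.ofReal (1 - trialProb B n) * D := by push_cast; ring
        _ ≤ _ := by gcongr; exact hv r T
    -- An excess can only survive a failed trial. As Φ is bounded, `D` is finite, and `D ≤ (1 - q)
    -- D` with q > 0 forces `D = 0`.
    have hDle : D ≤ ENNReal.ofReal (1 - trialProb B n) * D :=
      iSup_le fun T => iSup_le fun s => iSup_le fun hs => tsub_le_iff_left.2 (hstep T s hs)
    have hD0 : D = 0 := by
      by_contra hne
      have h1 : ENNReal.ofReal (1 - trialProb B n) < 1 := by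
        rw [← ENNReal.ofReal_one]
        exact (ENNReal.ofReal_lt_ofReal_iff one_pos).2 (by linarith)
      have := (ENNReal.mul_lt_mul_iff_left (pos_iff_ne_zero.2 hne).ne' hDtop).2 h1
      rw [one_mul] at this
      exact absurd hDle (not_le.2 this)
    intro T s hs
    simpa [hD0] using hle T s hs

end

/-! ### The preparation -/

section
variable {B : ℕ → ℕ → Bool} {n : ℕ} {ε δ : ℝ} {s : Store}

/-- The input is still present, and `n²` has been computed. -/
structure Input (B : ℕ → ℕ → Bool) (n : ℕ) (ε δ : ℝ) (s : Store) : Prop where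
  size : s.nat 0 = n
  square : s.nat 1 = n * n
  accuracy : s.real 0 = ε
  confidence : s.real 1 = δ
  entries : ∀ k < n, ∀ j < n, s.real (2 + j + k * n) = if B k j then 1 else 0

lemma Input.update_nat (h : Input B n ε δ s) {a v : ℕ} (ha : 2 ≤ a) :
    Input B n ε δ ⟨Function.update s.nat a v, s.real⟩ where
  size := by simp [Function.update_of_ne (show 0 ≠ a by omega), h.size]
  square := by simp [Function.update_of_ne (show 1 ≠ a by omega), h.square]
  accuracy := h.accuracy
  confidence := h.confidence
  entries := h.entries

lemma Input.update_real (h : Input B n ε δ s) {a : ℕ} {v : ℝ} (ha : n * n + 2 ≤ a) :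
    Input B n ε δ ⟨s.nat, Function.update s.real a v⟩ where
  size := h.size
  square := h.square
  accuracy := by rw [← h.accuracy]; exact Function.update_of_ne (by omega) _ _
  confidence := by rw [← h.confidence]; exact Function.update_of_ne (by omega) _ _
  entries k hk j hj := by
    have := pos_lt hk hj
    rw [← h.entries k hk j hj]
    exact Function.update_of_ne (by omega) _ _

lemma inputStore_entry {n : ℕ} (X : Fin n → Fin n → Bool) (ε δ : ℝ) {k j : ℕ} (hk : k < n)
    (hj : j < n) : (inputStore (zeroOneMatrix X) ε δ).real (2 + j + k * n) =
      if boolArray X k j then 1 else 0 := by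
  have h := pos_lt hk hj
  have h1 : 2 + j + k * n - 2 = j + k * n := by omega
  have he : finProdFinEquiv.symm (⟨j + k * n, h⟩ : Fin (n * n)) = (⟨k, hk⟩, ⟨j, hj⟩) := by
    rw [Equiv.symm_apply_eq]
    ext
    simp [finProdFinEquiv, mul_comm]
  simp only [inputStore, h1]
  rw [if_neg (by omega), if_neg (by omega), dif_pos h, he]
  simp [zeroOneMatrix, boolArray, hk, hj]

lemma ends_computeSquare {n : ℕ} (X : Fin n → Fin n → Bool) (ε δ : ℝ) :
    Ends computeSquare (inputStore (zeroOneMatrix X) ε δ) (n * 4 + 1)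
      (Input (boolArray X) n ε δ) := by
  refine (Ends.loop (t := 3) (fun i s => s.real = (inputStore (zeroOneMatrix X) ε δ).real ∧
    s.nat 0 = n ∧ s.nat 1 = i * n ∧ s.nat 2 = i) ?_ ?_ ?_).mono le_rfl ?_
  · simp [inputStore]
  · rintro i hi s ⟨h1, h2, h3, h4⟩
    refine ⟨by simpa [h2, h4] using hi, Ends.seq (Ends.setN (Ends.incr ⟨h1, ?_, ?_, ?_⟩))⟩
    · simp [NExp.eval, h2]
    · simp [NExp.eval, h3, h2]; ring
    · simp [NExp.eval, h4]
  · rintro s ⟨-, h2, -, h4⟩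
    simp [h2, h4]
  · rintro s ⟨h1, h2, h3, -⟩
    refine ⟨h2, h3, ?_, ?_, fun k hk j hj => ?_⟩
    · rw [h1]; simp [inputStore]
    · rw [h1]; simp [inputStore]
    · rw [h1, inputStore_entry X ε δ hk hj]

lemma Input.ends_computeExpSum (h : Input B n ε δ s) :
    Ends computeExpSum s (n * 8 + 9) fun s' => Input B n ε δ s' ∧
      s'.real (3 * (n * n) + 2 + 0) = expSum n := by
  refine Ends.mono (t := 1 + (1 + (1 + (1 + (n * (7 + 1) + 1) + 1) + 1) + 1) + 1)
    (Ends.seq (Ends.setN (Ends.seq (Ends.setR (Ends.seq (Ends.setR (Ends.seq (Ends.setR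
    ((Ends.loop (t := 7) (fun i s => Input B n ε δ s ∧ s.nat 2 = i ∧
      s.real (3 * (n * n) + 2 + 0) = expSum i ∧ s.real (3 * (n * n) + 2 + 1) = i ∧
      s.real (3 * (n * n) + 2 + 2) = 1 / (i.factorial : ℝ)) ?_ ?_ ?_).mono le_rfl ?_)))))))))
    (by omega) fun _ h => h
  · refine ⟨(((h.update_nat ?_).update_real ?_).update_real ?_).update_real ?_, ?_, ?_, ?_, ?_⟩ <;>
      simp [NExp.eval, RExp.eval, h.square, expSum] <;> omega
  · rintro i hi s ⟨hs, h1, h2, h3, h4⟩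
    refine ⟨by simpa [h1, hs.size] using hi, ?_⟩
    refine Ends.mono (t := 1 + (1 + (1 + 1 + 1) + 1) + 1) (Ends.seq (Ends.setR (Ends.seq (Ends.setR
      (Ends.seq (Ends.setR (Ends.incr ⟨?_, ?_, ?_, ?_, ?_⟩))))))) le_rfl fun _ h => h
    · refine (((hs.update_real ?_).update_real ?_).update_real ?_).update_nat ?_ <;>
        simp [hs.square] <;> omega
    · simp [h1]
    · simp [RExp.eval, hs.square, h2, h3, h4]
      rw [expSum, expSum, Finset.sum_range_succ _ (i + 1), Nat.factorial_succ]
      push_cast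
      field_simp
    · simp [RExp.eval, hs.square, h3]
    · simp [RExp.eval, hs.square, h3, h4, Nat.factorial_succ]
      field_simp
  · rintro s ⟨hs, h1, -⟩
    simp [h1, hs.size]
  · rintro s ⟨hs, -, h2, -⟩
    exact ⟨hs, h2⟩

/-- The number of successes that are needed for the approximation. -/
noncomputable def target (ε δ : ℝ) : ℕ := ⌊(1 + ε) * (1 + ε) / (δ * (ε * ε))⌋₊ + 1

lemma Input.ends_computeTarget (h : Input B n ε δ s) (hε : 0 < ε) (hδ : 0 < δ)
    (he : s.real (3 * (n * n) + 2 + 0) = expSum n) :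
    Ends computeTarget s (target ε δ * 4 + 5) fun s' => Input B n ε δ s' ∧
      s'.real (3 * (n * n) + 2 + 0) = expSum n ∧ s'.nat 5 = target ε δ ∧
      s'.real (3 * (n * n) + 2 + 5) = target ε δ := by
  refine Ends.mono (t := 1 + (1 + (target ε δ * (3 + 1) + 1) + 1) + 1)
    (Ends.seq (Ends.setN (Ends.seq (Ends.setR
    ((Ends.loop (t := 3) (fun i s => Input B n ε δ s ∧
      s.real (3 * (n * n) + 2 + 0) = expSum n ∧ s.nat 5 = i ∧
      s.real (3 * (n * n) + 2 + 5) = i) ?_ ?_ ?_).mono le_rfl fun _ h => h)))))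
    (by omega) fun _ h => h
  · refine ⟨(h.update_nat ?_).update_real ?_, ?_, ?_, ?_⟩ <;>
      simp [NExp.eval, RExp.eval, h.square, ← he]
    omega
  · rintro i hi s ⟨hs, h1, h2, h3⟩
    refine ⟨?_, Ends.seq (Ends.setR (Ends.incr ⟨?_, ?_, ?_, ?_⟩))⟩
    · simp only [Cond.holds, rReg_eval, hs.square, h3, trialTarget, RExp.eval, NExp.eval,
        hs.accuracy, hs.confidence, Nat.cast_one]
      rw [← Nat.le_floor_iff (by positivity)]
      exact Nat.lt_succ_iff.1 hi
    · refine (hs.update_real ?_).update_nat ?_ <;> simp [hs.square]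
      omega
    · simp [hs.square, ← h1]
    · simp [h2]
    · simp [RExp.eval, hs.square, h3]
  · rintro s ⟨hs, h1, h2, h3⟩
    simp only [Cond.holds, rReg_eval, hs.square, h3, trialTarget, RExp.eval, NExp.eval,
      hs.accuracy, hs.confidence, Nat.cast_one, not_le, target]
    push_cast
    exact Nat.lt_floor_add_one _

/-! ### Filling the tables of decays and picks -/

/-- The memory while the tables are filled in; the positions satisfying `done` are completed. -/
structure Filling (B : ℕ → ℕ → Bool) (n : ℕ) (ε δ : ℝ) (m : ℕ) (done : ℕ → ℕ → Prop) (p i : ℕ)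
    (s : Store) : Prop extends Input B n ε δ s where
  base : s.real (3 * (n * n) + 2 + 0) = expSum n
  remaining : s.nat 5 = m
  target : s.real (3 * (n * n) + 2 + 5) = m
  count : s.real (3 * (n * n) + 2 + 6) = 0
  row : s.nat 2 = i
  position : s.nat 3 = p
  decay : ∀ k < n, ∀ j < n, done k j → s.real (n * n + (2 + j + k * n)) = decay B n k j
  pick : ∀ k < n, ∀ j < n, done k j → s.real (n * n + (n * n + (2 + j + k * n))) = pick B n k j

variable {m : ℕ} {done : ℕ → ℕ → Prop} {p i : ℕ}

lemma Filling.mono (h : Filling B n ε δ m done p i s) {done' : ℕ → ℕ → Prop}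
    (hd : ∀ k j, done' k j → done k j) : Filling B n ε δ m done' p i s :=
  { h with
    decay := fun k hk j hj h' => h.decay k hk j hj (hd k j h')
    pick := fun k hk j hj h' => h.pick k hk j hj (hd k j h') }

lemma Filling.setCounter (h : Filling B n ε δ m done p i s) (v : ℕ) :
    Filling B n ε δ m done p i ⟨Function.update s.nat 6 v, s.real⟩ where
  toInput := h.toInput.update_nat (by omega)
  base := h.base
  remaining := by simp [h.remaining]
  target := h.target
  count := h.count
  row := by simp [h.row]
  position := by simp [h.position]
  decay := h.decay
  pick := h.pick

lemma Filling.setRow (h : Filling B n ε δ m done p i s) (v : ℕ) :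
    Filling B n ε δ m done p v ⟨Function.update s.nat 2 v, s.real⟩ where
  toInput := h.toInput.update_nat (by omega)
  base := h.base
  remaining := by simp [h.remaining]
  target := h.target
  count := h.count
  row := by simp
  position := by simp [h.position]
  decay := h.decay
  pick := h.pick

lemma Filling.setPosition (h : Filling B n ε δ m done p i s) (v : ℕ) :
    Filling B n ε δ m done v i ⟨Function.update s.nat 3 v, s.real⟩ where
  toInput := h.toInput.update_nat (by omega)
  base := h.base
  remaining := by simp [h.remaining]
  target := h.target
  count := h.count
  row := by simp [h.row]
  position := by simp
  decay := h.decay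
  pick := h.pick

lemma Filling.setReg (h : Filling B n ε δ m done p i s) {a : ℕ} {v : ℝ}
    (ha : a = 3 * (n * n) + 2 + 3 ∨ a = 3 * (n * n) + 2 + 4) :
    Filling B n ε δ m done p i ⟨s.nat, Function.update s.real a v⟩ where
  toInput := h.toInput.update_real (by omega)
  base := by rw [← h.base]; exact Function.update_of_ne (by omega) _ _
  remaining := h.remaining
  target := by rw [← h.target]; exact Function.update_of_ne (by omega) _ _
  count := by rw [← h.count]; exact Function.update_of_ne (by omega) _ _
  row := h.row
  position := h.position
  decay k hk j hj hd := by
    have := pos_lt hk hj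
    rw [← h.decay k hk j hj hd]
    exact Function.update_of_ne (by omega) _ _
  pick k hk j hj hd := by
    have := pos_lt hk hj
    rw [← h.pick k hk j hj hd]
    exact Function.update_of_ne (by omega) _ _

lemma pos_injective {k j k' j' : ℕ} (hj : j < n) (hj' : j' < n)
    (h : j + k * n = j' + k' * n) : k = k' ∧ j = j' := by
  have h1 : j = j' := by
    have := congrArg (· % n) h
    simpa [Nat.add_mul_mod_self_right, Nat.mod_eq_of_lt hj, Nat.mod_eq_of_lt hj'] using this
  subst h1
  exact ⟨Nat.eq_of_mul_eq_mul_right (by omega) (Nat.add_left_cancel h), rfl⟩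

lemma Filling.setEntry (h : Filling B n ε δ m done p i s) {k j : ℕ} (hk : k < n) (hj : j < n) :
    Filling B n ε δ m (fun k' j' => done k' j' ∨ k' = k ∧ j' = j) p i
      ⟨s.nat, Function.update (Function.update s.real (n * n + (2 + j + k * n))
        (_root_.decay B n k j)) (n * n + (n * n + (2 + j + k * n))) (_root_.pick B n k j)⟩ := by
  have hlt := pos_lt hk hj
  refine ⟨(h.toInput.update_real (by omega)).update_real (by omega), ?_, h.remaining, ?_, ?_, h.row,
    h.position, ?_, ?_⟩
  · simp only
    rw [Function.update_of_ne (by omega), Function.update_of_ne (by omega), h.base]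
  · simp only
    rw [Function.update_of_ne (by omega), Function.update_of_ne (by omega), h.target]
  · simp only
    rw [Function.update_of_ne (by omega), Function.update_of_ne (by omega), h.count]
  · rintro k' hk' j' hj' hd
    have := pos_lt hk' hj'
    simp only
    rw [Function.update_of_ne (by omega)]
    by_cases heq : j' + k' * n = j + k * n
    · obtain ⟨rfl, rfl⟩ := pos_injective hj' hj heq
      simp
    · rw [Function.update_of_ne (by omega)]
      refine h.decay k' hk' j' hj' (hd.resolve_right ?_)
      rintro ⟨rfl, rfl⟩
      exact heq rfl
  · rintro k' hk' j' hj' hd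
    have := pos_lt hk' hj'
    simp only
    by_cases heq : j' + k' * n = j + k * n
    · obtain ⟨rfl, rfl⟩ := pos_injective hj' hj heq
      simp
    · rw [Function.update_of_ne (by omega), Function.update_of_ne (by omega)]
      refine h.pick k' hk' j' hj' (hd.resolve_right ?_)
      rintro ⟨rfl, rfl⟩
      exact heq rfl

/-- Both table entries depend only on the row bound for the columns to the right of `j` and on its
successor. For an entry zero the bound does not change, so the decay is 1 and the pick 0. -/
lemma Filling.ends_fillEntry {k j : ℕ} (hk : k < n) (hj : j < n)
    (h : Filling B n ε δ m done (2 + (j + 1) + k * n) i s)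
    (hr : s.real (3 * (n * n) + 2 + 3) = rowBound (onesFrom B n k (j + 1))) :
    Ends fillEntry s 10 fun s' =>
      Filling B n ε δ m (fun k' j' => done k' j' ∨ k' = k ∧ j' = j) (2 + j + k * n) i s' ∧
      s'.real (3 * (n * n) + 2 + 3) = rowBound (onesFrom B n k j) ∧ s'.nat 6 = s.nat 6 + 1 ∧
      s'.real (3 * (n * n) + 2 + 4) = s.real (3 * (n * n) + 2 + 4) := by
  have hlt := pos_lt hk hj
  have hp : s.nat 3 - 1 = 2 + j + k * n := by rw [h.position]; omega
  have h1 := h.setPosition (2 + j + k * n)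
  have hones := onesFrom_eq B k hj
  refine Ends.mono (t := 1 + ((5 + 1) + 1 + 1) + 1) (Ends.seq (Ends.setN (Ends.seq (Ends.ite
    (fun hc => ?_) fun hc => ?_)))) (by omega) fun _ h => h
  · simp only [Cond.holds, RExp.eval, NExp.eval, nReg_eval, hp, Function.update_self,
      Nat.cast_one, h.entries k hk j hj] at hc
    have hB : B k j = true := by
      by_contra hne
      rw [if_neg hne] at hc
      linarith
    rw [if_pos hB] at hones
    have hd : _root_.decay B n k j = rowBound (onesFrom B n k (j + 1)) /
        nextBound (rowBound (onesFrom B n k (j + 1))) := by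
      rw [_root_.decay, hones]
      rfl
    have hpk : _root_.pick B n k j = expSum n / rowBound (onesFrom B n k (j + 1)) := by
      rw [_root_.pick, if_pos hB]
    have h2 := (h1.setEntry hk hj).setReg (a := 3 * (n * n) + 2 + 3)
      (v := rowBound (onesFrom B n k j)) (Or.inl rfl)
    have hfin := h2.setCounter (s.nat 6 + 1)
    refine Ends.mono (t := 1 + (1 + 1 + 1) + 1) (Ends.seq (Ends.setR (Ends.seq (Ends.setR
      (Ends.setR (Ends.incr ?_)))))) le_rfl fun _ h => h
    have hne1 : 3 * (n * n) + 2 + 3 ≠ n * n + (2 + j + k * n) := by omega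
    have hne2 : 3 * (n * n) + 2 + 3 ≠ n * n + (n * n + (2 + j + k * n)) := by omega
    have hne3 : 3 * (n * n) + 2 + 0 ≠ n * n + (2 + j + k * n) := by omega
    have hne4 : 3 * (n * n) + 2 + 4 ≠ n * n + (2 + j + k * n) := by omega
    have hne5 : 3 * (n * n) + 2 + 4 ≠ n * n + (n * n + (2 + j + k * n)) := by omega
    have hn1 : Function.update s.nat 3 (2 + j + k * n) 1 = n * n := by simp [h.square]
    have hn6 : Function.update s.nat 3 (2 + j + k * n) 6 = s.nat 6 := by simp
    have hnb : nextBound (rowBound (onesFrom B n k (j + 1))) = rowBound (onesFrom B n k j) := by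
      rw [hones]; rfl
    simp only [NExp.eval, nReg_eval, hp, decayAddr_eval, pickAddr_eval, rAddr_eval, hn1, hn6,
      Function.update_self, RExp.eval, rReg_eval, nextBoundExp, Nat.cast_one, Nat.cast_ofNat,
      Function.update_of_ne hne1, Function.update_of_ne hne2, Function.update_of_ne hne3, hr, h.base]
    simp only [nextBound] at hd hnb
    rw [← hd, ← hpk, hnb]
    refine ⟨hfin, by simp, by simp, ?_⟩
    rw [Function.update_of_ne (by omega), Function.update_of_ne hne5, Function.update_of_ne hne4]
  · simp only [Cond.holds, RExp.eval, NExp.eval, nReg_eval, hp, Function.update_self,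
      Nat.cast_one, h.entries k hk j hj] at hc
    have hB : ¬ B k j = true := by
      intro hB
      rw [if_pos hB] at hc
      linarith
    rw [if_neg hB, add_zero] at hones
    have hd : _root_.decay B n k j = 1 := by
      rw [_root_.decay, hones, div_self (rowBound_pos _).ne']
    have hpk : _root_.pick B n k j = 0 := by rw [_root_.pick, if_neg hB]
    have hfin := (h1.setEntry hk hj).setCounter (s.nat 6 + 1)
    refine Ends.mono (t := 1 + 1 + 1) (Ends.seq (Ends.setR (Ends.setR (Ends.incr ?_)))) (by omega)
      fun _ h => h
    have hn1 : Function.update s.nat 3 (2 + j + k * n) 1 = n * n := by simp [h.square]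
    have hn6 : Function.update s.nat 3 (2 + j + k * n) 6 = s.nat 6 := by simp
    simp only [NExp.eval, nReg_eval, hp, decayAddr_eval, pickAddr_eval, hn1, hn6,
      Function.update_self, RExp.eval, Nat.cast_one, Nat.cast_zero]
    rw [hd, hpk] at hfin
    refine ⟨hfin, ?_, by simp, ?_⟩
    · rw [Function.update_of_ne (by omega), Function.update_of_ne (by omega), hr, hones]
    · rw [Function.update_of_ne (by omega), Function.update_of_ne (by omega)]

lemma Filling.ends_fillRow {k : ℕ} (hk : k + i + 1 = n)
    (h : Filling B n ε δ m (fun k' _ => n ≤ k' + i) (2 + n + k * n) i s) :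
    Ends fillRow s (n * 11 + 9) fun s' =>
      Filling B n ε δ m (fun k' _ => n ≤ k' + (i + 1)) (2 + k * n) (i + 1) s' ∧
      s'.real (3 * (n * n) + 2 + 4) = s.real (3 * (n * n) + 2 + 4) *
        (rowBound (onesFrom B n k 0) / expSum n) := by
  have h1 := (h.setCounter 0).setReg (a := 3 * (n * n) + 2 + 3) (v := 1) (Or.inl rfl)
  refine Ends.mono (t := 1 + (1 + ((n * (10 + 1) + 1) + (1 + 1 + 1) + 1) + 1) + 1)
    (Ends.seq (Ends.setN (Ends.seq (Ends.setR (Ends.seq ((Ends.loop (t := 10) (fun l s' =>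
      Filling B n ε δ m (fun k' j' => n ≤ k' + i ∨ k' + i + 1 = n ∧ n ≤ j' + l)
        (2 + (n - l) + k * n) i s' ∧ s'.nat 6 = l ∧
      s'.real (3 * (n * n) + 2 + 3) = rowBound (onesFrom B n k (n - l)) ∧
      s'.real (3 * (n * n) + 2 + 4) = s.real (3 * (n * n) + 2 + 4)) ?_ ?_ ?_).mono le_rfl ?_))))))
    (by omega) fun _ h => h
  · simp only [NExp.eval, RExp.eval, rAddr_eval, Nat.cast_one, Nat.sub_zero]
    rw [Function.update_of_ne (show (1 : ℕ) ≠ 6 by omega), h.square]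
    refine ⟨?_, by simp, by simp [onesFrom_self, rowBound], by simp⟩
    have h1' : Filling B n ε δ m (fun k' _ => n ≤ k' + i) (2 + n + k * n) i
      ⟨Function.update s.nat 6 0, Function.update s.real (3 * (n * n) + 2 + 3) 1⟩ := h1
    exact ⟨h1'.toInput, h1'.base, h1'.remaining, h1'.target, h1'.count, h1'.row, h1'.position,
      fun k' hk' j' hj' hd => h1'.decay k' hk' j' hj' (by omega),
      fun k' hk' j' hj' hd => h1'.pick k' hk' j' hj' (by omega)⟩
  · rintro l hl s₁ ⟨hs, h6, h3, h4⟩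
    refine ⟨by simpa [h6, hs.size] using hl, ?_⟩
    obtain ⟨j, hj⟩ : ∃ j, n = j + l + 1 := ⟨n - l - 1, by omega⟩
    have e1 : n - l = j + 1 := by omega
    have e2 : n - (l + 1) = j := by omega
    rw [e1] at hs h3
    rw [e2]
    refine (hs.ends_fillEntry (by omega) (by omega) h3).mono le_rfl ?_
    rintro s' ⟨g1, g2, g3, g4⟩
    refine ⟨g1.mono ?_, by rw [g3, h6], g2, by rw [g4, h4]⟩
    intro k' j' hd
    omega
  · rintro s₁ ⟨hs, h6, -⟩
    simp [h6, hs.size]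
  · rintro s₁ ⟨hs, h6, h3, h4⟩
    rw [Nat.sub_self] at hs h3
    refine Ends.seq (Ends.setR (Ends.incr ?_))
    have hs2 := (hs.setReg (a := 3 * (n * n) + 2 + 4)
      (v := (RExp.mul (rReg 4) (.div (rReg 3) (rReg 0))).eval s₁) (Or.inr rfl)).setRow (i + 1)
    rw [rAddr_eval, hs.square, hs.row]
    refine ⟨?_, ?_⟩
    · exact ⟨hs2.toInput, hs2.base, hs2.remaining, hs2.target, hs2.count, hs2.row, hs2.position,
        fun k' hk' j' hj' hd => hs2.decay k' hk' j' hj' (by omega),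
        fun k' hk' j' hj' hd => hs2.pick k' hk' j' hj' (by omega)⟩
    · simp only [Function.update_self, RExp.eval, rReg_eval, hs.square, h3, h4, hs.base]

lemma Input.ends_fillTables (h : Input B n ε δ s)
    (he : s.real (3 * (n * n) + 2 + 0) = expSum n) (h5 : s.nat 5 = m)
    (ht : s.real (3 * (n * n) + 2 + 5) = m) :
    Ends fillTables s (n * (n * 11 + 10) + 9) fun s' =>
      Between B n (minorBound B n (Finset.range n) 0) m m 0 s' := by
  refine Ends.mono (t := 1 + (1 + (1 + (1 + (n * ((n * 11 + 9) + 1) + 1) + 1) + 1) + 1) + 1)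
    (Ends.seq (Ends.setN (Ends.seq (Ends.setN (Ends.seq (Ends.setR (Ends.seq (Ends.setR
    ((Ends.loop (t := n * 11 + 9) (fun i s' =>
      Filling B n ε δ m (fun k' _ => n ≤ k' + i) (2 + (n - i) * n) i s' ∧
      s'.real (3 * (n * n) + 2 + 4) =
        ∏ l ∈ Finset.range i, rowBound (onesFrom B n (n - 1 - l) 0) / expSum n)
      ?_ ?_ ?_).mono le_rfl ?_)))))))))
    (by ring_nf; omega) fun _ h => h
  · refine ⟨⟨(((h.update_nat ?_).update_nat ?_).update_real ?_).update_real ?_, ?_, ?_, ?_, ?_, ?_,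
      ?_, ?_, ?_⟩, ?_⟩
    · simp [NExp.eval]
    · simp [NExp.eval]
    · simp [NExp.eval, h.square]; omega
    · simp [NExp.eval, h.square]; omega
    · simp [NExp.eval, h.square, ← he]
    · simp [NExp.eval, h5]
    · simp [NExp.eval, h.square, ← ht]
    · simp [NExp.eval, h.square, RExp.eval]
    · simp [NExp.eval]
    · simp [NExp.eval, h.square, add_comm]
    · intro k hk j hj hd; omega
    · intro k hk j hj hd; omega
    · simp [NExp.eval, h.square, RExp.eval]
  · rintro i hi s₁ ⟨hs, hM⟩
    refine ⟨by simpa [hs.row, hs.size] using hi, ?_⟩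
    obtain ⟨k, hk⟩ : ∃ k, k + i + 1 = n := ⟨n - i - 1, by omega⟩
    have e1 : n - i = k + 1 := by omega
    have e2 : n - (i + 1) = k := by omega
    have e3 : 2 + (k + 1) * n = 2 + n + k * n := by ring
    rw [e1, e3] at hs
    refine (hs.ends_fillRow hk).mono le_rfl ?_
    rintro s' ⟨g1, g2⟩
    rw [e2]
    refine ⟨g1, ?_⟩
    rw [g2, hM, Finset.prod_range_succ, show n - 1 - i = k by omega]
  · rintro s₁ ⟨hs, -⟩
    simp [hs.row, hs.size]
  · rintro s₁ ⟨hs, hM⟩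
    -- The factors of U were multiplied in from the last row to the first.
    rw [Finset.prod_range_reflect (fun k => rowBound (onesFrom B n k 0) / expSum n) n] at hM
    exact ⟨⟨hs.size, hs.square, fun k hk j hj => hs.decay k hk j hj (by omega),
      fun k hk j hj => hs.pick k hk j hj (by omega), hM, hs.target⟩, hs.remaining,
      by rw [hs.count]; simp⟩

lemma ends_prepare {n : ℕ} (X : Fin n → Fin n → Bool) {ε δ : ℝ} (hε : 0 < ε) (hδ : 0 < δ) :
    Ends prepare (inputStore (zeroOneMatrix X) ε δ)
      (n * (n * 11 + 22) + target ε δ * 4 + 27) fun s' =>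
      Between (boolArray X) n (minorBound (boolArray X) n (Finset.range n) 0) (target ε δ)
        (target ε δ) 0 s' := by
  refine Ends.mono (t := (n * 4 + 1) + ((n * 8 + 9) + ((target ε δ * 4 + 5) +
    (n * (n * 11 + 10) + 9) + 1) + 1) + 1)
    (Ends.seq ((ends_computeSquare X ε δ).mono le_rfl fun s₁ hs₁ =>
    Ends.seq (hs₁.ends_computeExpSum.mono le_rfl fun s₂ hs₂ => Ends.seq
    ((hs₂.1.ends_computeTarget hε hδ hs₂.2).mono le_rfl fun s₃ hs₃ =>
    hs₃.1.ends_fillTables hs₃.2.1 hs₃.2.2.1 hs₃.2.2.2)))) (by ring_nf; omega) fun _ h => h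

end

/-! ### Correctness and running time -/

section
variable {n : ℕ} (X : Fin n → Fin n → Bool)

/-- The upper bound for the permanent that the sampling procedure uses. -/
noncomputable def permBound : ℝ := minorBound (boolArray X) n (Finset.range n) 0

lemma permBound_pos : 0 < permBound X := minorBound_pos _ _ _ _

/-- The estimator rests on this: the success frequency times `permBound X` estimates the permanent.
-/
lemma trialProb_eq :
    trialProb (boolArray X) n = (zeroOneMatrix X).permanent / permBound X := by
  rw [trialProb, successProb, Nat.sub_zero, permanent_eq_minorPerm, permBound]

lemma trialProb_le_one : trialProb (boolArray X) n ≤ 1 :=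
  successProb_le_one _ n n _ _ (by omega) (Finset.card_range n)

variable {X}

lemma IsValue.program_le {c : ℝ≥0∞} {Φ : Config → ℝ≥0∞} (hΦ : IsValue c Φ) {ε δ : ℝ}
    (hε : 0 < ε) (hδ : 0 < δ) {b : ℝ≥0∞}
    (hb : ∀ s, Between (boolArray X) n (permBound X) (target ε δ) (target ε δ) 0 s →
      Φ ([trials, writeOutput], s) ≤ b) :
    Φ ([permanentProgram], inputStore (zeroOneMatrix X) ε δ) ≤
      c * (n * (n * 11 + 22) + target ε δ * 4 + 29 : ℕ) + b := by
  calc _ ≤ c + (c * (n * (n * 11 + 22) + target ε δ * 4 + 27 : ℕ) + (c + b)) := by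
        refine (hΦ.seq_le _ _ _ _).trans (add_le_add le_rfl ?_)
        refine hΦ.ends (ends_prepare X hε hδ) fun s hs => ?_
        exact (hΦ.seq_le _ _ _ _).trans (add_le_add le_rfl (hb s hs))
    _ = _ := by push_cast; ring

lemma expectedTime_permanentProgram_le {ε δ : ℝ} (hε : 0 < ε) (hδ : 0 < δ)
    (hX : 0 < (zeroOneMatrix X).permanent) :
    expectedTime permanentProgram (inputStore (zeroOneMatrix X) ε δ) ≤
      ENNReal.ofReal ((n * (n * 11 + 22) + target ε δ * 4 + 31 : ℕ) + target ε δ *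
        ((trialTime n + 1 : ℕ) * (permBound X / (zeroOneMatrix X).permanent))) := by
  refine expectedTime_le_of_value fun Φ hΦ h0 => ?_
  have hq : trialProb (boolArray X) n = (zeroOneMatrix X).permanent / permBound X := trialProb_eq X
  have hqpos : 0 < trialProb (boolArray X) n := by rw [hq]; exact div_pos hX (permBound_pos X)
  have hq1 := trialProb_le_one X
  have hqinv : permBound X / (zeroOneMatrix X).permanent = 1 / trialProb (boolArray X) n := by
    rw [hq, one_div_div]
  set q := trialProb (boolArray X) n with hqdef
  have hloop := fun s hs => hΦ.trials_le (K := [writeOutput]) (B := boolArray X) (n := n)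
    (U := permBound X) (m := target ε δ) hqpos
    -- Each missing success takes 1/q trials on average, each with one extra step for the loop test;
    -- the 2 accounts for leaving the loop and writing the output.
    (fun r _ => ENNReal.ofReal (2 + r * ((trialTime n + 1 : ℕ) * (1 / q)))) ?_ ?_
    (target ε δ) 0 s hs
  · refine (hΦ.program_le hε hδ hloop).trans (le_of_eq ?_)
    rw [one_mul, ← ENNReal.ofReal_natCast, ← ENNReal.ofReal_add (by positivity) (by positivity),
      hqinv]
    congr 1
    push_cast
    ring
  · intro T s _
    have h1 : Φ ([writeOutput], s) ≤ 1 := by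
      have := hΦ.exec (P := writeOutput) (Exec.setR _ _ s) []
      rw [h0] at this
      simpa using this
    calc 1 + Φ ([writeOutput], s) ≤ 1 + 1 := by gcongr
      _ = _ := by norm_num
  · intro r T
    rw [← ENNReal.ofReal_mul hqpos.le, ← ENNReal.ofReal_mul (by linarith),
      ← ENNReal.ofReal_add (by positivity) (mul_nonneg (by linarith) (by positivity)), one_mul,
      ← ENNReal.ofReal_natCast, ← ENNReal.ofReal_add (by positivity)
        (add_nonneg (by positivity) (mul_nonneg (by linarith) (by positivity)))]
    refine le_of_eq (congrArg _ ?_)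
    push_cast
    field_simp
    ring

/-- Chebyshev's inequality for the number of trials until the m-th success, with the conditional
second moment used as a potential. -/
lemma approximatesPermanent_permanentProgram {ε δ : ℝ} (hε : 0 < ε) (hδ : 0 < δ)
    (hX : 0 < (zeroOneMatrix X).permanent) :
    ApproximatesPermanent permanentProgram (zeroOneMatrix X) ε δ := by
  refine le_measure_outputs_of_value (S := Set.Icc ((zeroOneMatrix X).permanent / (1 + ε))
    ((1 + ε) * (zeroOneMatrix X).permanent)) hδ.le fun Φ hΦ h1 h0 => ?_
  have hq : trialProb (boolArray X) n = (zeroOneMatrix X).permanent / permBound X := trialProb_eq X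
  have hU := permBound_pos X
  have hqpos : 0 < trialProb (boolArray X) n := by rw [hq]; exact div_pos hX hU
  have hq1 := trialProb_le_one X
  have hper : (zeroOneMatrix X).permanent = permBound X * trialProb (boolArray X) n := by
    rw [hq]; field_simp
  set q := trialProb (boolArray X) n with hqdef
  set m := target ε δ with hm
  have hmpos : (0 : ℝ) < m := by rw [hm, target]; positivity
  have hmge : (1 + ε) * (1 + ε) / (δ * (ε * ε)) ≤ m := by
    rw [hm, target]
    push_cast
    exact (Nat.lt_floor_add_one _).le
  -- The squared half-width of the window for q T around m: its lower end is exactly m/(1 + ε) and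
  -- its upper end is at most m(1 + ε).
  set κ : ℝ := (m * (ε / (1 + ε))) ^ 2 with hκ
  have hκpos : 0 < κ := by positivity
  -- With m - r successes so far, q T - (m - r) is a martingale with variance q(1 - q) per trial,
  -- and r/q further trials are expected. So the numerator is the conditional second moment of the
  -- final deviation q T - m, and `w` satisfies the trial recursion with equality.
  let w : ℕ → ℕ → ℝ := fun r T => ((q * T - (m - r)) ^ 2 + r * (1 - q)) / κ
  have hw0 : ∀ r T, 0 ≤ w r T := fun r T =>
    div_nonneg (add_nonneg (sq_nonneg _) (mul_nonneg r.cast_nonneg (by linarith))) hκpos.le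
  have hloop := fun s hs => hΦ.trials_le (K := [writeOutput]) (B := boolArray X) (n := n)
    (U := permBound X) (m := m) hqpos (fun r T => ENNReal.ofReal (w r T)) ?_ ?_ m 0 s hs
  · refine (hΦ.program_le hε hδ hloop).trans ?_
    rw [zero_mul, zero_add]
    refine ENNReal.ofReal_le_ofReal ?_
    simp only [w]
    rw [div_le_iff₀ hκpos]
    have : (1 + ε) * (1 + ε) ≤ m * (δ * (ε * ε)) := (div_le_iff₀ (by positivity)).1 hmge
    have h2 : (m : ℝ) ≤ δ * κ := by
      rw [hκ, mul_pow, div_pow, ← mul_assoc, mul_div_assoc', le_div_iff₀ (by positivity)]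
      nlinarith
    simp only [Nat.cast_zero, mul_zero, sub_self]
    nlinarith
  · intro T s hs
    rw [zero_add]
    have hex := hΦ.exec (P := writeOutput) (Exec.setR _ _ s) []
    rw [zero_mul, zero_add] at hex
    by_cases hgood : |q * T - m| ≤ m * (ε / (1 + ε))
    · refine (hex.trans (h0 _ ?_).le).trans zero_le
      simp only [NExp.eval, RExp.eval, Function.update_self, rReg_eval, hs.square, hs.bound,
        hs.target, hs.count]
      rw [abs_le] at hgood
      have hl : m / (1 + ε) ≤ q * T := by
        have : m * (ε / (1 + ε)) = m - m / (1 + ε) := by field_simp; ring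
        linarith [hgood.1]
      have hu : q * T ≤ m * (1 + ε) := by
        have : ε / (1 + ε) ≤ ε := div_le_self hε.le (by linarith)
        nlinarith [hgood.2]
      have hTpos : (0 : ℝ) < T := by
        have : 0 < q * T := lt_of_lt_of_le (by positivity) hl
        exact pos_of_mul_pos_right this hqpos.le
      rw [hper]
      constructor
      · rw [div_le_div_iff₀ (by positivity) hTpos]
        nlinarith
      · rw [div_le_iff₀ hTpos]
        rw [div_le_iff₀ (by positivity)] at hl
        nlinarith
    · refine (h1 _).trans ?_
      rw [← ENNReal.ofReal_one]
      refine ENNReal.ofReal_le_ofReal ?_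
      simp only [w]
      rw [le_div_iff₀ hκpos, one_mul, hκ]
      push Not at hgood
      have := pow_le_pow_left₀ (by positivity) hgood.le 2
      rw [sq_abs] at this
      simpa using this
  · intro r T
    have h1q : 0 ≤ 1 - q := by linarith
    rw [← ENNReal.ofReal_mul hqpos.le, ← ENNReal.ofReal_mul h1q,
      ← ENNReal.ofReal_add (mul_nonneg hqpos.le (hw0 _ _)) (mul_nonneg h1q (hw0 _ _)), zero_mul,
      zero_add]
    refine le_of_eq (congrArg _ ?_)
    simp only [w]
    push_cast
    field_simp
    ring

end

/-! ### Fixed points of permutations -/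

lemma card_perm_fixing {α : Type*} [Fintype α] [DecidableEq α] (S : Finset α) :
    ((Finset.univ : Finset (Equiv.Perm α)).filter fun σ => ∀ a ∈ S, σ a = a).card =
      (Fintype.card α - S.card).factorial := by
  have e := Equiv.Perm.subtypeEquivSubtypePerm (fun a => a ∉ S)
  have h := Fintype.card_congr e
  rw [Fintype.card_perm, Fintype.card_subtype_compl, Fintype.card_coe, Fintype.card_subtype] at h
  rw [h]
  congr 1
  ext σ
  simp

/-- Each factor is 1 plus `x - 1` at a fixed point. Expanding over subsets, a set of size d is fixed
by (n - d)! permutations, so the sum is n! times a partial sum of the series of exp (x - 1). -/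
lemma sum_perm_prod_fixed_le (n : ℕ) {x : ℝ} (hx : 1 ≤ x) :
    ∑ σ : Equiv.Perm (Fin n), ∏ j, (if σ j = j then x else 1) ≤
      n.factorial * Real.exp (x - 1) := by
  have h1 : ∀ σ : Equiv.Perm (Fin n), ∏ j, (if σ j = j then x else 1) =
      ∑ S ∈ (Finset.univ : Finset (Fin n)).powerset,
        if ∀ a ∈ S, σ a = a then (x - 1) ^ S.card else 0 := by
    intro σ
    have : ∀ j, (if σ j = j then x else 1) = 1 + (if σ j = j then x - 1 else 0) := by
      intro j; split_ifs <;> ring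
    simp_rw [this]
    rw [Finset.prod_one_add]
    refine Finset.sum_congr rfl fun S _ => ?_
    split_ifs with h
    · rw [Finset.prod_congr rfl fun a ha => if_pos (h a ha), Finset.prod_const]
    · push Not at h
      obtain ⟨a, ha, hne⟩ := h
      exact Finset.prod_eq_zero ha (if_neg hne)
  simp_rw [h1]
  rw [Finset.sum_comm]
  have h2 : ∀ S ∈ (Finset.univ : Finset (Fin n)).powerset,
      ∑ σ : Equiv.Perm (Fin n), (if ∀ a ∈ S, σ a = a then (x - 1) ^ S.card else 0) =
      (fun d : ℕ => ((n - d).factorial : ℝ) * (x - 1) ^ d) S.card := by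
    intro S _
    have hc := card_perm_fixing S
    rw [Fintype.card_fin] at hc
    rw [← Finset.sum_filter, Finset.sum_const, nsmul_eq_mul]
    simp only
    rw [← hc]
    congr!
  rw [Finset.sum_congr rfl h2, Finset.sum_powerset_apply_card
    (fun d : ℕ => ((n - d).factorial : ℝ) * (x - 1) ^ d), Finset.card_univ, Fintype.card_fin]
  have h3 := Real.sum_le_exp_of_nonneg (sub_nonneg.2 hx) (n + 1)
  refine le_trans (le_of_eq ?_) (mul_le_mul_of_nonneg_left h3 (by positivity))
  rw [Finset.mul_sum]
  refine Finset.sum_congr rfl fun d hd => ?_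
  have hdn : d ≤ n := Nat.lt_succ_iff.1 (Finset.mem_range.1 hd)
  have hch : ((n.choose d : ℕ) : ℝ) * d.factorial * (n - d).factorial = n.factorial := by
    exact_mod_cast Nat.choose_mul_factorial_mul_factorial hdn
  rw [nsmul_eq_mul, ← hch]
  field_simp

/-- Agreements of σ and τ are the fixed points of σ⁻¹τ. -/
lemma sum_perm_perm_prod_agree_le (n : ℕ) {x : ℝ} (hx : 1 ≤ x) :
    ∑ σ : Equiv.Perm (Fin n), ∑ τ : Equiv.Perm (Fin n), ∏ j, (if σ j = τ j then x else 1) ≤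
      n.factorial * (n.factorial * Real.exp (x - 1)) := by
  have h : ∀ σ : Equiv.Perm (Fin n),
      ∑ τ : Equiv.Perm (Fin n), ∏ j, (if σ j = τ j then x else 1) ≤
      n.factorial * Real.exp (x - 1) := by
    intro σ
    refine le_trans (le_of_eq ?_) (sum_perm_prod_fixed_le n hx)
    refine Fintype.sum_equiv (Equiv.mulLeft σ⁻¹) _ _ fun τ => ?_
    refine Finset.prod_congr rfl fun j _ => ?_
    have : σ j = τ j ↔ (Equiv.mulLeft σ⁻¹ τ) j = j := by
      rw [Equiv.coe_mulLeft, Equiv.Perm.mul_apply, Equiv.Perm.inv_eq_iff_eq, eq_comm]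
    simp only [this]
  refine (Finset.sum_le_sum fun σ _ => h σ).trans (le_of_eq ?_)
  rw [Finset.sum_const, Finset.card_univ, Fintype.card_perm, Fintype.card_fin, nsmul_eq_mul]

/-! ### Moments of the weighted permanent -/

section
variable {n : ℕ} (p : unitInterval)

instance : IsProbabilityMeasure (randomMatrix n p) := by unfold randomMatrix; infer_instance

lemma integral_randomMatrix_prod (F : Fin n → Fin n → Bool → ℝ) :
    ∫ X, ∏ k, ∏ j, F k j (X k j) ∂(randomMatrix n p) =
      ∏ k, ∏ j, ((p : ℝ) * F k j true + (1 - p) * F k j false) := by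
  unfold randomMatrix
  rw [integral_fintype_prod_eq_prod (fun k (x : Fin n → Bool) => ∏ j, F k j (x j))]
  refine Finset.prod_congr rfl fun k _ => ?_
  rw [integral_fintype_prod_eq_prod (fun j (x : Bool) => F k j x)]
  refine Finset.prod_congr rfl fun j _ => ?_
  rw [integral_bernoulliMeasure]
  simp

/-- The permanent, with the weight `v` for each one in the matrix. -/
noncomputable def weightedPerm (v : ℝ) (X : Fin n → Fin n → Bool) : ℝ :=
  (zeroOneMatrix X).permanent * ∏ k, ∏ j, (if X k j then v else 1)

/-- The mean weight of an entry. -/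
noncomputable def meanWeight (v : ℝ) : ℝ := p * v + (1 - p)

lemma prod_prod_if_perm (σ : Equiv.Perm (Fin n)) (X : Fin n → Fin n → Bool) :
    ∏ j, zeroOneMatrix X (σ j) j = ∏ k, ∏ j, (if σ j = k then (if X k j then (1 : ℝ) else 0) else 1)
    := by
  rw [Finset.prod_comm]
  refine Finset.prod_congr rfl fun j _ => ?_
  rw [Finset.prod_ite_eq Finset.univ (σ j) fun k => if X k j then (1 : ℝ) else 0]
  simp [zeroOneMatrix]

lemma weightedPerm_eq (v : ℝ) (X : Fin n → Fin n → Bool) :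
    weightedPerm v X = ∑ σ : Equiv.Perm (Fin n), ∏ k, ∏ j,
      ((if σ j = k then (if X k j then (1 : ℝ) else 0) else 1) * (if X k j then v else 1)) := by
  simp only [weightedPerm, Matrix.permanent, Finset.sum_mul, Finset.prod_mul_distrib,
    prod_prod_if_perm]

lemma weightedPerm_sq_eq (v : ℝ) (X : Fin n → Fin n → Bool) :
    weightedPerm v X ^ 2 = ∑ σ : Equiv.Perm (Fin n), ∑ τ : Equiv.Perm (Fin n), ∏ k, ∏ j,
      ((if σ j = k ∨ τ j = k then (if X k j then (1 : ℝ) else 0) else 1) *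
        (if X k j then v ^ 2 else 1)) := by
  rw [sq, weightedPerm_eq, Finset.sum_mul_sum]
  refine Finset.sum_congr rfl fun σ _ => Finset.sum_congr rfl fun τ _ => ?_
  simp only [← Finset.prod_mul_distrib]
  refine Finset.prod_congr rfl fun k _ => Finset.prod_congr rfl fun j _ => ?_
  by_cases h1 : σ j = k <;> by_cases h2 : τ j = k <;> by_cases h3 : X k j <;>
    simp [h1, h2, h3, sq]

lemma integrable_randomMatrix (f : (Fin n → Fin n → Bool) → ℝ) :
    Integrable f (randomMatrix n p) := Integrable.of_finite

lemma meanWeight_pos {v : ℝ} (hp : (0 : ℝ) < p) (hv : 0 < v) : 0 < meanWeight p v := by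
  have := p.2.2
  unfold meanWeight
  have : 0 < p * v := mul_pos hp hv
  linarith [sub_nonneg.2 p.2.2]

/-- By independence every entry has mean weight φ = `meanWeight p v`, except that the n cells of the
permutation contribute p v. -/
lemma integral_weightedPerm {v : ℝ} (hp : (0 : ℝ) < p) (hv : 0 < v) :
    ∫ X, weightedPerm v X ∂(randomMatrix n p) =
      n.factorial * (meanWeight p v ^ (n * n) * (p * v / meanWeight p v) ^ n) := by
  have hφ := (meanWeight_pos p hp hv).ne'
  simp only [weightedPerm_eq]
  rw [integral_finsetSum _ fun σ _ => integrable_randomMatrix p _]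
  have h : ∀ σ : Equiv.Perm (Fin n), ∫ X, ∏ k, ∏ j,
      ((if σ j = k then (if X k j then (1 : ℝ) else 0) else 1) * (if X k j then v else 1))
      ∂(randomMatrix n p) = meanWeight p v ^ (n * n) * (p * v / meanWeight p v) ^ n := by
    intro σ
    rw [integral_randomMatrix_prod p fun k j b =>
      (if σ j = k then (if b then (1 : ℝ) else 0) else 1) * (if b then v else 1)]
    have : ∀ k j, ((p : ℝ) * ((if σ j = k then (if true then (1 : ℝ) else 0) else 1) *
        (if true then v else 1)) + (1 - p) * ((if σ j = k then (if false then (1 : ℝ) else 0)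
        else 1) * (if false then v else 1))) =
        meanWeight p v * (if σ j = k then p * v / meanWeight p v else 1) := by
      intro k j
      by_cases h : σ j = k
      · simp [h]; field_simp
      · simp [h, meanWeight]
    refine (Finset.prod_congr rfl fun k _ => Finset.prod_congr rfl fun j _ => this k j).trans ?_
    simp only [Finset.prod_mul_distrib]
    rw [Finset.prod_comm (s := Finset.univ) (t := Finset.univ)
      (f := fun k j => if σ j = k then p * v / meanWeight p v else 1)]
    simp [← pow_mul, div_pow]
  simp only [h]
  simp [Fintype.card_perm]

/-- Two permutations occupy 2n cells minus one for each agreement, so every agreement contributes a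
factor φ/a, and the agreements are controlled by `sum_perm_perm_prod_agree_le`. -/
lemma integral_weightedPerm_sq_le {v : ℝ} (hp : (0 : ℝ) < p) (hv : 0 < v) :
    ∫ X, weightedPerm v X ^ 2 ∂(randomMatrix n p) ≤
      meanWeight p (v ^ 2) ^ (n * n) * (p * v ^ 2 / meanWeight p (v ^ 2)) ^ (2 * n) *
        (n.factorial * (n.factorial * Real.exp (meanWeight p (v ^ 2) / (p * v ^ 2) - 1))) := by
  have hφ := meanWeight_pos p hp (pow_pos hv 2)
  have hpv : 0 < p * v ^ 2 := mul_pos hp (pow_pos hv 2)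
  set φ := meanWeight p (v ^ 2) with hφdef
  set a := p * v ^ 2 with ha
  simp only [weightedPerm_sq_eq]
  rw [integral_finsetSum _ fun σ _ => integrable_randomMatrix p _]
  have h : ∀ σ τ : Equiv.Perm (Fin n), ∫ X, ∏ k, ∏ j,
      ((if σ j = k ∨ τ j = k then (if X k j then (1 : ℝ) else 0) else 1) *
        (if X k j then v ^ 2 else 1)) ∂(randomMatrix n p) =
      φ ^ (n * n) * (a / φ) ^ (2 * n) * ∏ j, (if σ j = τ j then φ / a else 1) := by
    intro σ τ
    rw [integral_randomMatrix_prod p fun k j b =>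
      (if σ j = k ∨ τ j = k then (if b then (1 : ℝ) else 0) else 1) * (if b then v ^ 2 else 1)]
    have : ∀ k j, ((p : ℝ) * ((if σ j = k ∨ τ j = k then (if true then (1 : ℝ) else 0) else 1) *
        (if true then v ^ 2 else 1)) + (1 - p) * ((if σ j = k ∨ τ j = k then
        (if false then (1 : ℝ) else 0) else 1) * (if false then v ^ 2 else 1))) =
        -- A cell shared by σ and τ is charged to σ only.
        φ * ((if σ j = k then a / φ else 1) * (if τ j = k then
          (if σ j = τ j then 1 else a / φ) else 1)) := by
      intro k j
      by_cases h : σ j = k <;> by_cases h' : τ j = k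
      · simp [h, h', ha]; field_simp
      · simp [h, h', ha]; field_simp
      · have : ¬ σ j = τ j := by rw [h']; exact h
        simp [h, h', ha]; field_simp
      · simp [h, h', hφdef, meanWeight]
    refine (Finset.prod_congr rfl fun k _ => Finset.prod_congr rfl fun j _ => this k j).trans ?_
    simp only [Finset.prod_mul_distrib]
    rw [Finset.prod_comm (s := Finset.univ) (t := Finset.univ)
      (f := fun k j => if σ j = k then a / φ else 1),
      Finset.prod_comm (s := Finset.univ) (t := Finset.univ)
      (f := fun k j => if τ j = k then (if σ j = τ j then 1 else a / φ) else 1)]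
    simp only [Finset.prod_ite_eq, Finset.mem_univ, if_true, Finset.prod_const, Finset.card_univ,
      Fintype.card_fin, ← pow_mul]
    have h2 : ∏ j, (if σ j = τ j then 1 else a / φ) =
        (a / φ) ^ n * ∏ j, (if σ j = τ j then φ / a else 1) := by
      have : (a / φ) ^ n = ∏ _j : Fin n, a / φ := by
        rw [Finset.prod_const, Finset.card_univ, Fintype.card_fin]
      rw [this, ← Finset.prod_mul_distrib]
      refine Finset.prod_congr rfl fun j _ => ?_
      split_ifs
      · field_simp
      · ring
    rw [h2]
    ring
  have h' : ∀ σ : Equiv.Perm (Fin n), ∫ X, ∑ τ : Equiv.Perm (Fin n), ∏ k, ∏ j,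
      ((if σ j = k ∨ τ j = k then (if X k j then (1 : ℝ) else 0) else 1) *
        (if X k j then v ^ 2 else 1)) ∂(randomMatrix n p) =
      ∑ τ : Equiv.Perm (Fin n), φ ^ (n * n) * (a / φ) ^ (2 * n) *
        ∏ j, (if σ j = τ j then φ / a else 1) := by
    intro σ
    rw [integral_finsetSum _ fun τ _ => integrable_randomMatrix p _]
    exact Finset.sum_congr rfl fun τ _ => h σ τ
  simp only [h', ← Finset.mul_sum]
  refine mul_le_mul_of_nonneg_left (sum_perm_perm_prod_agree_le n ?_) (by positivity)
  rw [le_div_iff₀ hpv, one_mul, hφdef, meanWeight, ha]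
  linarith [sub_nonneg.2 p.2.2]

/-! ### The second moment ratio with the tilted weight -/

/-- The exponent in the bound for the ratio of the second moment and the square of the first. -/
noncomputable def ratioExponent (v : ℝ) : ℝ :=
  (1 - p) / p / meanWeight p v ^ 2 - 2 / p + 2 / meanWeight p (v ^ 2) +
    (meanWeight p (v ^ 2) / (p * v ^ 2) - 1)

/-- At v = 1 the four contributions cancel: (1 - p)/p - 2/p + 2 + (1/p - 1) = 0. -/
lemma tendsto_ratioExponent (hp : (0 : ℝ) < p) :
    Tendsto (ratioExponent p) (𝓝 1) (𝓝 0) := by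
  have h : ContinuousAt (ratioExponent p) 1 := by
    have h1 : meanWeight p 1 = 1 := by simp [meanWeight]
    have hc : Continuous (meanWeight p) := by unfold meanWeight; fun_prop
    unfold ratioExponent
    refine ContinuousAt.add (ContinuousAt.add (ContinuousAt.sub ?_ ?_) ?_)
      (ContinuousAt.sub (ContinuousAt.div ?_ ?_ ?_) ?_)
    · exact continuousAt_const.div (hc.continuousAt.pow 2) (by simp [h1])
    · exact continuousAt_const
    · exact continuousAt_const.div (by fun_prop) (by simp [h1])
    · fun_prop
    · fun_prop
    · simpa using hp.ne'
    · exact continuousAt_const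
  have h0 : ratioExponent p 1 = 0 := by
    simp only [ratioExponent, meanWeight]
    field_simp
    ring
  rw [← h0]
  exact h

/-- The weight for which the weighted permanent is concentrated. -/
noncomputable def tilt (n : ℕ) : ℝ := Real.exp (-(1 / (p * n)))

lemma tilt_pos (n : ℕ) : 0 < tilt p n := Real.exp_pos _

lemma tilt_le_one (n : ℕ) : tilt p n ≤ 1 :=
  Real.exp_le_one_iff.2 (neg_nonpos.2 (div_nonneg zero_le_one (mul_nonneg p.2.1 n.cast_nonneg)))

lemma one_sub_tilt_le (n : ℕ) : 1 - tilt p n ≤ 1 / (p * n) := by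
  have := Real.add_one_le_exp (-(1 / ((p : ℝ) * n)))
  unfold tilt
  linarith

lemma tilt_pow (hp : (0 : ℝ) < p) (hn : 1 ≤ n) : tilt p n ^ n = Real.exp (-(1 / p)) := by
  have : (0 : ℝ) < n := by exact_mod_cast hn
  rw [tilt, ← Real.exp_nat_mul]
  congr 1
  field_simp

lemma tendsto_tilt : Tendsto (tilt p) atTop (𝓝 1) := by
  rw [← Real.exp_zero]
  refine (Real.continuous_exp.tendsto 0).comp ?_
  rw [← neg_zero]
  refine Tendsto.neg ?_
  have h := (tendsto_const_div_atTop_nhds_zero_nat (1 / (p : ℝ)))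
  refine h.congr fun n => ?_
  rw [div_div]

/-- With φ1, φ2 the mean weights for v and v², the bound on the ratio is (φ2/φ1²)^(n²) · v^(2n) ·
(φ1/φ2)^(2n) times the factor from agreements. Since 1 - v is at most 1/(pn), each of these powers
stays bounded and accounts for one term of `ratioExponent`. -/
lemma integral_weightedPerm_sq_le_mul (hp : (0 : ℝ) < p) (hn : 1 ≤ n) :
    ∫ X, weightedPerm (tilt p n) X ^ 2 ∂(randomMatrix n p) ≤
      Real.exp (ratioExponent p (tilt p n)) *
        (∫ X, weightedPerm (tilt p n) X ∂(randomMatrix n p)) ^ 2 := by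
  have hnpos : (0 : ℝ) < n := by exact_mod_cast hn
  have hvn := tilt_pow p hp hn
  have hv := tilt_pos p n
  have hv1 := tilt_le_one p n
  have hvl := one_sub_tilt_le p n
  have hq : 0 ≤ 1 - (p : ℝ) := sub_nonneg.2 p.2.2
  refine (integral_weightedPerm_sq_le p hp hv).trans ?_
  rw [integral_weightedPerm p hp hv]
  set v := tilt p n with hvdef
  have hφ1 := meanWeight_pos p hp hv
  have hφ2 := meanWeight_pos p hp (pow_pos hv 2)
  have e1 : (meanWeight p (v ^ 2) / meanWeight p v ^ 2) ^ (n * n) ≤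
      Real.exp ((1 - p) / p / meanWeight p v ^ 2) := by
    have hA : meanWeight p (v ^ 2) / meanWeight p v ^ 2 ≤
        Real.exp ((1 - p) / p / meanWeight p v ^ 2 / (n * n)) := by
      refine le_trans ?_ (Real.add_one_le_exp _)
      -- The difference of the two sides' moments is the variance of the weight of a single entry.
      have h1 : meanWeight p (v ^ 2) = p * (1 - p) * (1 - v) ^ 2 + meanWeight p v ^ 2 := by
        unfold meanWeight; ring
      have h2 : (1 - v) ^ 2 ≤ (1 / (p * n)) ^ 2 :=
        pow_le_pow_left₀ (by linarith) hvl 2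
      rw [h1, add_div, div_self (by positivity), div_right_comm]
      gcongr
      calc (p : ℝ) * (1 - p) * (1 - v) ^ 2 ≤ p * (1 - p) * (1 / (p * n)) ^ 2 := by
            gcongr
        _ = _ := by field_simp
    calc _ ≤ (Real.exp ((1 - p) / p / meanWeight p v ^ 2 / (n * n))) ^ (n * n) :=
          pow_le_pow_left₀ (by positivity) hA _
      _ = _ := by
          rw [← Real.exp_nat_mul]
          congr 1
          push_cast
          field_simp
  have e2 : (meanWeight p v / meanWeight p (v ^ 2)) ^ (2 * n) ≤
      Real.exp (2 / meanWeight p (v ^ 2)) := by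
    have hA : meanWeight p v / meanWeight p (v ^ 2) ≤
        Real.exp (1 / meanWeight p (v ^ 2) / n) := by
      refine le_trans ?_ (Real.add_one_le_exp _)
      have h1 : meanWeight p v = p * (v * (1 - v)) + meanWeight p (v ^ 2) := by
        unfold meanWeight; ring
      rw [h1, add_div, div_self hφ2.ne', div_right_comm]
      gcongr
      calc (p : ℝ) * (v * (1 - v)) ≤ p * (1 * (1 / (p * n))) := by
            have : 0 ≤ 1 - v := by linarith
            gcongr
        _ = _ := by field_simp
    calc _ ≤ (Real.exp (1 / meanWeight p (v ^ 2) / n)) ^ (2 * n) :=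
          pow_le_pow_left₀ (by positivity) hA _
      _ = _ := by
          rw [← Real.exp_nat_mul]
          congr 1
          push_cast
          field_simp
  have e3 : v ^ (2 * n) = Real.exp (-(2 / p)) := by
    rw [mul_comm, pow_mul, hvn, ← Real.exp_nat_mul]
    congr 1
    push_cast
    ring
  set x := meanWeight p (v ^ 2) / (p * v ^ 2) - 1 with hx
  have hexp : Real.exp (ratioExponent p v) = Real.exp ((1 - p) / p / meanWeight p v ^ 2) *
      Real.exp (-(2 / p)) * Real.exp (2 / meanWeight p (v ^ 2)) * Real.exp x := by
    rw [← Real.exp_add, ← Real.exp_add, ← Real.exp_add, ratioExponent, ← hx]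
    congr 1
  rw [hexp, ← e3]
  set φ1 := meanWeight p v
  set φ2 := meanWeight p (v ^ 2)
  calc φ2 ^ (n * n) * (p * v ^ 2 / φ2) ^ (2 * n) *
        (n.factorial * (n.factorial * Real.exp x))
      = ((φ2 / φ1 ^ 2) ^ (n * n) * v ^ (2 * n) * (φ1 / φ2) ^ (2 * n) * Real.exp x) *
        (n.factorial * (φ1 ^ (n * n) * (p * v / φ1) ^ n)) ^ 2 := by
        have h1 : φ2 ^ (n * n) = (φ2 / φ1 ^ 2) ^ (n * n) * (φ1 ^ (n * n)) ^ 2 := by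
          rw [div_pow, ← pow_mul, ← pow_mul, mul_comm 2 (n * n)]
          field_simp
        have h2 : (p * v ^ 2 / φ2) ^ (2 * n) =
            v ^ (2 * n) * (φ1 / φ2) ^ (2 * n) * ((p * v / φ1) ^ n) ^ 2 := by
          rw [← pow_mul, mul_comm n 2, ← mul_pow, ← mul_pow]
          congr 1
          field_simp
        rw [h1, h2]
        ring
    _ ≤ _ := by gcongr

/-- Chebyshev's inequality at distance E/2 from the mean; this gives the factor 4. -/
lemma measure_weightedPerm_ge (hp : (0 : ℝ) < p) (hn : 1 ≤ n) :
    1 - ENNReal.ofReal (4 * (Real.exp (ratioExponent p (tilt p n)) - 1)) ≤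
      randomMatrix n p {X | (∫ X, weightedPerm (tilt p n) X ∂(randomMatrix n p)) / 2 ≤
        weightedPerm (tilt p n) X} := by
  set μ := randomMatrix n p
  set Y := weightedPerm (n := n) (tilt p n)
  set E := ∫ X, Y X ∂μ with hE
  have hEpos : 0 < E := by
    rw [hE, integral_weightedPerm p hp (tilt_pos p n)]
    have := meanWeight_pos p hp (tilt_pos p n)
    have := tilt_pos p n
    positivity
  have hmem : MemLp Y 2 μ := MemLp.of_discrete
  have hch := meas_ge_le_variance_div_sq hmem (half_pos hEpos)
  have hvar : variance Y μ ≤ (Real.exp (ratioExponent p (tilt p n)) - 1) * E ^ 2 := by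
    rw [variance_eq_sub hmem]
    have := integral_weightedPerm_sq_le_mul p hp hn
    simp only [Pi.pow_apply]
    linarith
  have hbad : μ {X | E / 2 ≤ |Y X - E|} ≤
      ENNReal.ofReal (4 * (Real.exp (ratioExponent p (tilt p n)) - 1)) := by
    refine hch.trans (ENNReal.ofReal_le_ofReal ?_)
    rw [div_le_iff₀ (by positivity)]
    linarith
  have hsub : {X | E / 2 ≤ Y X}ᶜ ⊆ {X | E / 2 ≤ |Y X - E|} := by
    intro X hX
    simp only [Set.mem_compl_iff, Set.mem_ofPred_eq, not_le] at hX ⊢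
    rw [abs_sub_comm]
    exact le_trans (by linarith) (le_abs_self _)
  have hm : MeasurableSet {X | E / 2 ≤ Y X} := Set.Finite.measurableSet (Set.toFinite _)
  rw [tsub_le_iff_right]
  calc (1 : ℝ≥0∞) = μ {X | E / 2 ≤ Y X} + μ {X | E / 2 ≤ Y X}ᶜ := by
        rw [measure_add_measure_compl hm, measure_univ]
    _ ≤ _ := by gcongr; exact (measure_mono hsub).trans hbad

/-! ### The acceptance probability for random matrices -/

lemma le_integral_weightedPerm (hp : (0 : ℝ) < p) (hn : 2 ≤ n) :
    (n.factorial : ℝ) * (p : ℝ) ^ n * Real.exp (-(1 / p)) * Real.exp (-(n + 2)) ≤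
      ∫ X, weightedPerm (tilt p n) X ∂(randomMatrix n p) := by
  have hn2 : (2 : ℝ) ≤ n := by exact_mod_cast hn
  have hv := tilt_pos p n
  have hvl := one_sub_tilt_le p n
  have hφ := meanWeight_pos p hp hv
  rw [integral_weightedPerm p hp hv, div_pow, mul_pow, tilt_pow p hp (by omega)]
  have hφ1 : meanWeight p (tilt p n) ≤ 1 := by
    have := mul_le_mul_of_nonneg_left (tilt_le_one p n) hp.le
    unfold meanWeight
    linarith
  have hφ2 : 1 - 1 / (n : ℝ) ≤ meanWeight p (tilt p n) := by
    have : (p : ℝ) * (1 - tilt p n) ≤ p * (1 / (p * n)) := mul_le_mul_of_nonneg_left hvl hp.le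
    have h2 : (p : ℝ) * (1 / (p * n)) = 1 / (n : ℝ) := by field_simp
    unfold meanWeight
    linarith
  have hlow : Real.exp (-(n + 2)) ≤ meanWeight p (tilt p n) ^ (n * n) := by
    have h1 : Real.exp (-(1 / ((n : ℝ) - 1))) ≤ 1 - 1 / (n : ℝ) := by
      have h2 := Real.add_one_le_exp (1 / ((n : ℝ) - 1))
      rw [Real.exp_neg, inv_le_comm₀ (Real.exp_pos _) (by
        rw [sub_pos, div_lt_one (by linarith)]; linarith)]
      refine le_trans (le_of_eq ?_) h2
      have : (n : ℝ) - 1 ≠ 0 := by linarith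
      field_simp
      ring
    calc Real.exp (-(n + 2)) ≤ Real.exp (-(1 / ((n : ℝ) - 1))) ^ (n * n) := by
          rw [← Real.exp_nat_mul]
          refine Real.exp_le_exp.2 ?_
          push_cast
          have : (0 : ℝ) < n - 1 := by linarith
          -- For n ≥ 2, n²/(n - 1) = n + 1 + 1/(n - 1) is at most n + 2.
          rw [mul_neg, neg_le_neg_iff, mul_one_div, div_le_iff₀ this]
          nlinarith
      _ ≤ _ := pow_le_pow_left₀ (Real.exp_pos _).le (h1.trans hφ2) _
  have hdiv : (p : ℝ) ^ n * Real.exp (-(1 / p)) ≤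
      p ^ n * Real.exp (-(1 / p)) / meanWeight p (tilt p n) ^ n := by
    rw [le_div_iff₀ (by positivity)]
    exact mul_le_of_le_one_right (by positivity) (pow_le_one₀ hφ.le hφ1)
  calc _ = n.factorial * (Real.exp (-(n + 2)) * (p ^ n * Real.exp (-(1 / p)))) := by ring
    _ ≤ _ := by gcongr

/-! ### The sampling bound against the weighted permanent -/

lemma onesFrom_le (B : ℕ → ℕ → Bool) (k : ℕ) : onesFrom B n k 0 ≤ n := by
  unfold onesFrom
  exact (Finset.card_filter_le _ _).trans (by simp)

lemma rowBound_le_of_le {r : ℕ} (hn : 1 ≤ n) (hr : r ≤ n) :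
    rowBound r ≤ r + (Real.log n / 2 + 7 / 2) := by
  have h0 : 0 ≤ Real.log n := Real.log_nonneg (by exact_mod_cast hn)
  rcases Nat.eq_zero_or_pos r with rfl | hpos
  · simp only [rowBound, Nat.cast_zero]
    linarith
  · have h1 := rowBound_le r hpos
    have h2 : Real.log r ≤ Real.log n :=
      Real.log_le_log (by exact_mod_cast hpos) (by exact_mod_cast hr)
    linarith

/-- The weight is written through the row sums so that its exponent is the negative of the one in
`permBound_le`. -/
lemma prod_weights (X : Fin n → Fin n → Bool) :
    ∏ k, ∏ j, (if X k j then tilt p n else 1) =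
      Real.exp (-(∑ k ∈ Finset.range n, (onesFrom (boolArray X) n k 0 : ℝ) / (p * n))) := by
  rw [← Finset.sum_neg_distrib, Real.exp_sum, Finset.prod_range]
  refine Finset.prod_congr rfl fun k _ => ?_
  have h1 : ∏ j, (if X k j then tilt p n else 1) =
      tilt p n ^ (Finset.univ.filter fun j => X k j = true).card := by
    rw [Finset.prod_ite]; simp
  have h2 : onesFrom (boolArray X) n k 0 = (Finset.univ.filter fun j => X k j = true).card := by
    unfold onesFrom
    rw [← Finset.card_map Fin.valEmbedding]
    congr 1
    ext j
    simp only [Finset.mem_filter, Finset.mem_Ico, Nat.zero_le, true_and, Finset.mem_map,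
      Finset.mem_univ, Fin.valEmbedding_apply]
    constructor
    · rintro ⟨hj, h⟩
      exact ⟨⟨j, hj⟩, by simpa [boolArray, hj] using h, rfl⟩
    · rintro ⟨i, h, rfl⟩
      exact ⟨i.2, by simpa [boolArray] using h⟩
  rw [h1, ← h2, tilt, ← Real.exp_nat_mul]
  congr 1
  ring

/-- Linearization at the expected row sum: x ≤ exp (x - 1) for x = (row bound)/(pn) turns the
product over the rows into the exponential of the total number of ones. -/
lemma permBound_le (hp : (0 : ℝ) < p) (hn : 1 ≤ n) (X : Fin n → Fin n → Bool) :
    permBound X ≤ (p * n / expSum n) ^ n * (Real.exp (∑ k ∈ Finset.range n,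
      (onesFrom (boolArray X) n k 0 : ℝ) / (p * n)) *
      Real.exp ((Real.log n / 2 + 7 / 2) / p - n)) := by
  have hnpos : (0 : ℝ) < n := by exact_mod_cast hn
  have hpn : 0 < p * (n : ℝ) := mul_pos hp hnpos
  have hc := expSum_pos n
  have hrow : ∀ k ∈ Finset.range n, rowBound (onesFrom (boolArray X) n k 0) / expSum n ≤
      p * n / expSum n * Real.exp ((onesFrom (boolArray X) n k 0 : ℝ) / (p * n) +
        ((Real.log n / 2 + 7 / 2) / (p * n) - 1)) := by
    intro k _
    have h1 := rowBound_le_of_le hn (onesFrom_le (n := n) (boolArray X) k)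
    have h2 := Real.add_one_le_exp ((onesFrom (boolArray X) n k 0 : ℝ) / (p * n) +
        ((Real.log n / 2 + 7 / 2) / (p * n) - 1))
    rw [div_mul_eq_mul_div]
    gcongr
    refine h1.trans ?_
    refine le_trans (le_of_eq ?_) (mul_le_mul_of_nonneg_left h2 hpn.le)
    field_simp
    ring
  refine (Finset.prod_le_prod (fun k _ => (div_pos (rowBound_pos _) hc).le) hrow).trans
    (le_of_eq ?_)
  rw [Finset.prod_mul_distrib, Finset.prod_const, Finset.card_range, ← Real.exp_sum,
    Finset.sum_add_distrib, Real.exp_add, Finset.sum_const, Finset.card_range, nsmul_eq_mul]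
  congr 3
  field_simp

/-- If the weighted permanent is not too small, then the trials succeed often enough. -/
lemma permBound_div_permanent_le (hp : (0 : ℝ) < p) (hn : 2 ≤ n) {X : Fin n → Fin n → Bool}
    (hX : (∫ X, weightedPerm (tilt p n) X ∂(randomMatrix n p)) / 2 ≤ weightedPerm (tilt p n) X) :
    0 < (zeroOneMatrix X).permanent ∧ permBound X / (zeroOneMatrix X).permanent ≤
      2 * Real.exp (4 + 9 / 2 / p) * (n : ℝ) ^ (1 / 2 / (p : ℝ) - 1 / 2) := by
  have hnpos : (0 : ℝ) < n := by positivity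
  have hE := le_integral_weightedPerm p hp hn
  have hc := expSum_pos n
  set S := ∑ k ∈ Finset.range n, (onesFrom (boolArray X) n k 0 : ℝ) / (p * n) with hS
  set D := (n.factorial : ℝ) * (p : ℝ) ^ n * Real.exp (-(1 / p)) * Real.exp (-(n + 2 : ℝ)) with hD
  have hDpos : 0 < D := by positivity
  have hper : D / 2 * Real.exp S ≤ (zeroOneMatrix X).permanent := by
    have h1 : D / 2 ≤ (zeroOneMatrix X).permanent * Real.exp (-S) := by
      rw [hS, ← prod_weights]
      exact le_trans (by linarith) hX
    calc D / 2 * Real.exp S ≤ (zeroOneMatrix X).permanent * Real.exp (-S) * Real.exp S := by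
          gcongr
      _ = _ := by rw [mul_assoc, ← Real.exp_add]; simp
  have hperpos : 0 < (zeroOneMatrix X).permanent := lt_of_lt_of_le (by positivity) hper
  refine ⟨hperpos, ?_⟩
  rw [div_le_iff₀ hperpos]
  refine (permBound_le p hp (by omega) X).trans ?_
  refine le_trans ?_ (mul_le_mul_of_nonneg_left hper (by positivity))
  rw [← hS]
  -- Stirling's lower bound; its √n is the source of the -1/2 in the exponent.
  have hst : Real.sqrt n * (n : ℝ) ^ n ≤ n.factorial * Real.exp n := by
    have h1 := Stirling.le_factorial_stirling n
    have h2 : Real.sqrt n ≤ Real.sqrt (2 * Real.pi * n) := by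
      refine Real.sqrt_le_sqrt ?_
      nlinarith [Real.pi_gt_three]
    have h3 : (n / Real.exp 1) ^ n = (n : ℝ) ^ n / Real.exp n := by
      rw [div_pow, ← Real.exp_nat_mul, mul_one]
    rw [h3] at h1
    have h4 : Real.sqrt n * ((n : ℝ) ^ n / Real.exp n) ≤ n.factorial :=
      le_trans (by gcongr) h1
    rwa [mul_div_assoc', div_le_iff₀ (Real.exp_pos _)] at h4
  have hcn := exp_le_expSum_pow n
  -- The power n^(1/(2p)) comes from (log n)/2 in each of n rows, divided by pn. A factor √n is
  -- split off for Stirling's formula.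
  have hlog : Real.exp ((Real.log n / 2 + 7 / 2) / p - n) =
      (n : ℝ) ^ (1 / 2 / (p : ℝ) - 1 / 2) * Real.sqrt n *
        (Real.exp (7 / 2 / p) * Real.exp (-n)) := by
    rw [Real.sqrt_eq_rpow, ← Real.rpow_add hnpos, Real.rpow_def_of_pos hnpos, ← Real.exp_add,
      ← Real.exp_add]
    congr 1
    field_simp
    ring
  rw [hlog, hD]
  have hfin : ((p : ℝ) * n / expSum n) ^ n * Real.sqrt n * Real.exp (-n) ≤
      (n.factorial : ℝ) * (p : ℝ) ^ n * Real.exp (-n) * Real.exp 2 := by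
    rw [div_pow, mul_pow, div_mul_eq_mul_div, div_mul_eq_mul_div, div_le_iff₀ (by positivity)]
    calc (p : ℝ) ^ n * n ^ n * Real.sqrt n * Real.exp (-n)
        = p ^ n * Real.exp (-n) * (Real.sqrt n * n ^ n) := by ring
      _ ≤ p ^ n * Real.exp (-n) * (n.factorial * (expSum n ^ n * Real.exp 2)) :=
          mul_le_mul_of_nonneg_left
            (hst.trans (mul_le_mul_of_nonneg_left hcn (Nat.cast_nonneg _))) (by positivity)
      _ = _ := by ring
  -- The 4 collects exp 2 from `expSum` and exp 2 from the mean; 9/2 is 7/2 from the row bounds plus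
  -- 1 from v^n = exp (-1/p).
  have hsplit : Real.exp (4 + 9 / 2 / p) * Real.exp (-(1 / p)) * Real.exp (-(n + 2 : ℝ)) =
      Real.exp 2 * Real.exp (-n) * Real.exp (7 / 2 / p) := by
    rw [← Real.exp_add, ← Real.exp_add, ← Real.exp_add, ← Real.exp_add]
    congr 1
    field_simp
    ring
  set w := (n : ℝ) ^ (1 / 2 / (p : ℝ) - 1 / 2)
  have hw : 0 < w := Real.rpow_pos_of_pos hnpos _
  calc ((p : ℝ) * n / expSum n) ^ n * (Real.exp S * (w * Real.sqrt n *
        (Real.exp (7 / 2 / p) * Real.exp (-n))))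
      = (((p : ℝ) * n / expSum n) ^ n * Real.sqrt n * Real.exp (-n)) *
        (Real.exp S * w * Real.exp (7 / 2 / p)) := by ring
    _ ≤ ((n.factorial : ℝ) * (p : ℝ) ^ n * Real.exp (-n) * Real.exp 2) *
        (Real.exp S * w * Real.exp (7 / 2 / p)) := by gcongr
    _ = ((n.factorial : ℝ) * (p : ℝ) ^ n) * (Real.exp 2 * Real.exp (-n) * Real.exp (7 / 2 / p)) *
        (Real.exp S * w) := by ring
    _ = ((n.factorial : ℝ) * (p : ℝ) ^ n) * (Real.exp (4 + 9 / 2 / p) * Real.exp (-(1 / p)) *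
        Real.exp (-(n + 2 : ℝ))) * (Real.exp S * w) := by rw [hsplit]
    _ = _ := by ring

lemma expectedTime_le_of_weightedPerm (hp : (0 : ℝ) < p) (hn : 2 ≤ n) {X : Fin n → Fin n → Bool}
    {α ε δ : ℝ} (hα : 1 / 2 < α) (hε : 0 < ε) (hδ : 0 < δ)
    (hX : (∫ X, weightedPerm (tilt p n) X ∂(randomMatrix n p)) / 2 ≤ weightedPerm (tilt p n) X) :
    expectedTime permanentProgram (inputStore (zeroOneMatrix X) ε δ) ≤
      ENNReal.ofReal ((64 + 4 * target ε δ + target ε δ * 68 *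
        (2 * Real.exp (4 + 9 / 2 / p))) * (n : ℝ) ^ (1.5 + α / (p : ℝ))) := by
  obtain ⟨hper, hU⟩ := permBound_div_permanent_le p hp hn hX
  refine (expectedTime_permanentProgram_le hε hδ hper).trans (ENNReal.ofReal_le_ofReal ?_)
  have hn1 : (1 : ℝ) ≤ n := by exact_mod_cast (by omega : 1 ≤ n)
  have hnpos : (0 : ℝ) < n := by linarith
  have hp1 : (p : ℝ) ≤ 1 := p.2.2
  have hαp : 1 / 2 / (p : ℝ) ≤ α / p := by gcongr
  have hhalf : 1 / 2 ≤ 1 / 2 / (p : ℝ) := by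
    rw [le_div_iff₀ hp]; linarith
  -- The quadratic preparation fits because p ≤ 1 gives α/p ≥ 1/2.
  have hsq : (n : ℝ) ^ 2 ≤ (n : ℝ) ^ (1.5 + α / (p : ℝ)) := by
    rw [← Real.rpow_natCast]
    refine Real.rpow_le_rpow_of_exponent_le hn1 ?_
    norm_num
    linarith
  -- Time per trial times number of trials has exponent 3/2 + 1/(2p).
  have hpow : (n : ℝ) ^ 2 * (n : ℝ) ^ (1 / 2 / (p : ℝ) - 1 / 2) ≤
      (n : ℝ) ^ (1.5 + α / (p : ℝ)) := by
    rw [← Real.rpow_natCast, ← Real.rpow_add hnpos]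
    refine Real.rpow_le_rpow_of_exponent_le hn1 ?_
    norm_num
    linarith
  set W := (n : ℝ) ^ (1.5 + α / (p : ℝ))
  set t := (target ε δ : ℝ) with ht
  have ht0 : 0 ≤ t := Nat.cast_nonneg _
  have hn2 : (n : ℝ) ≤ (n : ℝ) ^ 2 := by nlinarith
  have h1n : (1 : ℝ) ≤ (n : ℝ) ^ 2 := by nlinarith
  have hA : (((n * (n * 11 + 22) + target ε δ * 4 + 31 : ℕ) : ℕ) : ℝ) ≤ (64 + 4 * t) * W := by
    push_cast
    rw [← ht]
    calc (n : ℝ) * (n * 11 + 22) + t * 4 + 31 ≤ (64 + 4 * t) * (n : ℝ) ^ 2 := by nlinarith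
      _ ≤ _ := by gcongr
  -- 68 = 19 + 32 + 4 + 12 + 1; likewise 64 = 11 + 22 + 31 above.
  have hB : ((trialTime n + 1 : ℕ) : ℝ) ≤ 68 * (n : ℝ) ^ 2 := by
    unfold trialTime
    push_cast
    nlinarith
  have hC : t * (((trialTime n + 1 : ℕ) : ℝ) * (permBound X / (zeroOneMatrix X).permanent)) ≤
      t * 68 * (2 * Real.exp (4 + 9 / 2 / p)) * W := by
    calc t * (((trialTime n + 1 : ℕ) : ℝ) * (permBound X / (zeroOneMatrix X).permanent))
        ≤ t * ((68 * (n : ℝ) ^ 2) * (2 * Real.exp (4 + 9 / 2 / p) *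
          (n : ℝ) ^ (1 / 2 / (p : ℝ) - 1 / 2))) := by
          have := (div_pos (permBound_pos X) hper).le
          gcongr
      _ = t * 68 * (2 * Real.exp (4 + 9 / 2 / p)) *
          ((n : ℝ) ^ 2 * (n : ℝ) ^ (1 / 2 / (p : ℝ) - 1 / 2)) := by ring
      _ ≤ _ := by gcongr
  linarith

end

theorem theorem3 :
    ∃ P : Prog,
      (∀ ε δ : ℝ, 0 < ε → 0 < δ → ∀ (n : ℕ) (X : Fin n → Fin n → Bool),
        0 < (zeroOneMatrix X).permanent → ApproximatesPermanent P (zeroOneMatrix X) ε δ) ∧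
      ∀ (α ε δ : ℝ) (p : unitInterval), 1 / 2 < α → 0 < ε → 0 < δ → (0 : ℝ) < p →
        ∃ C : ℝ, 0 < C ∧
          Tendsto
            (fun n : ℕ => randomMatrix n p
              {X | ApproximatesPermanent P (zeroOneMatrix X) ε δ ∧
                expectedTime P (inputStore (zeroOneMatrix X) ε δ) ≤
                  ENNReal.ofReal (C * (n : ℝ) ^ (1.5 + α / (p : ℝ)))})
            atTop (𝓝 1) := by
  refine ⟨permanentProgram, fun ε δ hε hδ n X hX =>
    approximatesPermanent_permanentProgram hε hδ hX, fun α ε δ p hα hε hδ hp => ?_⟩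
  refine ⟨64 + 4 * target ε δ + target ε δ * 68 * (2 * Real.exp (4 + 9 / 2 / p)),
    by positivity, ?_⟩
  have hlim : Tendsto (fun n : ℕ => 1 - ENNReal.ofReal
      (4 * (Real.exp (ratioExponent p (tilt p n)) - 1))) atTop (𝓝 1) := by
    have h1 : Tendsto (fun n : ℕ => 4 * (Real.exp (ratioExponent p (tilt p n)) - 1)) atTop
        (𝓝 (4 * (Real.exp 0 - 1))) :=
      ((((Real.continuous_exp.tendsto 0).comp
        ((tendsto_ratioExponent p hp).comp (tendsto_tilt p))).sub_const 1).const_mul 4)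
    have h2 := ENNReal.tendsto_ofReal h1
    simp only [Real.exp_zero, sub_self, mul_zero, ENNReal.ofReal_zero] at h2
    simpa using ENNReal.Tendsto.sub tendsto_const_nhds h2 (Or.inl ENNReal.one_ne_top)
  refine tendsto_of_tendsto_of_tendsto_of_le_of_le' hlim tendsto_const_nhds ?_
    (Eventually.of_forall fun n => prob_le_one)
  filter_upwards [eventually_ge_atTop 2] with n hn
  -- Both properties hold on the event that the weighted permanent is at least half its mean, which
  -- also forces the permanent to be positive.
  refine (measure_weightedPerm_ge p hp (by omega)).trans (measure_mono fun X hX => ?_)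
  exact ⟨approximatesPermanent_permanentProgram hε hδ (permBound_div_permanent_le p hp hn hX).1,
    expectedTime_le_of_weightedPerm p hp hn hα hε hδ hX⟩
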